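/- **Theorem 5.** Let $T>0$, let $\Omega\subset\mathbb R^2$ and $\Omega_c\subseteq\Omega$ be Lipschitz polygons (bounded open sets with polygonal Lipschitz boundary), and let $\sigma,\mu$ be measurable with $0<\sigma_{\min}\le\sigma\le\sigma_{\max}$ a.e. in $\Omega_c$ and $0<\mu_{\min}\le\mu\le\mu_{\max}$ a.e. in $\Omega$. Write $\|w\|_{\sigma,\Omega_c}^2:=\int_{\Omega_c}\sigma|w|^2$, and let $H_0^1(\Omega)$ carry the $H^1(\Omega)$-norm. Let $\{\mathcal T_h\}_h$ be a shape-regular family of conforming triangular meshes of $\overline\Omega$, each triangle of which is contained either in $\overline{\Omega}_c$ or in $\overline{\Omega\setminus\overline{\Omega}_c}$, and let $X_h:=\{v\in C^0(\overline\Omega): v|_K\in\mathbb P_1(K)\ \forall K\in\mathcal T_h\}\cap H_0^1(\Omega)$. Let $J\in L^2(0,T;L^2(\Omega))$, $u_0\in H_0^1(\Omega)$, and let $u\in L^2(0,T;H_0^1(\Omega))$ solve $$\frac{d}{dt}\int_{\Omega_c}\sigma\,u\,v+\int_\Omega\frac1\mu\nabla u\cdot\nabla v=\int_\Omega J\,v\quad\text{in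 }\mathcal D'(0,T),\ \forall v\in H_0^1(\Omega),\qquad u(0)=u_0\ \text{ in }\Omega_c .$$ For $N\ge1$ put $\Delta t:=T/N$, $t_n:=n\Delta t$, $\overline\partial u_h^n:=(u_h^n-u_h^{n-1})/\Delta t$, and let $u_h^0=u_{0,h}\in X_h$ and $u_h^n\in X_h$, $n=1,\dots,N$, satisfy $$\int_{\Omega_c}\sigma\,\overline\partial u_h^n\,v+\int_\Omega\frac1\mu\nabla u_h^n\cdot\nabla v=\int_\Omega J(t_n)\,v\qquad\forall v\in X_h .$$ Assume $u\in H^1(0,T;H_0^1(\Omega))\cap H^2(0,T;L^2(\Omega))$. (The values at $t_n$ of $u$, of $\partial_tu$ as an $L^2(\Omega)$-valued function, and of $t\mapsto\int_\Omega J(t)v$ are those of the continuous representatives on $[0,T]$.) Then there is a constant $C>0$, independent of the mesh, of $\Delta t$, and of $u$, $u_0$, $u_{0,h}$, $J$, such that $$\begin{aligned} &\max_{1\le n\le N}\|u(t_n)-u_h^n\|_{\sigma,\Omega_c}^2+\Delta t\sum_{n=1}^N\|u(t_n)-u_h^n\|_{H_0^1(\Omega)}^2+\Delta t\sum_{n=1}^N\|\partial_tu(t_n)-\overline\partial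 u_h^n\|_{\sigma,\Omega_c}^2\\ &\quad\le C\Big\{\|u_0-u_{0,h}\|_{H_0^1(\Omega)}^2+\max_{0\le n\le N}\Big[\inf_{v\in X_h}\|u(t_n)-v\|_{H_0^1(\Omega)}^2\Big]+\int_0^T\inf_{v\in X_h}\|\partial_tu(t)-v\|_{H_0^1(\Omega)}^2\,dt+(\Delta t)^2\int_0^T\|\partial_{tt}u(t)\|_{L^2(\Omega)}^2\,dt\Big\}. \end{aligned}$$ -/

import Mathlib

open MeasureTheory Set
open scoped ContDiff RealInnerProductSpace NNReal

noncomputable section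

/-! ### The plane, `L²(Ω)` and `H¹₀(Ω)` -/

/-- The plane with its Euclidean norm. -/
abbrev Plane : Type := EuclideanSpace ℝ (Fin 2)

/-- `L²(Ω)`, real valued. -/
abbrev L2 (Ω : Set Plane) : Type := Lp ℝ 2 (volume.restrict Ω)

/-- `L²(Ω)²`, vector fields. -/
abbrev L2Vec (Ω : Set Plane) : Type := Lp Plane 2 (volume.restrict Ω)

/-- `L²(Ω) × L²(Ω)²` with the norm `(‖f‖² + ‖F‖²)^(1/2)`. -/
abbrev L2Pair (Ω : Set Plane) : Type := WithLp 2 (L2 Ω × L2Vec Ω)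

/-- The pairs `(φ, ∇φ)` with `φ` smooth and compactly supported in `Ω`. -/
def testPairs (Ω : Set Plane) : Set (L2Pair Ω) :=
  {z | ∃ φ : Plane → ℝ, ContDiff ℝ ∞ φ ∧ HasCompactSupport φ ∧ tsupport φ ⊆ Ω ∧
    z.fst =ᵐ[volume.restrict Ω] φ ∧ z.snd =ᵐ[volume.restrict Ω] gradient φ}

/-- `H¹₀(Ω)`: the closure of the smooth compactly supported functions in the norm
`(‖v‖² + ‖∇v‖²)^(1/2)` of `H¹(Ω)`; an element is recorded as the pair `(v, ∇v)` of the function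
and its weak gradient. The norm and inner product are those of `H¹(Ω)`. -/
def H01 (Ω : Set Plane) : Submodule ℝ (L2Pair Ω) :=
  (Submodule.span ℝ (testPairs Ω)).topologicalClosure

section Space

variable {Ω : Set Plane}

/-- The underlying function of an element of `H¹₀(Ω)`, i.e. the embedding into `L²(Ω)`. -/
def toL2 (v : H01 Ω) : L2 Ω := (v : L2Pair Ω).fst

/-- The weak gradient of an element of `H¹₀(Ω)`. -/
def wgrad (v : H01 Ω) : L2Vec Ω := (v : L2Pair Ω).snd

/-! ### Lipschitz polygons, triangulations and P1 elements -/

/-- A bounded open set whose boundary lies in finitely many segments and is locally, in suitable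
orthonormal coordinates, the graph of a Lipschitz function with the set on one side of it. -/
def IsLipschitzPolygon (D : Set Plane) : Prop :=
  IsOpen D ∧ Bornology.IsBounded D ∧
  (∃ S : Finset (Plane × Plane), frontier D ⊆ ⋃ p ∈ S, segment ℝ p.1 p.2) ∧
  ∀ x ∈ frontier D, ∃ (e : Plane ≃ₗᵢ[ℝ] Plane) (γ : ℝ → ℝ) (L : ℝ≥0) (r : ℝ),
    0 < r ∧ LipschitzWith L γ ∧ ∀ y ∈ Metric.ball x r, (y ∈ D ↔ γ (e y 0) < e y 1)

/-- A conforming mesh of triangles of `Ω`, each of them contained in the closure of `Ωc` or in the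
closure of `Ω \ closure Ωc`. A triangle is given by its set of vertices. -/
structure TriMesh (Ω Ωc : Set Plane) where
  /-- the triangles -/
  cells : Finset (Finset Plane)
  card_eq : ∀ K ∈ cells, K.card = 3
  indep : ∀ K ∈ cells, AffineIndependent ℝ (fun p : K => (p : Plane))
  covers : ⋃ K ∈ cells, convexHull ℝ (K : Set Plane) = closure Ω
  conforming : ∀ K ∈ cells, ∀ L ∈ cells,
    convexHull ℝ (K : Set Plane) ∩ convexHull ℝ (L : Set Plane) =
      convexHull ℝ ((K : Set Plane) ∩ (L : Set Plane))
  fitted : ∀ K ∈ cells, convexHull ℝ (K : Set Plane) ⊆ closure Ωc ∨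
    convexHull ℝ (K : Set Plane) ⊆ closure (Ω \ closure Ωc)

/-- A regular (shape-regular) family of meshes: the ratio of the diameter of a triangle to the
radius of a disc contained in it is bounded, uniformly over all triangles of all meshes. -/
def IsRegularFamily {Ωc : Set Plane} {ι : Type*} (𝒯 : ι → TriMesh Ω Ωc) : Prop :=
  ∃ κ : ℝ, ∀ i, ∀ K ∈ (𝒯 i).cells, ∃ (x : Plane) (r : ℝ), 0 < r ∧
    Metric.closedBall x r ⊆ convexHull ℝ (K : Set Plane) ∧
    Metric.diam (convexHull ℝ (K : Set Plane)) ≤ κ * r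

/-- The P1 Lagrange space: the functions of `H¹₀(Ω)` that are continuous on the closure of `Ω` and
polynomials of degree at most one on each triangle. -/
def P1 {Ωc : Set Plane} (𝒯 : TriMesh Ω Ωc) : Submodule ℝ (H01 Ω) where
  carrier := {v | ∃ f : Plane → ℝ, ContinuousOn f (closure Ω) ∧
    (∀ K ∈ 𝒯.cells, ∃ (a : ℝ) (b : Plane), ∀ x ∈ convexHull ℝ (K : Set Plane), f x = a + ⟪b, x⟫) ∧
    toL2 v =ᵐ[volume.restrict Ω] f}
  zero_mem' := by
    refine ⟨fun _ => 0, continuousOn_const, fun K _ => ⟨0, 0, fun x _ => by simp⟩, ?_⟩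
    exact Lp.coeFn_zero _ _ _
  add_mem' := by
    rintro v w ⟨f, hf, hfK, hvf⟩ ⟨g, hg, hgK, hwg⟩
    refine ⟨fun x => f x + g x, hf.add hg, fun K hK => ?_, ?_⟩
    · obtain ⟨a, b, h⟩ := hfK K hK
      obtain ⟨a', b', h'⟩ := hgK K hK
      refine ⟨a + a', b + b', fun x hx => ?_⟩
      simp only [h x hx, h' x hx, inner_add_left]
      ring
    · have h := Lp.coeFn_add (toL2 v) (toL2 w)
      filter_upwards [h, hvf, hwg] with x hx h1 h2
      have : toL2 (v + w) = toL2 v + toL2 w := rfl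
      rw [this, hx, Pi.add_apply, h1, h2]
  smul_mem' := by
    rintro c v ⟨f, hf, hfK, hvf⟩
    refine ⟨fun x => c * f x, continuousOn_const.mul hf, fun K hK => ?_, ?_⟩
    · obtain ⟨a, b, h⟩ := hfK K hK
      refine ⟨c * a, c • b, fun x hx => ?_⟩
      simp only [h x hx, real_inner_smul_left]
      ring
    · have h := Lp.coeFn_smul c (toL2 v)
      filter_upwards [h, hvf] with x hx h1
      have : toL2 (c • v) = c • toL2 v := rfl
      rw [this, hx, Pi.smul_apply, h1, smul_eq_mul]

/-! ### The forms of the eddy-current problem -/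

/-- `∫_{Ωc} σ v w`. -/
def rForm (σ : Plane → ℝ) (Ωc : Set Plane) (v w : L2 Ω) : ℝ :=
  ∫ x in Ωc, σ x * v x * w x

/-- `‖w‖²_{σ,Ωc} = ∫_{Ωc} σ |w|²`. -/
def sigmaNormSq (σ : Plane → ℝ) (Ωc : Set Plane) (w : L2 Ω) : ℝ :=
  ∫ x in Ωc, σ x * |w x| ^ 2

/-- `∫_Ω μ⁻¹ ∇v · ∇w`. -/
def aForm (μ : Plane → ℝ) (v w : H01 Ω) : ℝ :=
  ∫ x in Ω, (μ x)⁻¹ * ⟪wgrad v x, wgrad w x⟫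

/-- `∫_Ω f v`. -/
def load (f : L2 Ω) (v : H01 Ω) : ℝ :=
  ∫ x in Ω, f x * toL2 v x

/-! ### Functions of time -/

/-- Lebesgue measure on `(0,T)`. -/
abbrev timeMeasure (T : ℝ) : Measure ℝ := volume.restrict (Ioo 0 T)

/-- `φ ∈ C₀^∞(0,T)`. -/
def IsTimeTest (T : ℝ) (φ : ℝ → ℝ) : Prop :=
  ContDiff ℝ ∞ φ ∧ HasCompactSupport φ ∧ tsupport φ ⊆ Ioo 0 T

section Time

variable {E : Type*} [NormedAddCommGroup E] [NormedSpace ℝ E]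

/-- `w` is the generalized derivative of `u` on `(0,T)` (used for `u`, `w` in `L²(0,T;E)`). -/
def IsTimeDeriv (T : ℝ) (u w : ℝ → E) : Prop :=
  ∀ φ : ℝ → ℝ, IsTimeTest T φ →
    ∫ t, φ t • w t ∂(timeMeasure T) = -∫ t, deriv φ t • u t ∂(timeMeasure T)

/-- `g` is the continuous representative on `[0,T]` of the class of `u`. -/
def IsContRep (T : ℝ) (u g : ℝ → E) : Prop :=
  ContinuousOn g (Icc 0 T) ∧ u =ᵐ[timeMeasure T] g

/-- The class of `u` has a continuous representative on `[0,T]`, whose value at `t` is `a`. -/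
def HasTimeValue (T : ℝ) (u : ℝ → E) (t : ℝ) (a : E) : Prop :=
  ∃ g : ℝ → E, IsContRep T u g ∧ g t = a

end Time

/-! ### The continuous and the fully discrete problem -/

/-- `u ∈ L²(0,T;H¹₀(Ω))` solves
`d/dt ∫_{Ωc} σ u v + ∫_Ω μ⁻¹ ∇u · ∇v = ∫_Ω J v` in `𝒟'(0,T)` for every `v ∈ H¹₀(Ω)`,
and `u(0) = u₀` in `Ωc`. -/
structure IsEddySolution (T : ℝ) (Ωc : Set Plane) (σ μ : Plane → ℝ) (u₀ : L2 Ω)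
    (J : ℝ → L2 Ω) (u : ℝ → H01 Ω) : Prop where
  memLp : MemLp u 2 (timeMeasure T)
  equation : ∀ (v : H01 Ω) (φ : ℝ → ℝ), IsTimeTest T φ →
    -(∫ t, rForm σ Ωc (toL2 (u t)) (toL2 v) * deriv φ t ∂(timeMeasure T))
      + ∫ t, aForm μ (u t) v * φ t ∂(timeMeasure T)
      = ∫ t, load (J t) v * φ t ∂(timeMeasure T)
  /-- By the equation, `t ↦ ∫_{Ωc} σ u(t) v` has a continuous representative. -/
  initial : ∀ v : H01 Ω,
    HasTimeValue T (fun t => rForm σ Ωc (toL2 (u t)) (toL2 v)) 0 (rForm σ Ωc u₀ (toL2 v))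

/-- The backward Euler scheme with `N` steps of length `Δt = T/N`: `U 0 = u_{0,h} ∈ X_h` is the
given discrete initial value, `U n ∈ X_h` and
`∫_{Ωc} σ (U n - U (n-1))/Δt v + ∫_Ω μ⁻¹ ∇(U n) · ∇v = ∫_Ω J(t_n) v` for `v ∈ X_h`, `1 ≤ n ≤ N`,
where the right-hand side is the value at `t_n = n Δt` of the continuous representative of
`t ↦ ∫_Ω J(t) v` (the plain value at `t_n` when `J` is continuous). -/
structure IsDiscreteSolution (T : ℝ) {Ωc : Set Plane} (σ μ : Plane → ℝ) (J : ℝ → L2 Ω)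
    (𝒯 : TriMesh Ω Ωc) (N : ℕ) (U : ℕ → H01 Ω) : Prop where
  mem : ∀ n ≤ N, U n ∈ P1 𝒯
  equation : ∀ n, 1 ≤ n → n ≤ N → ∀ v ∈ P1 𝒯,
    HasTimeValue T (fun t => load (J t) v) (n * (T / N))
      (rForm σ Ωc (toL2 ((T / N)⁻¹ • (U n - U (n - 1)))) (toL2 v) + aForm μ (U n) v)

end Space

end

/-!
The error splits as `u(tₙ) - Uⁿ = (u(tₙ) - R u(tₙ)) + θⁿ`, where `R` is the Ritz projection of the
stiffness form onto the finite element space. The first part is quasi-optimal by Céa's lemma. The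
discrete part satisfies the scheme with the consistency error `∂̄ R u(tₙ) - ∂ₜu(tₙ)` as data, and a
single energy estimate, with the difference quotient of `θ` as test function
(`backward_euler_energy_le`), bounds `θⁿ` in `H¹₀(Ω)` and its difference quotients in the weighted
norm on `Ωc` by the energy of `θ⁰` and by the consistency error (`consistency_error_le`).

The difficulty is the initial value. The equation is elliptic outside `Ωc`, so the exact initial
value `u(0)` is only known to agree with `u₀` in `Ωc`, whereas the error bound contains `u₀`.
The scheme sees `θ⁰` through its restriction to `Ωc` only, and there `θ⁰` agrees with
`(R u(0) - u(0)) + (u₀ - U⁰)`, whose norm is admissible. It therefore suffices to replace `θ⁰` by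
a finite element function with the same restriction to `Ωc` and a norm bounded by that of any
element of `H¹₀(Ω)` that extends the restriction, with a constant that is uniform in the mesh:
`exists_discrete_extension`.

This discrete extension is a quasi-interpolant. Given `w ∈ H¹₀(Ω)` that coincides in `Ωc` with a
finite element function, nodal values are chosen as follows: the given values on the closure of
`Ωc`, zero on the boundary of `Ω`, and averages of `w` over small balls elsewhere. All of them
differ from `w(x)`, for almost every `x` in a triangle `K` at the node, by at most a constant times
the diameter of `K` times the Hardy–Littlewood maximal function of `|∇w|` at `x`
(`exists_nodal_value`). Hence the gradient of the interpolant is bounded pointwise by that maximal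
function, which is bounded in `L²` by `∇w` (`lintegral_maximalFn_sq_le`), and the Poincaré
inequality concludes. For the boundary nodes one needs exterior balls of comparable radius at all
scales (`exists_exterior_ball`) and that a finite element function in `H¹₀(Ω)` vanishes there
(`vertex_value_eq_zero`); for the comparison of scales one needs that the triangles at a vertex have
comparable diameters (`triDiam_le_of_mem_starCells`), which follows from shape regularity and from
the connectedness of a Lipschitz domain near a boundary point.
-/

open Metric
open scoped ENNReal

set_option linter.unusedSectionVars false

/-! ### The Hardy–Littlewood maximal function in `L²` -/

section Maximal

variable {E : Type*} [NormedAddCommGroup E] [NormedSpace ℝ E] [FiniteDimensional ℝ E]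
  [MeasurableSpace E] [BorelSpace E] (m : Measure E) [m.IsAddHaarMeasure]

/-- The centred Hardy–Littlewood maximal function, over open balls. -/
noncomputable def maximalFn (f : E → ℝ≥0∞) (x : E) : ℝ≥0∞ :=
  ⨆ (r : ℝ) (_ : 0 < r), (∫⁻ y in ball x r, f y ∂m) / m (ball x r)

variable {m}

lemma setLIntegral_ball_le_maximalFn (f : E → ℝ≥0∞) (x : E) {r : ℝ} (hr : 0 < r) :
    ∫⁻ y in ball x r, f y ∂m ≤ m (ball x r) * maximalFn m f x := by
  have h : (∫⁻ y in ball x r, f y ∂m) / m (ball x r) ≤ maximalFn m f x :=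
    le_iSup₂ (f := fun (r : ℝ) (_ : 0 < r) => (∫⁻ y in ball x r, f y ∂m) / m (ball x r)) r hr
  rw [ENNReal.div_le_iff (measure_ball_pos m x hr).ne' measure_ball_lt_top.ne] at h
  rwa [mul_comm]

lemma lowerSemicontinuous_maximalFn (f : E → ℝ≥0∞) :
    LowerSemicontinuous (maximalFn m f) := by
  refine lowerSemicontinuous_iSup fun r => lowerSemicontinuous_iSup fun hr => ?_
  intro x a ha
  change a < (∫⁻ y in ball x r, f y ∂m) / m (ball x r) at ha
  change ∀ᶠ y in nhds x, a < (∫⁻ z in ball y r, f z ∂m) / m (ball y r)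
  have hv0 := (measure_ball_pos m x hr).ne'
  have hvt : m (ball x r) ≠ ⊤ := measure_ball_lt_top.ne
  rw [ENNReal.lt_div_iff_mul_lt (Or.inl hv0) (Or.inl hvt)] at ha
  -- the integral over the ball is the supremum over smaller concentric balls
  have hU : ball x r = ⋃ n : ℕ, ball x (r - 1 / ((n : ℝ) + 1)) := by
    ext y
    simp only [mem_ball, mem_iUnion]
    constructor
    · intro hy
      obtain ⟨n, hn⟩ := exists_nat_one_div_lt (sub_pos.2 hy)
      exact ⟨n, by linarith⟩
    · rintro ⟨n, hn⟩
      have : (0 : ℝ) < 1 / ((n : ℝ) + 1) := by positivity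
      linarith
  have hmono : Monotone fun n : ℕ => ball x (r - 1 / ((n : ℝ) + 1)) := by
    intro a b hab
    apply ball_subset_ball
    have : 1 / ((b : ℝ) + 1) ≤ 1 / ((a : ℝ) + 1) := Nat.one_div_le_one_div hab
    linarith
  have hsup : ∫⁻ y in ball x r, f y ∂m
      = ⨆ n : ℕ, ∫⁻ y in ball x (r - 1 / ((n : ℝ) + 1)), f y ∂m := by
    conv_lhs => rw [hU]
    rw [setLIntegral_iUnion_of_directed]
    exact hmono.directed_le
  rw [hsup] at ha
  obtain ⟨n, hn⟩ := lt_iSup_iff.1 ha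
  have hpos : (0 : ℝ) < 1 / ((n : ℝ) + 1) := by positivity
  filter_upwards [ball_mem_nhds x hpos] with y hy
  have hc : m (ball y r) = m (ball x r) := by
    rw [m.addHaar_ball_center, m.addHaar_ball_center x]
  rw [hc, ENNReal.lt_div_iff_mul_lt (Or.inl hv0) (Or.inl hvt)]
  refine hn.trans_le (lintegral_mono_set ?_)
  apply ball_subset_ball'
  rw [mem_ball, dist_comm] at hy
  linarith

lemma measurable_maximalFn (f : E → ℝ≥0∞) : Measurable (maximalFn m f) :=
  (lowerSemicontinuous_maximalFn f).measurable

lemma maximalFn_mono {f g : E → ℝ≥0∞} (h : ∀ x, f x ≤ g x) (x : E) :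
    maximalFn m f x ≤ maximalFn m g x :=
  iSup₂_mono fun _ _ => ENNReal.div_le_div_right (lintegral_mono h) _

lemma maximalFn_congr_ae {f g : E → ℝ≥0∞} (h : f =ᵐ[m] g) : maximalFn m f = maximalFn m g := by
  funext x
  simp only [maximalFn]
  congr! 4 with r hr
  exact lintegral_congr_ae (ae_restrict_of_ae h)

lemma maximalFn_add_le {f g : E → ℝ≥0∞} (hf : Measurable f) (x : E) :
    maximalFn m (fun y => f y + g y) x ≤ maximalFn m f x + maximalFn m g x := by
  refine iSup₂_le fun r hr => ?_
  rw [lintegral_add_left hf, ENNReal.add_div]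
  exact add_le_add
    (le_iSup₂ (f := fun (r : ℝ) (_ : 0 < r) => (∫⁻ y in ball x r, f y ∂m) / m (ball x r)) r hr)
    (le_iSup₂ (f := fun (r : ℝ) (_ : 0 < r) => (∫⁻ y in ball x r, g y ∂m) / m (ball x r)) r hr)

lemma maximalFn_const_le (c : ℝ≥0∞) (x : E) : maximalFn m (fun _ => c) x ≤ c := by
  refine iSup₂_le fun r hr => ?_
  rw [setLIntegral_const]
  rw [ENNReal.div_le_iff (measure_ball_pos m x hr).ne' measure_ball_lt_top.ne]

/-- The weak type (1,1) bound, from the Vitali covering theorem. -/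
lemma mul_measure_lt_maximalFn_le [Nontrivial E] (f : E → ℝ≥0∞) (a : ℝ≥0∞) :
    a * m {x | a < maximalFn m f x}
      ≤ ENNReal.ofReal (5 ^ Module.finrank ℝ E) * ∫⁻ x, f x ∂m := by
  set d := Module.finrank ℝ E with hd
  have hd1 : 1 ≤ d := Module.finrank_pos
  have h5 : ENNReal.ofReal (5 ^ d) ≠ 0 := by simp
  rcases eq_or_ne a 0 with rfl | ha0
  · simp
  rcases eq_or_ne a ⊤ with rfl | hat
  · simp
  rcases eq_or_ne (∫⁻ x, f x ∂m) ⊤ with hI | hI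
  · rw [hI, ENNReal.mul_top h5]; exact le_top
  have hsel : ∀ x : {x | a < maximalFn m f x}, ∃ r : ℝ, 0 < r ∧
      a * m (ball (x : E) r) < ∫⁻ y in ball (x : E) r, f y ∂m := by
    rintro ⟨x, hx⟩
    obtain ⟨r, hr⟩ := lt_iSup_iff.1 (show a < maximalFn m f x from hx)
    obtain ⟨hr0, hr⟩ := lt_iSup_iff.1 hr
    exact ⟨r, hr0, (ENNReal.lt_div_iff_mul_lt (Or.inl (measure_ball_pos m x hr0).ne')
      (Or.inl measure_ball_lt_top.ne)).1 hr⟩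
  choose r hr0 hr using hsel
  have hB0 := (measure_ball_pos m (0 : E) one_pos).ne'
  have hBt : m (ball (0 : E) 1) ≠ ⊤ := measure_ball_lt_top.ne
  -- Vitali's lemma requires bounded radii: over a large ball the mean of `f` cannot exceed `a`
  have hbound : ∀ x, r x ≤ max 1 ((∫⁻ x, f x ∂m) / (a * m (ball (0 : E) 1))).toReal := by
    intro x
    by_contra! hlt
    have h1 : 1 < r x := (le_max_left _ _).trans_lt hlt
    have h2 := (le_max_right _ _).trans_lt hlt
    have h3 := (hr x).trans_le (setLIntegral_le_lintegral _ _)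
    rw [m.addHaar_ball _ (hr0 x).le] at h3
    have h4 : ENNReal.ofReal (r x) ≤ ENNReal.ofReal (r x ^ d) :=
      ENNReal.ofReal_le_ofReal (le_self_pow₀ h1.le (by omega))
    have h5 : (∫⁻ x, f x ∂m) / (a * m (ball (0 : E) 1)) < ENNReal.ofReal (r x) := by
      rw [ENNReal.lt_ofReal_iff_toReal_lt]
      · exact h2
      · exact ENNReal.div_ne_top hI (mul_ne_zero ha0 hB0)
    rw [ENNReal.div_lt_iff (Or.inl (mul_ne_zero ha0 hB0))
      (Or.inl (ENNReal.mul_ne_top hat hBt))] at h5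
    refine lt_irrefl _ (h5.trans_le (le_trans ?_ h3.le))
    rw [← mul_assoc, mul_comm (ENNReal.ofReal _), mul_assoc]
    gcongr
  obtain ⟨u, -, hdisj, hcov⟩ := Vitali.exists_disjoint_subfamily_covering_enlargement_closedBall
    (univ : Set {x | a < maximalFn m f x}) (fun x => (x : E)) r _ (fun x _ => hbound x) 5
    (by norm_num)
  have hdisj' : u.PairwiseDisjoint fun x => ball (x : E) (r x) :=
    hdisj.mono fun x => ball_subset_closedBall
  have hcount : u.Countable :=
    hdisj'.countable_of_isOpen (fun _ _ => isOpen_ball) (fun x _ => nonempty_ball.2 (hr0 x))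
  have hsub : {x | a < maximalFn m f x} ⊆ ⋃ x ∈ u, closedBall (x : E) (5 * r x) := by
    intro x hx
    obtain ⟨b, hb, hsub⟩ := hcov ⟨x, hx⟩ (mem_univ _)
    exact mem_biUnion hb (hsub (mem_closedBall_self (hr0 _).le))
  have := hcount.to_subtype
  calc a * m {x | a < maximalFn m f x}
      ≤ a * ∑' x : u, m (closedBall (x : E) (5 * r x)) := by
        gcongr
        exact (measure_mono hsub).trans (measure_biUnion_le m hcount _)
    _ = ∑' x : u, ENNReal.ofReal (5 ^ d) * (a * m (ball (x : E) (r x))) := by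
        rw [← ENNReal.tsum_mul_left]
        congr 1
        funext x
        rw [m.addHaar_closedBall _ (by linarith [hr0 x]), m.addHaar_ball _ (hr0 x).le, mul_pow,
          ENNReal.ofReal_mul (by positivity)]
        ring
    _ ≤ ∑' x : u, ENNReal.ofReal (5 ^ d) * ∫⁻ y in ball (x : E) (r x), f y ∂m := by
        gcongr with x
        exact (hr x).le
    _ = ENNReal.ofReal (5 ^ d) * ∫⁻ y in ⋃ x ∈ u, ball (x : E) (r x), f y ∂m := by
        rw [ENNReal.tsum_mul_left, lintegral_biUnion hcount (fun _ _ => measurableSet_ball) hdisj']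
    _ ≤ _ := by
        gcongr
        exact Measure.restrict_le_self

lemma setLIntegral_two_mul_Ioo (c : ℝ≥0) :
    ∫⁻ t in Ioo (0 : ℝ) c, ENNReal.ofReal (2 * t) = (c : ℝ≥0∞) ^ 2 := by
  rw [← ofReal_integral_eq_lintegral_ofReal]
  · rw [← integral_Ioc_eq_integral_Ioo,
      ← intervalIntegral.integral_of_le (NNReal.coe_nonneg c), intervalIntegral.integral_const_mul, integral_id]
    rw [← ENNReal.ofReal_coe_nnreal, ← ENNReal.ofReal_pow (NNReal.coe_nonneg c)]
    congr 1
    ring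
  · exact ((continuous_const.mul continuous_id).integrableOn_Icc).mono_set Ioo_subset_Icc_self
  · filter_upwards [self_mem_ae_restrict measurableSet_Ioo] with t ht
    simp [ht.1.le]

/-- One half of the layer cake formula for squares. -/
lemma sq_le_lintegral_Ioi (b : ℝ≥0∞) :
    b ^ 2 ≤ ∫⁻ t in Ioi (0 : ℝ),
      ENNReal.ofReal (2 * t) * (if ENNReal.ofReal t < b then 1 else 0) := by
  have key : ∀ c : ℝ≥0, (c : ℝ≥0∞) ≤ b → (c : ℝ≥0∞) ^ 2 ≤ ∫⁻ t in Ioi (0 : ℝ),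
      ENNReal.ofReal (2 * t) * (if ENNReal.ofReal t < b then 1 else 0) := by
    intro c hc
    rw [← setLIntegral_two_mul_Ioo]
    refine le_trans (le_of_eq ?_) (lintegral_mono_set (t := Ioi (0 : ℝ)) (s := Ioo (0 : ℝ) c) Ioo_subset_Ioi_self)
    refine setLIntegral_congr_fun measurableSet_Ioo fun t ht => ?_
    have : ENNReal.ofReal t < b := by
      refine lt_of_lt_of_le ?_ hc
      rw [← ENNReal.ofReal_coe_nnreal]
      exact (ENNReal.ofReal_lt_ofReal_iff (ht.1.trans ht.2)).2 ht.2
    simp [this]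
  rcases eq_or_ne b ⊤ with rfl | hb
  · refine le_of_eq_of_le (by simp) (top_le_iff.2 (ENNReal.eq_top_of_forall_nnreal_le fun q => ?_)).ge
    have h := key (max q 1) le_top
    refine le_trans ?_ h
    norm_cast
    exact (le_max_left q 1).trans (le_self_pow₀ (le_max_right _ _) two_ne_zero)
  · lift b to ℝ≥0 using hb
    exact key b le_rfl

lemma lintegral_Ioi_indicator_half_lt (b : ℝ≥0∞) :
    ∫⁻ t in Ioi (0 : ℝ), (if ENNReal.ofReal (t / 2) < b then 1 else 0) ≤ 2 * b := by
  rcases eq_or_ne b ⊤ with rfl | hb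
  · simp
  lift b to ℝ≥0 using hb
  have : ∀ t : ℝ, (if ENNReal.ofReal (t / 2) < b then (1 : ℝ≥0∞) else 0)
      ≤ (Iio (2 * (b : ℝ))).indicator 1 t := by
    intro t
    split_ifs with h
    · have : t ∈ Iio (2 * (b : ℝ)) := by
        by_contra hcon
        rw [mem_Iio, not_lt] at hcon
        refine absurd h (not_lt.2 ?_)
        rw [← ENNReal.ofReal_coe_nnreal]
        exact ENNReal.ofReal_le_ofReal (by linarith)
      simp [indicator_of_mem this]
    · exact bot_le
  refine (lintegral_mono this).trans ?_
  rw [lintegral_indicator_one measurableSet_Iio, Measure.restrict_apply measurableSet_Iio,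
    inter_comm, Ioi_inter_Iio, Real.volume_Ioo, sub_zero, ENNReal.ofReal_mul zero_le_two,
    ENNReal.ofReal_coe_nnreal]
  simp

/-- The Hardy–Littlewood maximal theorem in `L²`: the weak type bound is applied, at each level
`t`, to the part of `f` above `t / 2`, and integrated over `t`. -/
theorem lintegral_maximalFn_sq_le [Nontrivial E] {f : E → ℝ≥0∞} (hf : Measurable f) :
    ∫⁻ x, maximalFn m f x ^ 2 ∂m
      ≤ 8 * ENNReal.ofReal (5 ^ Module.finrank ℝ E) * ∫⁻ x, f x ^ 2 ∂m := by
  set C := ENNReal.ofReal (5 ^ Module.finrank ℝ E) with hC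
  have hM : Measurable (maximalFn m f) := measurable_maximalFn f
  have hlevel : ∀ t ∈ Ioi (0 : ℝ), ENNReal.ofReal (2 * t) * m {x | ENNReal.ofReal t < maximalFn m f x}
      ≤ 4 * C * ∫⁻ x, f x * (if ENNReal.ofReal (t / 2) < f x then 1 else 0) ∂m := by
    intro t ht
    have h1 : {x | ENNReal.ofReal t < maximalFn m f x} ⊆ {x | ENNReal.ofReal (t / 2) < maximalFn m
        (fun x => f x * (if ENNReal.ofReal (t / 2) < f x then 1 else 0)) x} := by
      intro x hx
      by_contra hcon
      simp only [mem_ofPred_eq, not_lt] at hcon hx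
      refine absurd hx (not_lt.2 ?_)
      calc maximalFn m f x ≤ maximalFn m (fun x => ENNReal.ofReal (t / 2) +
            f x * (if ENNReal.ofReal (t / 2) < f x then 1 else 0)) x := by
            refine maximalFn_mono (fun y => ?_) x
            split_ifs with h
            · simp
            · simpa using not_lt.1 h
        _ ≤ ENNReal.ofReal (t / 2) + ENNReal.ofReal (t / 2) :=
            (maximalFn_add_le measurable_const x).trans
              (add_le_add (maximalFn_const_le _ _) hcon)
        _ = ENNReal.ofReal t := by
            rw [← ENNReal.ofReal_add (half_pos ht).le (half_pos ht).le, add_halves]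
    calc ENNReal.ofReal (2 * t) * m {x | ENNReal.ofReal t < maximalFn m f x}
        ≤ (4 * ENNReal.ofReal (t / 2)) * m {x | ENNReal.ofReal (t / 2) < maximalFn m
          (fun x => f x * (if ENNReal.ofReal (t / 2) < f x then 1 else 0)) x} := by
          refine mul_le_mul' (le_of_eq ?_) (measure_mono h1)
          rw [show (4 : ℝ≥0∞) = ENNReal.ofReal 4 by simp, ← ENNReal.ofReal_mul (by norm_num)]
          congr 1
          ring
      _ ≤ 4 * (C * ∫⁻ x, f x * (if ENNReal.ofReal (t / 2) < f x then 1 else 0) ∂m) := by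
          rw [mul_assoc]
          exact mul_le_mul_right (mul_measure_lt_maximalFn_le (m := m) _ _) 4
      _ = _ := by rw [mul_assoc]
  have hms1 : MeasurableSet {p : E × ℝ | ENNReal.ofReal p.2 < maximalFn m f p.1} :=
    measurableSet_lt (by fun_prop) (by fun_prop)
  have hms2 : MeasurableSet {p : E × ℝ | ENNReal.ofReal (p.2 / 2) < f p.1} :=
    measurableSet_lt (by fun_prop) (by fun_prop)
  calc ∫⁻ x, maximalFn m f x ^ 2 ∂m
      ≤ ∫⁻ x, (∫⁻ t in Ioi (0 : ℝ), ENNReal.ofReal (2 * t) *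
          (if ENNReal.ofReal t < maximalFn m f x then 1 else 0)) ∂m :=
        lintegral_mono fun x => sq_le_lintegral_Ioi _
    _ = ∫⁻ t in Ioi (0 : ℝ), ∫⁻ x, ENNReal.ofReal (2 * t) *
          (if ENNReal.ofReal t < maximalFn m f x then 1 else 0) ∂m := by
        refine lintegral_lintegral_swap (Measurable.aemeasurable ?_)
        exact (by fun_prop : Measurable fun p : E × ℝ => ENNReal.ofReal (2 * p.2)).mul
          (Measurable.ite hms1 measurable_const measurable_const)
    _ = ∫⁻ t in Ioi (0 : ℝ), ENNReal.ofReal (2 * t) *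
          m {x | ENNReal.ofReal t < maximalFn m f x} := by
        refine lintegral_congr fun t => ?_
        have hs : MeasurableSet {x | ENNReal.ofReal t < maximalFn m f x} :=
          measurableSet_lt measurable_const hM
        rw [lintegral_const_mul _ (Measurable.ite hs measurable_const measurable_const),
          ← lintegral_indicator_one hs]
        simp [indicator]
    _ ≤ ∫⁻ t in Ioi (0 : ℝ), 4 * C *
          ∫⁻ x, f x * (if ENNReal.ofReal (t / 2) < f x then 1 else 0) ∂m :=
        setLIntegral_mono' measurableSet_Ioi hlevel
    _ = 4 * C * ∫⁻ x, (∫⁻ t in Ioi (0 : ℝ),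
          f x * (if ENNReal.ofReal (t / 2) < f x then 1 else 0)) ∂m := by
        have hmeas : Measurable fun p : E × ℝ =>
            f p.1 * (if ENNReal.ofReal (p.2 / 2) < f p.1 then 1 else 0) :=
          (hf.comp measurable_fst).mul (Measurable.ite hms2 measurable_const measurable_const)
        have hmeas' : Measurable fun t : ℝ =>
            ∫⁻ x, f x * (if ENNReal.ofReal (t / 2) < f x then 1 else 0) ∂m :=
          (hmeas.comp measurable_swap).lintegral_prod_right'
        rw [lintegral_const_mul _ hmeas',
          lintegral_lintegral_swap]
        exact (hmeas.comp measurable_swap).aemeasurable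
    _ ≤ 4 * C * ∫⁻ x, 2 * f x ^ 2 ∂m := by
        gcongr with x
        rw [lintegral_const_mul]
        · calc _ ≤ f x * (2 * f x) := by gcongr; exact lintegral_Ioi_indicator_half_lt _
            _ = 2 * f x ^ 2 := by ring
        · exact Measurable.ite (measurableSet_lt (by fun_prop) measurable_const)
            measurable_const measurable_const
    _ = 8 * C * ∫⁻ x, f x ^ 2 ∂m := by
        rw [lintegral_const_mul _ (hf.pow_const 2)]
        ring

end Maximal

/-! ### Oscillation of a `C¹` function over a ball -/

section Pointwise

variable {E : Type*} [NormedAddCommGroup E] [NormedSpace ℝ E] [FiniteDimensional ℝ E]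
  [MeasurableSpace E] [BorelSpace E] {m : Measure E} [m.IsAddHaarMeasure]

lemma map_dilation (x : E) {t : ℝ} (ht : 0 < t) :
    Measure.map (fun y => x + t • (y - x)) m
      = ENNReal.ofReal ((t ^ Module.finrank ℝ E)⁻¹) • m := by
  have h : (fun y => x + t • (y - x)) = (fun y => (x - t • x) + y) ∘ (fun y => t • y) := by
    funext y
    simp only [Function.comp, smul_sub]
    abel
  rw [h, ← Measure.map_map (measurable_const_add _) (measurable_const_smul t),
    Measure.map_addHaar_smul m ht.ne', Measure.map_smul, map_add_left_eq_self,
    abs_of_pos (by positivity)]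

/-- The averages of `F` over the balls shrinking to `x` are controlled by the maximal function;
the ball `ball x (t * R)` is parametrised by `ball x R`. -/
lemma setLIntegral_dilation_le [Nontrivial E] {F : E → ℝ≥0∞} (hF : Measurable F) (x : E) {t R : ℝ}
    (ht : 0 < t) (hR : 0 < R) :
    ∫⁻ y in ball x R, F (x + t • (y - x)) ∂m ≤ m (ball x R) * maximalFn m F x := by
  have hpre : (fun y => x + t • (y - x)) ⁻¹' ball x (t * R) = ball x R := by
    ext y
    simp only [mem_preimage, mem_ball, dist_eq_norm, add_sub_cancel_left, norm_smul,
      Real.norm_eq_abs, abs_of_pos ht]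
    exact mul_lt_mul_iff_right₀ ht
  have hmeas : Measurable fun y => x + t • (y - x) := by fun_prop
  have h1 : ∫⁻ y in ball x R, F (x + t • (y - x)) ∂m
      = ∫⁻ y in ball x (t * R), F y ∂(Measure.map (fun y => x + t • (y - x)) m) := by
    rw [setLIntegral_map measurableSet_ball hF hmeas, hpre]
  rw [h1, map_dilation x ht, Measure.restrict_smul, lintegral_smul_measure]
  refine (mul_le_mul_right (setLIntegral_ball_le_maximalFn F x (mul_pos ht hR)) _).trans ?_
  rw [m.addHaar_ball _ (mul_pos ht hR).le, m.addHaar_ball _ hR.le, ← mul_assoc,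
    ← mul_assoc, ← ENNReal.ofReal_mul (by positivity), mul_pow, ← mul_assoc,
    inv_mul_cancel₀ (by positivity), one_mul, mul_assoc]

lemma enorm_sub_le_lintegral_fderiv {φ : E → ℝ} (hφ : ContDiff ℝ 1 φ) (x y : E) :
    ‖φ y - φ x‖ₑ ≤ ∫⁻ t in Ioc (0 : ℝ) 1, ‖fderiv ℝ φ (x + t • (y - x))‖ₑ * ‖y - x‖ₑ := by
  have hd : ∀ t : ℝ, HasDerivAt (fun t : ℝ => φ (x + t • (y - x)))
      (fderiv ℝ φ (x + t • (y - x)) (y - x)) t := by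
    intro t
    have h1 : HasDerivAt (fun t : ℝ => x + t • (y - x)) (y - x) t := by
      simpa using ((hasDerivAt_id t).smul_const (y - x)).const_add x
    exact ((hφ.differentiable one_ne_zero _).hasFDerivAt.comp_hasDerivAt t h1)
  have hc : Continuous fun t : ℝ => fderiv ℝ φ (x + t • (y - x)) (y - x) :=
    ((hφ.continuous_fderiv one_ne_zero).comp (by fun_prop)).clm_apply continuous_const
  have h := intervalIntegral.integral_eq_sub_of_hasDerivAt (a := 0) (b := 1)
    (fun t _ => hd t) (hc.intervalIntegrable _ _)
  rw [intervalIntegral.integral_of_le zero_le_one] at h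
  have hxy : φ y - φ x = ∫ t in Ioc (0 : ℝ) 1, fderiv ℝ φ (x + t • (y - x)) (y - x) := by
    rw [h]; simp
  rw [hxy]
  refine (enorm_integral_le_lintegral_enorm _).trans (lintegral_mono fun t => ?_)
  exact ContinuousLinearMap.le_opENorm _ _

/-- The mean oscillation of a `C¹` function around a point, over a ball centred there, is at most
the radius times the maximal function of the gradient. -/
theorem lintegral_ball_enorm_sub_le [Nontrivial E] {φ : E → ℝ} (hφ : ContDiff ℝ 1 φ) (x : E)
    {R : ℝ} (hR : 0 < R) :
    ∫⁻ y in ball x R, ‖φ y - φ x‖ₑ ∂m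
      ≤ ENNReal.ofReal R * (m (ball x R) * maximalFn m (fun y => ‖fderiv ℝ φ y‖ₑ) x) := by
  have hF : Continuous (fderiv ℝ φ) := hφ.continuous_fderiv one_ne_zero
  have hFm : Measurable fun y => ‖fderiv ℝ φ y‖ₑ := hF.enorm.measurable
  calc ∫⁻ y in ball x R, ‖φ y - φ x‖ₑ ∂m
      ≤ ∫⁻ y in ball x R, (∫⁻ t in Ioc (0 : ℝ) 1,
          ‖fderiv ℝ φ (x + t • (y - x))‖ₑ * ENNReal.ofReal R) ∂m := by
        refine setLIntegral_mono' measurableSet_ball fun y hy => ?_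
        refine (enorm_sub_le_lintegral_fderiv hφ x y).trans (lintegral_mono fun t => ?_)
        gcongr
        rw [← ofReal_norm, ← dist_eq_norm]
        exact ENNReal.ofReal_le_ofReal (mem_ball.1 hy).le
    _ = ∫⁻ t in Ioc (0 : ℝ) 1, (∫⁻ y in ball x R,
          ‖fderiv ℝ φ (x + t • (y - x))‖ₑ * ENNReal.ofReal R ∂m) := by
        refine lintegral_lintegral_swap (Continuous.measurable ?_).aemeasurable
        exact (ENNReal.continuous_mul_const ENNReal.ofReal_ne_top).comp
          (hF.comp (by fun_prop : Continuous fun p : E × ℝ => x + p.2 • (p.1 - x))).enorm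
    _ ≤ ∫⁻ t in Ioc (0 : ℝ) 1,
          ENNReal.ofReal R * (m (ball x R) * maximalFn m (fun y => ‖fderiv ℝ φ y‖ₑ) x) := by
        refine setLIntegral_mono' measurableSet_Ioc fun t ht => ?_
        rw [lintegral_mul_const', mul_comm]
        · gcongr
          exact setLIntegral_dilation_le hFm x ht.1 hR
        · exact ENNReal.ofReal_ne_top
    _ = _ := by simp

end Pointwise

/-! ### Extensions by zero and the maximal function of the gradient -/

section Sobolev

variable {Ω : Set Plane}

lemma lintegral_enorm_sq_coeFn {α F : Type*} [MeasurableSpace α] {μ : Measure α}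
    [NormedAddCommGroup F] (f : Lp F 2 μ) :
    ∫⁻ x, ‖f x‖ₑ ^ 2 ∂μ = ENNReal.ofReal (‖f‖ ^ 2) := by
  have h := eLpNorm_nnreal_pow_eq_lintegral (f := f) (μ := μ) (p := 2) two_ne_zero
  have h2 : eLpNorm f 2 μ = ENNReal.ofReal ‖f‖ := by
    rw [Lp.norm_def, ENNReal.ofReal_toReal (Lp.eLpNorm_ne_top f)]
  rw [ENNReal.ofReal_pow (norm_nonneg _), ← h2]
  simpa using h.symm

lemma norm_sq_eq (v : H01 Ω) : ‖v‖ ^ 2 = ‖toL2 v‖ ^ 2 + ‖wgrad v‖ ^ 2 :=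
  WithLp.prod_norm_sq_eq_of_L2 (v : L2Pair Ω)

lemma enorm_gradient {φ : Plane → ℝ} (x : Plane) :
    ‖gradient φ x‖ₑ = ‖fderiv ℝ φ x‖ₑ := by
  rw [← ofReal_norm, ← ofReal_norm, gradient, LinearIsometryEquiv.norm_map]

lemma gradient_linComb {φ ψ : Plane → ℝ} {x : Plane} (hφ : DifferentiableAt ℝ φ x)
    (hψ : DifferentiableAt ℝ ψ x) (c : ℝ) :
    gradient (fun y => φ y + c * ψ y) x = gradient φ x + c • gradient ψ x := by
  simp only [gradient]
  rw [fderiv_fun_add hφ (hψ.const_mul c), fderiv_const_mul hψ c, map_add, map_smul]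

lemma add_smul_mem_testPairs {z z' : L2Pair Ω} (hz : z ∈ testPairs Ω) (hz' : z' ∈ testPairs Ω)
    (c : ℝ) : z + c • z' ∈ testPairs Ω := by
  obtain ⟨φ, hφ, hφc, hφs, h1, h2⟩ := hz
  obtain ⟨ψ, hψ, hψc, hψs, h3, h4⟩ := hz'
  refine ⟨fun y => φ y + c * ψ y, hφ.add (contDiff_const.mul hψ), hφc.add hψc.mul_left, ?_, ?_, ?_⟩
  · refine (tsupport_add φ (fun y => c * ψ y)).trans (union_subset hφs ?_)
    exact (tsupport_mul_subset_right (f := fun _ => c)).trans hψs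
  · have e1 : (z + c • z').fst = z.fst + c • z'.fst := rfl
    filter_upwards [Lp.coeFn_add z.fst (c • z'.fst), Lp.coeFn_smul c z'.fst, h1, h3]
      with x ha hb hc hd
    rw [e1, ha, Pi.add_apply, hb, Pi.smul_apply, hc, hd, smul_eq_mul]
  · have e1 : (z + c • z').snd = z.snd + c • z'.snd := rfl
    filter_upwards [Lp.coeFn_add z.snd (c • z'.snd), Lp.coeFn_smul c z'.snd, h2, h4]
      with x ha hb hc hd
    rw [e1, ha, Pi.add_apply, hb, Pi.smul_apply, hc, hd,
      gradient_linComb (hφ.differentiable (by simp) x) (hψ.differentiable (by simp) x)]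

lemma zero_mem_testPairs : (0 : L2Pair Ω) ∈ testPairs Ω := by
  refine ⟨fun _ => 0, contDiff_const, HasCompactSupport.zero, ?_, ?_, ?_⟩
  · simp [tsupport, Function.support_fun_zero]
  · exact Lp.coeFn_zero _ _ _
  · filter_upwards [Lp.coeFn_zero Plane 2 (volume.restrict Ω)] with x hx
    have e1 : (0 : L2Pair Ω).snd = 0 := rfl
    rw [e1, hx]
    simp [gradient]

lemma mem_testPairs_of_mem_span {z : L2Pair Ω} (hz : z ∈ Submodule.span ℝ (testPairs Ω)) :
    z ∈ testPairs Ω := by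
  induction hz using Submodule.span_induction with
  | mem x h => exact h
  | zero => exact zero_mem_testPairs
  | add x y _ _ hx hy => simpa using add_smul_mem_testPairs hx hy 1
  | smul a x _ hx => simpa using add_smul_mem_testPairs zero_mem_testPairs hx a

/-- The extension by zero of an element of `H¹₀(Ω)` to the plane. -/
noncomputable def zeroExt (w : H01 Ω) : Plane → ℝ := indicator Ω (toL2 w)

/-- The length of the weak gradient, extended by zero to the plane. -/
noncomputable def gradExt (w : H01 Ω) : Plane → ℝ≥0∞ := indicator Ω fun x => ‖wgrad w x‖ₑ

/-- The maximal function of the length of the weak gradient. -/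
noncomputable def gradMax (w : H01 Ω) (x : Plane) : ℝ := (maximalFn volume (gradExt w) x).toReal

lemma measurable_zeroExt (hΩ : MeasurableSet Ω) (w : H01 Ω) : Measurable (zeroExt w) :=
  (Lp.stronglyMeasurable (toL2 w)).measurable.indicator hΩ

lemma measurable_gradExt (hΩ : MeasurableSet Ω) (w : H01 Ω) : Measurable (gradExt w) :=
  (Lp.stronglyMeasurable (wgrad w)).enorm.indicator hΩ

lemma lintegral_gradExt_sq (hΩ : MeasurableSet Ω) (w : H01 Ω) :
    ∫⁻ x, gradExt w x ^ 2 = ENNReal.ofReal (‖wgrad w‖ ^ 2) := by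
  rw [← lintegral_enorm_sq_coeFn, ← lintegral_indicator hΩ]
  refine lintegral_congr fun x => ?_
  by_cases hx : x ∈ Ω <;> simp [gradExt, hx]

lemma lintegral_zeroExt_sq (hΩ : MeasurableSet Ω) (w : H01 Ω) :
    ∫⁻ x, ‖zeroExt w x‖ₑ ^ 2 = ENNReal.ofReal (‖toL2 w‖ ^ 2) := by
  rw [← lintegral_enorm_sq_coeFn, ← lintegral_indicator hΩ]
  refine lintegral_congr fun x => ?_
  by_cases hx : x ∈ Ω <;> simp [zeroExt, hx]

lemma lintegral_maximalFn_gradExt_sq_le (hΩ : MeasurableSet Ω) (w : H01 Ω) :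
    ∫⁻ x, maximalFn volume (gradExt w) x ^ 2 ≤ ENNReal.ofReal (200 * ‖wgrad w‖ ^ 2) := by
  refine (lintegral_maximalFn_sq_le (measurable_gradExt hΩ w)).trans (le_of_eq ?_)
  rw [lintegral_gradExt_sq hΩ, ENNReal.ofReal_mul (by norm_num), finrank_euclideanSpace_fin]
  congr 1
  rw [show (8 : ℝ≥0∞) = ENNReal.ofReal 8 by simp, ← ENNReal.ofReal_mul (by norm_num)]
  norm_num

lemma maximalFn_gradExt_lt_top (hΩ : MeasurableSet Ω) (w : H01 Ω) :
    ∀ᵐ x, maximalFn volume (gradExt w) x < ⊤ := by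
  have h := ae_lt_top (μ := volume) ((measurable_maximalFn (m := volume) (gradExt w)).pow_const 2)
    (ne_top_of_le_ne_top ENNReal.ofReal_ne_top (lintegral_maximalFn_gradExt_sq_le hΩ w))
  filter_upwards [h] with x hx
  by_contra hcon
  rw [not_lt_top_iff] at hcon
  simp [hcon] at hx

lemma gradMax_nonneg (w : H01 Ω) (x : Plane) : 0 ≤ gradMax w x := ENNReal.toReal_nonneg

lemma measurable_gradMax (w : H01 Ω) : Measurable (gradMax w) :=
  (measurable_maximalFn (gradExt w)).ennreal_toReal

lemma integrable_gradMax_sq (hΩ : MeasurableSet Ω) (w : H01 Ω) :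
    Integrable fun x => gradMax w x ^ 2 := by
  refine ⟨((measurable_gradMax w).pow_const 2).aestronglyMeasurable, ?_⟩
  refine lt_of_le_of_lt (lintegral_mono fun x => ?_)
    ((lintegral_maximalFn_gradExt_sq_le hΩ w).trans_lt ENNReal.ofReal_lt_top)
  rw [enorm_pow, gradMax, ← ofReal_norm, Real.norm_of_nonneg ENNReal.toReal_nonneg]
  gcongr
  exact ENNReal.ofReal_toReal_le

lemma integral_gradMax_sq_le (hΩ : MeasurableSet Ω) (w : H01 Ω) :
    ∫ x, gradMax w x ^ 2 ≤ 200 * ‖wgrad w‖ ^ 2 := by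
  rw [integral_eq_lintegral_of_nonneg_ae (Filter.Eventually.of_forall fun x => sq_nonneg _)
    ((measurable_gradMax w).pow_const 2).aestronglyMeasurable]
  refine ENNReal.toReal_le_of_le_ofReal (by positivity)
    (le_trans (lintegral_mono fun x => ?_) (lintegral_maximalFn_gradExt_sq_le hΩ w))
  rw [ENNReal.ofReal_pow (gradMax_nonneg _ _), gradMax]
  gcongr
  exact ENNReal.ofReal_toReal_le

/-- Density of the test functions, in terms of the extensions by zero. -/
lemma exists_test_lintegral_sub_lt (hΩ : MeasurableSet Ω) (w : H01 Ω) {ε : ℝ} (hε : 0 < ε) :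
    ∃ φ : Plane → ℝ, ContDiff ℝ ∞ φ ∧ HasCompactSupport φ ∧ tsupport φ ⊆ Ω ∧
      ∫⁻ x, ‖zeroExt w x - φ x‖ₑ ^ 2 ≤ ENNReal.ofReal ε ∧
      ∃ z : H01 Ω, wgrad z =ᵐ[volume.restrict Ω] gradient φ ∧
        ‖wgrad (w - z)‖ ^ 2 ≤ ε := by
  have hw : (w : L2Pair Ω) ∈ closure (Submodule.span ℝ (testPairs Ω) : Set (L2Pair Ω)) := w.2
  obtain ⟨z, hz, hzw⟩ := Metric.mem_closure_iff.1 hw (Real.sqrt ε) (Real.sqrt_pos.2 hε)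
  have hzH : z ∈ H01 Ω := Submodule.le_topologicalClosure _ hz
  obtain ⟨φ, hφ, hφc, hφs, h1, h2⟩ := mem_testPairs_of_mem_span hz
  have hn : ‖w - ⟨z, hzH⟩‖ ^ 2 < ε := by
    have : ‖w - ⟨z, hzH⟩‖ = dist (w : L2Pair Ω) z := (dist_eq_norm _ _).symm
    rw [this]
    exact (Real.lt_sqrt dist_nonneg).1 hzw
  rw [norm_sq_eq] at hn
  refine ⟨φ, hφ, hφc, hφs, ?_, ⟨z, hzH⟩, h2, by nlinarith [sq_nonneg ‖toL2 (w - ⟨z, hzH⟩)‖]⟩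
  have h3 : ∫⁻ x, ‖zeroExt w x - φ x‖ₑ ^ 2 = ENNReal.ofReal (‖toL2 (w - ⟨z, hzH⟩)‖ ^ 2) := by
    rw [← lintegral_enorm_sq_coeFn, ← lintegral_indicator hΩ]
    have e1 : toL2 (w - ⟨z, hzH⟩) = toL2 w - z.fst := rfl
    have h4 := (ae_restrict_iff' hΩ).1 h1
    have h5 := (ae_restrict_iff' hΩ).1 (Lp.coeFn_sub (toL2 w) z.fst)
    refine lintegral_congr_ae ?_
    filter_upwards [h4, h5] with x h4 h5
    by_cases hx : x ∈ Ω
    · simp only [zeroExt, indicator_of_mem hx]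
      rw [e1, h5 hx, Pi.sub_apply, h4 hx]
    · have : φ x = 0 := by
        by_contra hne
        exact hx (hφs (subset_tsupport _ hne))
      simp [zeroExt, hx, this]
  rw [h3]
  exact ENNReal.ofReal_le_ofReal (by nlinarith [sq_nonneg ‖wgrad (w - ⟨z, hzH⟩)‖])

end Sobolev

/-! ### Oscillation of elements of `H¹₀(Ω)` -/

section Oscillation

variable {Ω : Set Plane}

lemma maximalFn_fderiv_le (hΩ : MeasurableSet Ω) (w z : H01 Ω) {φ : Plane → ℝ}
    (hφs : tsupport φ ⊆ Ω) (hz : wgrad z =ᵐ[volume.restrict Ω] gradient φ) (x : Plane) :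
    maximalFn volume (fun y => ‖fderiv ℝ φ y‖ₑ) x
      ≤ maximalFn volume (gradExt w) x + maximalFn volume (gradExt (w - z)) x := by
  have e1 : wgrad (w - z) = wgrad w - wgrad z := rfl
  have h1 : (fun y => ‖fderiv ℝ φ y‖ₑ) =ᵐ[volume] gradExt z := by
    filter_upwards [(ae_restrict_iff' hΩ).1 hz] with y hy
    by_cases hyΩ : y ∈ Ω
    · rw [gradExt, indicator_of_mem hyΩ, hy hyΩ, enorm_gradient]
    · rw [gradExt, indicator_of_notMem hyΩ]
      have : fderiv ℝ φ y = 0 :=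
        image_eq_zero_of_notMem_tsupport fun h => hyΩ (hφs (tsupport_fderiv_subset ℝ h))
      rw [← ofReal_norm, this, norm_zero, ENNReal.ofReal_zero]
  have h2 : gradExt z =ᵐ[volume] fun y => min (gradExt z y) (gradExt w y + gradExt (w - z) y) := by
    filter_upwards [(ae_restrict_iff' hΩ).1 (Lp.coeFn_sub (wgrad w) (wgrad z))] with y hy
    refine (min_eq_left ?_).symm
    by_cases hyΩ : y ∈ Ω
    · simp only [gradExt, indicator_of_mem hyΩ]
      rw [e1, hy hyΩ, Pi.sub_apply]
      calc ‖wgrad z y‖ₑ = ‖wgrad w y - (wgrad w y - wgrad z y)‖ₑ := by rw [sub_sub_cancel]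
        _ ≤ _ := enorm_sub_le
    · simp [gradExt, hyΩ]
  rw [maximalFn_congr_ae h1, maximalFn_congr_ae h2]
  exact (maximalFn_mono (fun y => min_le_right _ _) x).trans
    (maximalFn_add_le (measurable_gradExt hΩ w) x)

lemma ennreal_le_add_mul_sq (a : ℝ≥0∞) (k : ℕ) :
    a ≤ ENNReal.ofReal ((1 / 2) ^ k) + ENNReal.ofReal (2 ^ k) * a ^ 2 := by
  rcases le_total a (ENNReal.ofReal ((1 / 2) ^ k)) with h | h
  · exact h.trans le_self_add
  · refine le_trans ?_ le_add_self
    have h1 : 1 ≤ ENNReal.ofReal (2 ^ k) * a := by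
      calc (1 : ℝ≥0∞) = ENNReal.ofReal (2 ^ k) * ENNReal.ofReal ((1 / 2) ^ k) := by
            rw [← ENNReal.ofReal_mul (by positivity), ← mul_pow]; norm_num
        _ ≤ _ := by gcongr
    calc a = 1 * a := (one_mul a).symm
      _ ≤ (ENNReal.ofReal (2 ^ k) * a) * a := by gcongr
      _ = _ := by ring

/-- The bound of `lintegral_ball_enorm_sub_le` passes to `H¹₀(Ω)`: along a sequence of test
functions converging fast enough, both the functions and the maximal functions of the gradients
of the differences converge almost everywhere. -/
theorem ae_lintegral_ball_zeroExt_sub_le (hΩ : MeasurableSet Ω) (w : H01 Ω) (y₀ : Plane)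
    (ρ : ℝ) {R : ℝ} (hR : 0 < R) :
    ∀ᵐ x, ball y₀ ρ ⊆ ball x R →
      ∫⁻ y in ball y₀ ρ, ‖zeroExt w y - zeroExt w x‖ₑ
        ≤ ENNReal.ofReal R * (volume (ball x R) * maximalFn volume (gradExt w) x) := by
  choose φ hφ hφc hφs ha z hz hzw using fun k : ℕ =>
    exists_test_lintegral_sub_lt hΩ w (ε := (1 / 4) ^ k) (by positivity)
  set a : ℕ → Plane → ℝ≥0∞ := fun k x => ‖zeroExt w x - φ k x‖ₑ with ha_def
  set g : ℕ → Plane → ℝ≥0∞ := fun k => maximalFn volume (gradExt (w - z k)) with hg_def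
  have ham : ∀ k, Measurable (a k) := fun k =>
    ((measurable_zeroExt hΩ w).sub (hφ k).continuous.measurable).enorm
  have hgm : ∀ k, Measurable (g k) := fun k => measurable_maximalFn _
  -- the squared errors are summable in mean, hence tend to zero almost everywhere
  have hsum : ∫⁻ x, ∑' k, (a k x ^ 2 + g k x ^ 2) ≠ ⊤ := by
    rw [lintegral_tsum (f := fun k x => a k x ^ 2 + g k x ^ 2)
      fun k => (((ham k).pow_const 2).add ((hgm k).pow_const 2)).aemeasurable]
    have hk : ∀ k, ∫⁻ x, (a k x ^ 2 + g k x ^ 2) ≤ ENNReal.ofReal (201 * (1 / 4) ^ k) := by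
      intro k
      rw [lintegral_add_left ((ham k).pow_const 2)]
      have h1 : ∫⁻ x, g k x ^ 2 ≤ ENNReal.ofReal (200 * (1 / 4) ^ k) :=
        (lintegral_maximalFn_gradExt_sq_le hΩ (w - z k)).trans
          (ENNReal.ofReal_le_ofReal (by linarith [hzw k]))
      refine (add_le_add (ha k) h1).trans (le_of_eq ?_)
      rw [← ENNReal.ofReal_add (by positivity) (by positivity)]
      congr 1
      ring
    refine ne_top_of_le_ne_top ?_ (ENNReal.tsum_le_tsum hk)
    exact (((summable_geometric_of_lt_one (by norm_num) (by norm_num)).mul_left _)).tsum_ofReal_ne_top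
  have hae := ae_lt_top' (Measurable.aemeasurable
    (Measurable.tsum (f := fun k x => a k x ^ 2 + g k x ^ 2)
      fun k => ((ham k).pow_const 2).add ((hgm k).pow_const 2))) hsum
  filter_upwards [hae] with x hx hball
  have hlim := ENNReal.tendsto_atTop_zero_of_tsum_ne_top hx.ne
  have hroot : ∀ s : ℕ → ℝ≥0∞, (∀ k, s k ^ 2 ≤ a k x ^ 2 + g k x ^ 2) →
      Filter.Tendsto s Filter.atTop (nhds 0) := by
    intro s hs
    have h2 : Filter.Tendsto (fun k => s k ^ 2) Filter.atTop (nhds 0) :=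
      tendsto_of_tendsto_of_tendsto_of_le_of_le tendsto_const_nhds hlim (fun _ => bot_le) hs
    have h3 := h2.ennrpow_const (1 / 2)
    rw [ENNReal.zero_rpow_of_pos (by norm_num)] at h3
    refine h3.congr fun k => ?_
    rw [← ENNReal.rpow_natCast, ← ENNReal.rpow_mul]
    norm_num
  have hax : Filter.Tendsto (fun k => a k x) Filter.atTop (nhds 0) :=
    hroot _ fun k => le_self_add
  have hgx : Filter.Tendsto (fun k => g k x) Filter.atTop (nhds 0) :=
    hroot _ fun k => le_add_self
  set V := volume (ball y₀ ρ) with hV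
  have hVt : V ≠ ⊤ := measure_ball_lt_top.ne
  have hVR : volume (ball x R) ≠ ⊤ := measure_ball_lt_top.ne
  have hb : ∀ k, ∫⁻ y in ball y₀ ρ, a k y ≤ ENNReal.ofReal ((1 / 2) ^ k) * (V + 1) := by
    intro k
    calc ∫⁻ y in ball y₀ ρ, a k y
        ≤ ∫⁻ y in ball y₀ ρ, (ENNReal.ofReal ((1 / 2) ^ k) + ENNReal.ofReal (2 ^ k) * a k y ^ 2) :=
          lintegral_mono fun y => ennreal_le_add_mul_sq _ _
      _ ≤ ENNReal.ofReal ((1 / 2) ^ k) * V + ENNReal.ofReal (2 ^ k) * ENNReal.ofReal ((1 / 4) ^ k) := by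
          rw [lintegral_add_left measurable_const, lintegral_const_mul _ ((ham k).pow_const 2),
            setLIntegral_const]
          gcongr
          exact (setLIntegral_le_lintegral _ _).trans (ha k)
      _ = _ := by
          rw [← ENNReal.ofReal_mul (by positivity), ← mul_pow, mul_add, mul_one]
          norm_num
  have hmain : ∀ k, ∫⁻ y in ball y₀ ρ, ‖zeroExt w y - zeroExt w x‖ₑ
      ≤ ENNReal.ofReal ((1 / 2) ^ k) * (V + 1) + ENNReal.ofReal R * (volume (ball x R) *
          (maximalFn volume (gradExt w) x + g k x)) + V * a k x := by
    intro k
    calc ∫⁻ y in ball y₀ ρ, ‖zeroExt w y - zeroExt w x‖ₑ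
        ≤ ∫⁻ y in ball y₀ ρ, (a k y + ‖φ k y - φ k x‖ₑ + a k x) := by
          refine lintegral_mono fun y => ?_
          have e : zeroExt w y - zeroExt w x
              = (zeroExt w y - φ k y) + (φ k y - φ k x) - (zeroExt w x - φ k x) := by ring
          dsimp only
          rw [e]
          exact enorm_sub_le.trans (add_le_add_left (enorm_add_le _ _) _)
      _ = (∫⁻ y in ball y₀ ρ, a k y) + (∫⁻ y in ball y₀ ρ, ‖φ k y - φ k x‖ₑ) + V * a k x := by
          rw [lintegral_add_right _ measurable_const, lintegral_add_left (ham k),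
            setLIntegral_const, mul_comm V]
      _ ≤ _ := by
          refine add_le_add (add_le_add (hb k) ?_) le_rfl
          refine (lintegral_mono_set hball).trans ?_
          refine (lintegral_ball_enorm_sub_le ((hφ k).of_le (by simp)) x hR).trans ?_
          gcongr
          exact maximalFn_fderiv_le hΩ w (z k) (hφs k) (hz k) x
  have hlim1 : Filter.Tendsto (fun k : ℕ => ENNReal.ofReal ((1 / 2) ^ k)) Filter.atTop (nhds 0) := by
    have := ENNReal.tendsto_ofReal
      (tendsto_pow_atTop_nhds_zero_of_lt_one (r := (1 / 2 : ℝ)) (by norm_num) (by norm_num))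
    simpa using this
  have hlim2 : Filter.Tendsto (fun k => ENNReal.ofReal ((1 / 2) ^ k) * (V + 1)
      + ENNReal.ofReal R * (volume (ball x R) * (maximalFn volume (gradExt w) x + g k x))
      + V * a k x) Filter.atTop
      (nhds (0 * (V + 1) + ENNReal.ofReal R * (volume (ball x R) *
        (maximalFn volume (gradExt w) x + 0)) + V * 0)) := by
    refine Filter.Tendsto.add (Filter.Tendsto.add ?_ ?_) ?_
    · exact ENNReal.Tendsto.mul_const hlim1 (Or.inr (by simp [hVt]))
    · exact ENNReal.Tendsto.const_mul (ENNReal.Tendsto.const_mul (tendsto_const_nhds.add hgx)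
        (Or.inr hVR)) (Or.inr ENNReal.ofReal_ne_top)
    · exact ENNReal.Tendsto.const_mul hax (Or.inr hVt)
  have := ge_of_tendsto' hlim2 hmain
  simpa using this

lemma memLp_zeroExt (hΩ : MeasurableSet Ω) (w : H01 Ω) : MemLp (zeroExt w) 2 volume :=
  (memLp_indicator_iff_restrict hΩ).2 (Lp.memLp (toL2 w))

lemma integrableOn_zeroExt_ball (hΩ : MeasurableSet Ω) (w : H01 Ω) (y₀ : Plane) (ρ : ℝ) :
    IntegrableOn (zeroExt w) (ball y₀ ρ) :=
  have : IsFiniteMeasure (volume.restrict (ball y₀ ρ)) :=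
    isFiniteMeasure_restrict.2 measure_ball_lt_top.ne
  ((memLp_zeroExt hΩ w).restrict _).integrable one_le_two

/-- An element of `H¹₀(Ω)` differs at almost every point from its average over a ball by at most
the maximal function of the gradient times a length. The ball need not be centred at the point, and
may lie outside `Ω`. -/
theorem ae_abs_average_sub_zeroExt_le (hΩ : MeasurableSet Ω) (w : H01 Ω) (y₀ : Plane)
    {ρ R : ℝ} (hρ : 0 < ρ) (hR : 0 < R) :
    ∀ᵐ x, ball y₀ ρ ⊆ ball x R →
      |(⨍ y in ball y₀ ρ, zeroExt w y) - zeroExt w x| ≤ R * (R / ρ) ^ 2 * gradMax w x := by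
  filter_upwards [ae_lintegral_ball_zeroExt_sub_le hΩ w y₀ ρ hR, maximalFn_gradExt_lt_top hΩ w]
    with x hx hfin hsub
  have hB0 : volume.real (ball y₀ ρ) ≠ 0 :=
    (ENNReal.toReal_pos (measure_ball_pos _ _ hρ).ne' measure_ball_lt_top.ne).ne'
  have hBpos : 0 < volume.real (ball y₀ ρ) := lt_of_le_of_ne measureReal_nonneg hB0.symm
  have hint := integrableOn_zeroExt_ball hΩ w y₀ ρ
  have h1 : (⨍ y in ball y₀ ρ, zeroExt w y) - zeroExt w x
      = (volume.real (ball y₀ ρ))⁻¹ * ∫ y in ball y₀ ρ, (zeroExt w y - zeroExt w x) := by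
    rw [setAverage_eq, integral_sub hint (integrableOn_const measure_ball_lt_top.ne),
      setIntegral_const, smul_eq_mul, smul_eq_mul, mul_sub, inv_mul_cancel_left₀ hB0]
  have h2 : |∫ y in ball y₀ ρ, (zeroExt w y - zeroExt w x)|
      ≤ R * (volume.real (ball x R) * gradMax w x) := by
    rw [← Real.norm_eq_abs, ← toReal_enorm]
    refine (ENNReal.toReal_mono ?_ ((enorm_integral_le_lintegral_enorm _).trans (hx hsub))).trans
      (le_of_eq ?_)
    · exact ENNReal.mul_ne_top ENNReal.ofReal_ne_top
        (ENNReal.mul_ne_top measure_ball_lt_top.ne hfin.ne)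
    · rw [ENNReal.toReal_mul, ENNReal.toReal_mul, ENNReal.toReal_ofReal hR.le]
      rfl
  have hscale : volume.real (ball x R) = (R / ρ) ^ 2 * volume.real (ball y₀ ρ) := by
    simp only [Measure.real, Measure.addHaar_ball volume _ hR.le, Measure.addHaar_ball volume _ hρ.le,
      ENNReal.toReal_mul, finrank_euclideanSpace_fin]
    rw [ENNReal.toReal_ofReal (by positivity), ENNReal.toReal_ofReal (by positivity)]
    field_simp
  rw [h1, abs_mul, abs_of_pos (inv_pos.2 hBpos)]
  calc (volume.real (ball y₀ ρ))⁻¹ * |∫ y in ball y₀ ρ, (zeroExt w y - zeroExt w x)|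
      ≤ (volume.real (ball y₀ ρ))⁻¹ * (R * (volume.real (ball x R) * gradMax w x)) := by gcongr
    _ = _ := by rw [hscale]; field_simp

end Oscillation

/-! ### Estimates for nodal values, and the Poincaré inequality -/

section NodalEstimates

variable {Ω : Set Plane}

lemma setAverage_affine_ball (a : ℝ) (b y : Plane) {ρ : ℝ} (hρ : 0 < ρ) :
    ⨍ x in ball y ρ, (a + ⟪b, x⟫) = a + ⟪b, y⟫ := by
  have hint : IntegrableOn (fun x : Plane => ⟪b, x - y⟫) (ball y ρ) :=
    ((by fun_prop : Continuous fun x : Plane => ⟪b, x - y⟫).continuousOn.integrableOn_compact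
      (isCompact_closedBall y ρ)).mono_set ball_subset_closedBall
  have hodd : ∫ x in ball y ρ, ⟪b, x - y⟫ = 0 := by
    rw [← integral_indicator measurableSet_ball]
    have h1 : ∀ x, (ball y ρ).indicator (fun x => ⟪b, x - y⟫) x
        = (fun u => (ball (0 : Plane) ρ).indicator (fun u => ⟪b, u⟫) u) (x - y) := by
      intro x
      simp [indicator, mem_ball, dist_eq_norm]
    simp_rw [h1]
    rw [integral_sub_right_eq_self (fun u => (ball (0 : Plane) ρ).indicator (fun u => ⟪b, u⟫) u) y]
    have h2 := integral_neg_eq_self (fun u => (ball (0 : Plane) ρ).indicator (fun u => ⟪b, u⟫) u)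
      volume
    have h3 : ∀ u, (ball (0 : Plane) ρ).indicator (fun u => ⟪b, u⟫) (-u)
        = - (ball (0 : Plane) ρ).indicator (fun u => ⟪b, u⟫) u := by
      intro u
      by_cases hu : u ∈ ball (0 : Plane) ρ
      · have hu' : -u ∈ ball (0 : Plane) ρ := by simpa using hu
        rw [indicator_of_mem hu, indicator_of_mem hu', inner_neg_right]
      · have hu' : -u ∉ ball (0 : Plane) ρ := by simpa using hu
        rw [indicator_of_notMem hu, indicator_of_notMem hu', neg_zero]
    simp_rw [h3] at h2
    rw [integral_neg] at h2
    linarith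
  have hV : volume.real (ball y ρ) ≠ 0 :=
    (ENNReal.toReal_pos (measure_ball_pos _ _ hρ).ne' measure_ball_lt_top.ne).ne'
  have hconst : IntegrableOn (fun _ : Plane => a + ⟪b, y⟫) (ball y ρ) :=
    integrableOn_const measure_ball_lt_top.ne
  have e : ∀ x : Plane, a + ⟪b, x⟫ = (a + ⟪b, y⟫) + ⟪b, x - y⟫ := by
    intro x
    rw [inner_sub_right]
    ring
  rw [show (fun x : Plane => a + ⟪b, x⟫) = fun x => (a + ⟪b, y⟫) + ⟪b, x - y⟫ from funext e,
    setAverage_eq, integral_add hconst hint, setIntegral_const, hodd, add_zero, smul_eq_mul, smul_eq_mul, inv_mul_cancel_left₀ hV]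

/-- The constant in the comparison, at the scale `h`, of a nodal value with the values of the
function, when the nodal value is read off a ball of radius `c * h`. -/
noncomputable def nodalConst (c : ℝ) : ℝ := (2 / c + 1) * (32 / c ^ 2)

lemma nodalConst_pos {c : ℝ} (hc : 0 < c) : 0 < nodalConst c := by
  unfold nodalConst
  positivity

/-- Nodal values given by averages. -/
lemma ae_abs_average_sub_le (hΩ : MeasurableSet Ω) (w : H01 Ω) {y z : Plane} {c h : ℝ}
    (hc : 0 < c) (hh : 0 < h) (hsub : ball y (c * h) ⊆ ball z h) :
    ∀ᵐ x, x ∈ ball z h →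
      |(⨍ u in ball y (c * h), zeroExt w u) - zeroExt w x| ≤ 8 / c ^ 2 * h * gradMax w x := by
  filter_upwards [ae_abs_average_sub_zeroExt_le hΩ w y (mul_pos hc hh)
    (mul_pos two_pos hh)] with x hx hxz
  have h1 : ball z h ⊆ ball x (2 * h) := by
    apply ball_subset_ball'
    rw [mem_ball, dist_comm] at hxz
    linarith
  refine (hx (hsub.trans h1)).trans (le_of_eq ?_)
  field_simp
  ring

/-- Nodal values that vanish, at points near which a ball lies outside `Ω`. -/
lemma ae_abs_zeroExt_le (hΩ : MeasurableSet Ω) (w : H01 Ω) {y z : Plane} {c h : ℝ}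
    (hc : 0 < c) (hh : 0 < h) (hsub : ball y (c * h) ⊆ ball z h \ Ω) :
    ∀ᵐ x, x ∈ ball z h → |zeroExt w x| ≤ 8 / c ^ 2 * h * gradMax w x := by
  filter_upwards [ae_abs_average_sub_le hΩ w hc hh (hsub.trans sdiff_subset)] with x hx hxz
  have h0 : ⨍ u in ball y (c * h), zeroExt w u = 0 := by
    rw [setAverage_eq, setIntegral_eq_zero_of_forall_eq_zero, smul_zero]
    intro u hu
    exact indicator_of_notMem (hsub hu).2 _
  simpa [h0] using hx hxz

/-- Nodal values of a function that is affine on a ball close to the node: the slope is controlled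
by comparing the averages over two smaller balls. -/
lemma ae_abs_affine_sub_le (hΩ : MeasurableSet Ω) (w : H01 Ω) {y z : Plane} {c h : ℝ}
    (hc : 0 < c) (hh : 0 < h) (hsub : ball y (c * h) ⊆ ball z h) {a : ℝ} {b : Plane}
    (haff : ∀ᵐ u ∂(volume.restrict (ball y (c * h))), zeroExt w u = a + ⟪b, u⟫) :
    ∀ᵐ x, x ∈ ball z h → |a + ⟪b, z⟫ - zeroExt w x| ≤ nodalConst c * h * gradMax w x := by
  set e : Plane := ‖b‖⁻¹ • b with he
  have hbe : ⟪b, e⟫ = ‖b‖ := by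
    rw [he, real_inner_smul_right, real_inner_self_eq_norm_sq]
    rcases eq_or_ne ‖b‖ 0 with h0 | h0
    · simp [h0]
    · field_simp
  have hen : ‖e‖ ≤ 1 := by
    rw [he, norm_smul, norm_inv, norm_norm]
    exact inv_mul_le_one
  have hc2 : 0 < c / 2 := by positivity
  have hin : ∀ s : ℝ, |s| = 1 → ball (y + (s * (c / 2 * h)) • e) (c / 2 * h) ⊆ ball y (c * h) := by
    intro s hs
    apply ball_subset_ball'
    rw [dist_eq_norm, add_sub_cancel_left, norm_smul, Real.norm_eq_abs, abs_mul, hs,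
      abs_of_pos (by positivity)]
    have : 1 * (c / 2 * h) * ‖e‖ ≤ 1 * (c / 2 * h) * 1 := by gcongr
    linarith
  have havg : ∀ s : ℝ, |s| = 1 → ⨍ u in ball (y + (s * (c / 2 * h)) • e) (c / 2 * h), zeroExt w u
      = a + ⟪b, y⟫ + s * (c / 2 * h) * ‖b‖ := by
    intro s hs
    rw [← hbe, ← real_inner_smul_right, add_assoc, ← inner_add_right,
      ← setAverage_affine_ball a b _ (mul_pos hc2 hh)]
    exact average_congr (ae_restrict_of_ae_restrict_of_subset (hin s hs) haff)
  have hy : y ∈ ball z h := hsub (mem_ball_self (mul_pos hc hh))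
  filter_upwards [ae_abs_average_sub_le hΩ w hc2 hh ((hin 1 (by simp)).trans hsub),
    ae_abs_average_sub_le hΩ w hc2 hh ((hin (-1) (by simp)).trans hsub)] with x h1 h2 hxz
  have h1 := h1 hxz
  have h2 := h2 hxz
  rw [havg 1 (by simp)] at h1
  rw [havg (-1) (by simp)] at h2
  set D := 8 / (c / 2) ^ 2 * h * gradMax w x with hD
  have hb : c * h * ‖b‖ ≤ 2 * D := by
    rw [abs_le] at h1 h2
    nlinarith [h1.2, h2.1]
  have hbz : |⟪b, z - y⟫| ≤ ‖b‖ * h := by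
    refine (abs_real_inner_le_norm _ _).trans ?_
    gcongr
    rw [← dist_eq_norm, dist_comm]
    exact (mem_ball.1 hy).le
  have hbh : ‖b‖ * h ≤ 2 / c * D := by
    rw [div_mul_eq_mul_div, le_div_iff₀ hc]
    linarith
  have hmid : |a + ⟪b, y⟫ - zeroExt w x| ≤ D := by
    rw [abs_le] at *
    constructor <;> linarith [h1.1, h1.2, h2.1, h2.2]
  have hfin : nodalConst c * h * gradMax w x = (2 / c + 1) * D := by
    rw [hD, nodalConst]
    field_simp
    ring
  rw [hfin, add_mul, one_mul]
  calc |a + ⟪b, z⟫ - zeroExt w x| = |⟪b, z - y⟫ + (a + ⟪b, y⟫ - zeroExt w x)| := by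
        rw [inner_sub_right]; congr 1; ring
    _ ≤ |⟪b, z - y⟫| + |a + ⟪b, y⟫ - zeroExt w x| := abs_add_le _ _
    _ ≤ _ := add_le_add (hbz.trans hbh) hmid

/-- The Poincaré–Friedrichs inequality: a bounded set is contained in a ball that contains a ball
outside the set, over which the average vanishes. -/
theorem exists_poincare (hΩ : MeasurableSet Ω) (hb : Bornology.IsBounded Ω) :
    ∃ C : ℝ, 0 < C ∧ ∀ w : H01 Ω, ‖w‖ ≤ C * ‖wgrad w‖ := by
  obtain ⟨r, hr⟩ := hb.subset_ball (0 : Plane)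
  set r' := max r 1 with hr'
  have hr1 : 1 ≤ r' := le_max_right _ _
  have hΩr : Ω ⊆ ball 0 r' := hr.trans (ball_subset_ball (le_max_left _ _))
  obtain ⟨e, he⟩ := exists_norm_eq Plane (zero_le_one (α := ℝ))
  set y : Plane := (r' + 1) • e with hy
  have hyn : ‖y‖ = r' + 1 := by
    rw [hy, norm_smul, he, Real.norm_of_nonneg (by linarith), mul_one]
  set h := 3 * r' with hh
  have hh0 : 0 < h := by linarith
  set c := 1 / h with hc
  have hc0 : 0 < c := by positivity
  have hch : c * h = 1 := by rw [hc]; field_simp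
  have hsub : ball y (c * h) ⊆ ball 0 h \ Ω := by
    rw [hch]
    intro u hu
    rw [mem_ball, dist_eq_norm] at hu
    have h1 := norm_sub_norm_le u y
    have h2 := norm_sub_norm_le y u
    rw [norm_sub_rev] at h2
    refine ⟨by rw [mem_ball_zero_iff]; linarith, fun hmem => ?_⟩
    have := mem_ball_zero_iff.1 (hΩr hmem)
    linarith
  set K := 8 / c ^ 2 * h with hK
  have hK0 : 0 < K := by positivity
  refine ⟨Real.sqrt (200 * K ^ 2 + 1), Real.sqrt_pos.2 (by positivity), fun w => ?_⟩
  have hae := ae_abs_zeroExt_le hΩ w hc0 hh0 hsub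
  have h1 : ‖toL2 w‖ ^ 2 ≤ K ^ 2 * (200 * ‖wgrad w‖ ^ 2) := by
    rw [← ENNReal.ofReal_le_ofReal_iff (by positivity), ← lintegral_zeroExt_sq hΩ]
    have h2 : ∫⁻ x, ‖zeroExt w x‖ₑ ^ 2 ≤ ∫⁻ x, ENNReal.ofReal (K ^ 2 * gradMax w x ^ 2) := by
      refine lintegral_mono_ae ?_
      filter_upwards [hae] with x hx
      by_cases hxΩ : x ∈ Ω
      · have h3 := hx (hΩr.trans (ball_subset_ball (by linarith)) hxΩ)
        rw [← ofReal_norm, ← ENNReal.ofReal_pow (norm_nonneg _), Real.norm_eq_abs, ← mul_pow]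
        exact ENNReal.ofReal_le_ofReal (pow_le_pow_left₀ (abs_nonneg _) h3 2)
      · simp [zeroExt, hxΩ]
    refine h2.trans ?_
    rw [← ofReal_integral_eq_lintegral_ofReal ((integrable_gradMax_sq hΩ w).const_mul _)
      (Filter.Eventually.of_forall fun x => by positivity), integral_const_mul]
    refine ENNReal.ofReal_le_ofReal ?_
    gcongr
    exact integral_gradMax_sq_le hΩ w
  refine le_of_sq_le_sq ?_ (by positivity)
  rw [norm_sq_eq, mul_pow, Real.sq_sqrt (by positivity)]
  linarith

end NodalEstimates

/-! ### Local geometry of Lipschitz polygons -/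

section LipschitzDomains

variable {D : Set Plane}

lemma plane_norm_le (v : Plane) : ‖v‖ ≤ |v 0| + |v 1| := by
  rw [EuclideanSpace.norm_eq, Real.sqrt_le_left (by positivity), Fin.sum_univ_two,
    Real.norm_eq_abs, Real.norm_eq_abs]
  nlinarith [mul_nonneg (abs_nonneg (v 0)) (abs_nonneg (v 1))]

lemma abs_coord_sub_le (e : Plane ≃ₗᵢ[ℝ] Plane) (u z : Plane) (i : Fin 2) :
    |e u i - e z i| ≤ dist u z := by
  have h := PiLp.norm_apply_le (e (u - z)) i
  rw [e.norm_map, ← dist_eq_norm, map_sub] at h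
  simpa using h

lemma IsLipschitzPolygon.notMem_of_mem_frontier (hD : IsLipschitzPolygon D) {z : Plane}
    (hz : z ∈ frontier D) : z ∉ D := by
  rw [hD.1.frontier_eq] at hz
  exact hz.2

lemma exists_local_exterior_ball (hD : IsLipschitzPolygon D) {x : Plane} (hx : x ∈ frontier D)
    {d : ℝ} (hd : 0 < d) :
    ∃ r > 0, ∃ c > 0, ∀ z ∈ ball x r, z ∈ frontier D → ∀ h, 0 < h → h ≤ d →
      ∃ y, ball y (c * h) ⊆ ball z h \ D := by
  obtain ⟨e, γ, L, r, hr, hγ, hchart⟩ := hD.2.2.2 x hx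
  set c := min 1 (r / (2 * d)) with hc
  have hc0 : 0 < c := by positivity
  have hL : (0 : ℝ) ≤ L := L.2
  refine ⟨r / 2, by positivity, c / (2 + L), by positivity, fun z hzx hz h hh hhd => ?_⟩
  have hch : c * h ≤ h := mul_le_of_le_one_left hh.le (min_le_left _ _)
  have hcr : c * h ≤ r / 2 := by
    calc c * h ≤ r / (2 * d) * d := by
          gcongr
          exact min_le_right _ _
      _ = r / 2 := by field_simp
  have hzr : ball z (c * h) ⊆ ball x r := by
    apply ball_subset_ball'
    linarith [mem_ball.1 hzx]
  set ρ := c / (2 + L) * h with hρ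
  have hρ0 : 0 < ρ := by positivity
  have hρc : (2 + L) * ρ = c * h := by rw [hρ]; field_simp
  -- the centre is moved away from the boundary point along the vertical axis of the chart
  set y : Plane := e.symm (e z - (((1 + L) * ρ) • EuclideanSpace.single (1 : Fin 2) (1 : ℝ))) with hy
  have hyz : dist y z = (1 + L) * ρ := by
    rw [← e.dist_map, hy, e.apply_symm_apply, dist_eq_norm, sub_sub_cancel_left, norm_neg,
      norm_smul, Real.norm_of_nonneg (by positivity)]
    simp
  have hsub : ball y ρ ⊆ ball z (c * h) := by
    apply ball_subset_ball'
    rw [hyz]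
    linarith
  refine ⟨y, fun u hu => ⟨ball_subset_ball hch (hsub hu), fun huD => ?_⟩⟩
  have h1 := (hchart u (hzr (hsub hu))).1 huD
  have hzD : ¬ γ (e z 0) < e z 1 := fun hlt => hD.notMem_of_mem_frontier hz
    ((hchart z (hzr (mem_ball_self (by positivity)))).2 hlt)
  have e0 : e y 0 = e z 0 := by simp [hy]
  have e1 : e y 1 = e z 1 - (1 + L) * ρ := by simp [hy]
  have h2 := (abs_coord_sub_le e u y 0).trans_lt (mem_ball.1 hu)
  have h3 := (abs_coord_sub_le e u y 1).trans_lt (mem_ball.1 hu)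
  have h4 := hγ.dist_le_mul (e u 0) (e z 0)
  rw [Real.dist_eq, Real.dist_eq] at h4
  rw [e0] at h2
  rw [e1] at h3
  have h5 : (L : ℝ) * |e u 0 - e z 0| ≤ L * ρ := by gcongr
  rw [abs_lt] at h3
  have h6 := (abs_le.1 (h4.trans h5)).1
  linarith [h3.2, not_lt.1 hzD]

/-- A Lipschitz polygon leaves out, near each boundary point and at every scale, a ball of
comparable radius. -/
theorem exists_exterior_ball (hD : IsLipschitzPolygon D) {d : ℝ} (hd : 0 < d) :
    ∃ c > 0, ∀ z ∈ frontier D, ∀ h, 0 < h → h ≤ d → ∃ y, ball y (c * h) ⊆ ball z h \ D := by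
  have hcomp : IsCompact (frontier D) :=
    Metric.isCompact_of_isClosed_isBounded isClosed_frontier
      (hD.2.1.closure.subset frontier_subset_closure)
  have key : ∃ c > 0, ∀ z ∈ frontier D, z ∈ frontier D → ∀ h, 0 < h → h ≤ d →
      ∃ y, ball y (c * h) ⊆ ball z h \ D := by
    refine hcomp.induction_on (p := fun S => ∃ c > 0, ∀ z ∈ S, z ∈ frontier D → ∀ h, 0 < h → h ≤ d →
      ∃ y, ball y (c * h) ⊆ ball z h \ D) ⟨1, one_pos, by simp⟩ ?_ ?_ ?_
    · rintro s t hst ⟨c, hc, h⟩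
      exact ⟨c, hc, fun z hz => h z (hst hz)⟩
    · rintro s t ⟨c, hc, hs⟩ ⟨c', hc', ht⟩
      refine ⟨min c c', lt_min hc hc', fun z hz hzD h hh hhd => ?_⟩
      rcases hz with hz | hz
      · obtain ⟨y, hy⟩ := hs z hz hzD h hh hhd
        exact ⟨y, (ball_subset_ball (by gcongr; exact min_le_left _ _)).trans hy⟩
      · obtain ⟨y, hy⟩ := ht z hz hzD h hh hhd
        exact ⟨y, (ball_subset_ball (by gcongr; exact min_le_right _ _)).trans hy⟩
    · intro x hx
      obtain ⟨r, hr, c, hc, h⟩ := exists_local_exterior_ball hD hx hd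
      exact ⟨ball x r, mem_nhdsWithin_of_mem_nhds (ball_mem_nhds x hr), c, hc, h⟩
  obtain ⟨c, hc, h⟩ := key
  exact ⟨c, hc, fun z hz => h z hz hz⟩

lemma IsLipschitzPolygon.interior_closure (hD : IsLipschitzPolygon D) :
    interior (closure D) = D := by
  refine Subset.antisymm (fun x hx => ?_) (interior_maximal subset_closure hD.1)
  by_contra hxD
  have hxf : x ∈ frontier D := by
    rw [hD.1.frontier_eq]
    exact ⟨interior_subset hx, hxD⟩
  obtain ⟨r, hr, hball⟩ := Metric.isOpen_iff.1 isOpen_interior x hx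
  obtain ⟨c, hc, h⟩ := exists_exterior_ball hD hr
  obtain ⟨y, hy⟩ := h x hxf r hr le_rfl
  have hyc : y ∈ closure D := interior_subset (hball (hy (mem_ball_self (by positivity))).1)
  obtain ⟨u, huD, hu⟩ := Metric.mem_closure_iff.1 hyc (c * r) (by positivity)
  rw [dist_comm] at hu
  exact (hy (mem_ball.2 hu)).2 huD

lemma isPreconnected_ball_diff_center (z : Plane) (s : ℝ) :
    IsPreconnected (ball z s \ {z}) := by
  have hrank : 1 < Module.rank ℝ Plane := by
    rw [rank_eq_card_basis (EuclideanSpace.basisFun (Fin 2) ℝ).toBasis]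
    norm_num
  have hS : IsPreconnected (sphere (0 : Plane) 1) := isPreconnected_sphere hrank 0 1
  have himg : ball z s \ {z} = (fun p : ℝ × Plane => z + p.1 • p.2) '' (Ioo 0 s ×ˢ sphere 0 1) := by
    ext u
    simp only [mem_sdiff, mem_ball, mem_singleton_iff, mem_image, mem_prod, mem_Ioo,
      mem_sphere_zero_iff_norm, Prod.exists]
    constructor
    · rintro ⟨h1, h2⟩
      have h3 : 0 < ‖u - z‖ := norm_pos_iff.2 (sub_ne_zero.2 h2)
      refine ⟨‖u - z‖, ‖u - z‖⁻¹ • (u - z), ⟨⟨h3, by rwa [← dist_eq_norm]⟩, ?_⟩, ?_⟩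
      · rw [norm_smul, norm_inv, norm_norm, inv_mul_cancel₀ h3.ne']
      · rw [smul_inv_smul₀ h3.ne', add_sub_cancel]
    · rintro ⟨t, v, ⟨⟨ht, hts⟩, hv⟩, rfl⟩
      rw [dist_eq_norm, add_sub_cancel_left, norm_smul, hv, Real.norm_of_nonneg ht.le, mul_one]
      refine ⟨hts, fun hcon => ?_⟩
      have : t • v = 0 := by simpa using hcon
      rcases smul_eq_zero.1 this with h | h
      · exact ht.ne' h
      · simp [h] at hv
  rw [himg]
  exact (isPreconnected_Ioo.prod hS).image _ (by fun_prop)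

/-- Near each point of its closure, a Lipschitz polygon minus the point is connected. -/
theorem exists_punctured_preconnected (hD : IsLipschitzPolygon D) {z : Plane} (hz : z ∈ closure D)
    {s : ℝ} (hs : 0 < s) :
    ∃ Q : Set Plane, IsPreconnected Q ∧ Q ⊆ (D ∩ ball z s) \ {z} ∧
      ∃ s' > 0, (D ∩ ball z s') \ {z} ⊆ Q := by
  by_cases hzD : z ∈ D
  · obtain ⟨r, hr, hball⟩ := Metric.isOpen_iff.1 hD.1 z hzD
    refine ⟨ball z (min s r) \ {z}, isPreconnected_ball_diff_center z _, ?_, min s r, by positivity,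
      ?_⟩
    · rintro u ⟨hu, huz⟩
      exact ⟨⟨hball (ball_subset_ball (min_le_right _ _) hu),
        ball_subset_ball (min_le_left _ _) hu⟩, huz⟩
    · rintro u ⟨⟨-, hu⟩, huz⟩
      exact ⟨hu, huz⟩
  have hzf : z ∈ frontier D := by
    rw [hD.1.frontier_eq]
    exact ⟨hz, hzD⟩
  obtain ⟨e, γ, L, r, hr, hγ, hchart⟩ := hD.2.2.2 z hzf
  have hL : (0 : ℝ) ≤ L := L.2
  -- the boundary point lies on the graph
  have hle : e z 1 ≤ γ (e z 0) := not_lt.1 fun hlt => hzD ((hchart z (mem_ball_self hr)).2 hlt)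
  have hge : γ (e z 0) ≤ e z 1 := by
    by_contra! hlt
    have hcont : Continuous fun u : Plane => e u 1 - γ (e u 0) := by
      have h0 : ∀ i : Fin 2, Continuous fun u : Plane => e u i := fun i =>
        (EuclideanSpace.proj i).continuous.comp e.continuous
      exact (h0 1).sub (hγ.continuous.comp (h0 0))
    have hopen : {u : Plane | e u 1 - γ (e u 0) < 0} ∩ ball z r ∈ nhds z :=
      Filter.inter_mem ((isOpen_Iio.preimage hcont).mem_nhds (by simpa using hlt))
        (ball_mem_nhds z hr)
    obtain ⟨u, ⟨hu1, hu2⟩, huD⟩ := mem_closure_iff_nhds.1 hz _ hopen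
    have hu1 : e u 1 - γ (e u 0) < 0 := hu1
    linarith [(hchart u hu2).1 huD]
  have heq : e z 1 = γ (e z 0) := le_antisymm hle hge
  set h := min s r with hh
  have hh0 : 0 < h := by positivity
  set δ := h / (2 + L) with hδ
  have hδ0 : 0 < δ := by positivity
  have hδh : (2 + L) * δ = h := by rw [hδ]; field_simp
  -- near `z` the set is the image of a rectangle under the map `F` that straightens the graph of `γ`
  set F : ℝ × ℝ → Plane := fun p => e.symm !₂[e z 0 + p.1, γ (e z 0 + p.1) + p.2] with hF
  have hFc : Continuous F := by
    refine e.symm.continuous.comp ((PiLp.continuous_toLp 2 _).comp ?_)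
    refine continuous_pi fun i => ?_
    fin_cases i
    · exact continuous_const.add continuous_fst
    · exact (hγ.continuous.comp (continuous_const.add continuous_fst)).add continuous_snd
  have hF0 : ∀ p, e (F p) 0 = e z 0 + p.1 := fun p => by simp [hF]
  have hF1 : ∀ p, e (F p) 1 = γ (e z 0 + p.1) + p.2 := fun p => by simp [hF]
  refine ⟨F '' (Ioo (-δ) δ ×ˢ Ioo 0 δ),
    (isPreconnected_Ioo.prod isPreconnected_Ioo).image _ hFc.continuousOn, ?_, δ / (2 + L),
    by positivity, ?_⟩
  · rintro _ ⟨p, ⟨⟨hp1, hp2⟩, hp3, hp4⟩, rfl⟩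
    have hlip := hγ.dist_le_mul (e z 0 + p.1) (e z 0)
    rw [Real.dist_eq, Real.dist_eq, add_sub_cancel_left] at hlip
    have hp : |p.1| < δ := abs_lt.2 ⟨hp1, hp2⟩
    have hLp : (L : ℝ) * |p.1| ≤ L * δ := by gcongr
    have hball : dist (F p) z < h := by
      rw [← e.dist_map, dist_eq_norm]
      refine (plane_norm_le _).trans_lt ?_
      simp only [PiLp.sub_apply, hF0, hF1, add_sub_cancel_left, heq]
      have : |γ (e z 0 + p.1) + p.2 - γ (e z 0)| ≤ |γ (e z 0 + p.1) - γ (e z 0)| + |p.2| := by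
        rw [add_sub_right_comm]
        exact abs_add_le _ _
      rw [abs_of_pos hp3] at this
      linarith
    have hin : F p ∈ D := (hchart _ (mem_ball.2 (hball.trans_le (min_le_right _ _)))).2 (by
      rw [hF0, hF1]
      linarith)
    refine ⟨⟨hin, mem_ball.2 (hball.trans_le (min_le_left _ _))⟩, fun hcon => ?_⟩
    rw [mem_singleton_iff] at hcon
    exact hzD (hcon ▸ hin)
  · rintro u ⟨⟨huD, hu⟩, -⟩
    rw [mem_ball] at hu
    have hsm : δ / (2 + L) * (2 + L) = δ := by field_simp
    have hsδ : δ / (2 + L) ≤ δ := div_le_self hδ0.le (by linarith)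
    have hδle : δ ≤ h := div_le_self hh0.le (by linarith)
    have hur : u ∈ ball z r :=
      mem_ball.2 (hu.trans_le (hsδ.trans (hδle.trans (min_le_right _ _))))
    have h1 := (hchart u hur).1 huD
    have h2 := (abs_coord_sub_le e u z 0).trans_lt hu
    have h3 := (abs_coord_sub_le e u z 1).trans_lt hu
    have hlip := hγ.dist_le_mul (e u 0) (e z 0)
    rw [Real.dist_eq, Real.dist_eq] at hlip
    have hLp : (L : ℝ) * |e u 0 - e z 0| ≤ L * (δ / (2 + L)) := by gcongr
    refine ⟨(e u 0 - e z 0, e u 1 - γ (e u 0)), ⟨?_, ?_, ?_⟩, ?_⟩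
    · exact abs_lt.1 (h2.trans_le hsδ)
    · simpa using h1
    · have := (abs_le.1 hlip).1
      have := (abs_lt.1 h3).2
      show e u 1 - γ (e u 0) < δ
      nlinarith
    · apply e.injective
      ext i
      fin_cases i
      · simp [hF]
      · simp [hF]

end LipschitzDomains

/-! ### Barycentric coordinates and conforming meshes -/

section Barycentric

/-- The barycentric coordinate of the vertex `z` of the triangle with vertex set `K` (zero if `K`
is not the vertex set of a triangle or `z` is not in `K`). -/
noncomputable def bary (K : Finset Plane) (z : Plane) : Plane →ᵃ[ℝ] ℝ :=
  open Classical in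
  if h : (AffineIndependent ℝ (fun p : K => (p : Plane)) ∧ K.card = 3) ∧ z ∈ K then
    AffineBasis.coord (ι := K) ⟨fun p : K => (p : Plane), h.1.1,
      h.1.1.affineSpan_eq_top_iff_card_eq_finrank_add_one.2
        (by simp [h.1.2])⟩ ⟨z, h.2⟩
  else 0

variable {Ω Ωc : Set Plane} {𝒯 : TriMesh Ω Ωc} {K L : Finset Plane} {z x y : Plane}

lemma exists_affineBasis (hK : K ∈ 𝒯.cells) :
    ∃ b : AffineBasis K ℝ Plane, (∀ p, b p = p) ∧ ∀ p : K, bary K p = b.coord p := by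
  have h1 := 𝒯.indep K hK
  have h2 := 𝒯.card_eq K hK
  refine ⟨⟨fun p : K => (p : Plane), h1,
      h1.affineSpan_eq_top_iff_card_eq_finrank_add_one.2 (by simp [h2])⟩, fun p => rfl, fun p => ?_⟩
  rw [bary, dif_pos ⟨⟨h1, h2⟩, p.2⟩]

lemma bary_self (hK : K ∈ 𝒯.cells) (hz : z ∈ K) : bary K z z = 1 := by
  obtain ⟨b, hb, hc⟩ := exists_affineBasis hK
  have := b.coord_apply_eq ⟨z, hz⟩
  rwa [hb, ← hc] at this

lemma bary_of_ne (hK : K ∈ 𝒯.cells) (hz : z ∈ K) (hy : y ∈ K) (hne : y ≠ z) : bary K z y = 0 := by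
  obtain ⟨b, hb, hc⟩ := exists_affineBasis hK
  have := b.coord_apply_ne (i := ⟨z, hz⟩) (j := ⟨y, hy⟩) (by simpa using hne.symm)
  rwa [hb, ← hc] at this

lemma sum_bary (hK : K ∈ 𝒯.cells) (x : Plane) : ∑ z ∈ K, bary K z x = 1 := by
  obtain ⟨b, hb, hc⟩ := exists_affineBasis hK
  rw [← Finset.sum_coe_sort K, ← b.sum_coord_apply_eq_one x]
  exact Finset.sum_congr rfl fun p _ => by rw [hc]

lemma sum_bary_smul (hK : K ∈ 𝒯.cells) (x : Plane) : ∑ z ∈ K, bary K z x • z = x := by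
  obtain ⟨b, hb, hc⟩ := exists_affineBasis hK
  rw [← Finset.sum_coe_sort K (fun z => bary K z x • z)]
  conv_rhs => rw [← b.linear_combination_coord_eq_self x]
  exact Finset.sum_congr rfl fun p _ => by rw [hc, hb]

lemma mem_hull_iff (hK : K ∈ 𝒯.cells) :
    x ∈ convexHull ℝ (K : Set Plane) ↔ ∀ z ∈ K, 0 ≤ bary K z x := by
  obtain ⟨b, hb, hc⟩ := exists_affineBasis hK
  have hr : range b = (K : Set Plane) := by
    ext u
    simp only [mem_range, hb]
    exact ⟨fun ⟨p, hp⟩ => hp ▸ p.2, fun hu => ⟨⟨u, hu⟩, rfl⟩⟩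
  rw [← hr, b.convexHull_eq_nonneg_coord, mem_ofPred_eq]
  exact ⟨fun h z hz => by rw [hc ⟨z, hz⟩]; exact h _, fun h p => by rw [← hc]; exact h p p.2⟩

lemma affineMap_eqOn_convexHull {f g : Plane →ᵃ[ℝ] ℝ} {s : Set Plane} (h : ∀ u ∈ s, f u = g u) :
    ∀ u ∈ convexHull ℝ s, f u = g u := by
  have hconv : Convex ℝ {u | f u = g u} := by
    intro a ha c hc s t hs ht hst
    simp only [mem_ofPred_eq] at *
    rw [Convex.combo_affine_apply hst, Convex.combo_affine_apply hst, ha, hc]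
  exact fun u hu => convexHull_min (fun v hv => h v hv) hconv hu

lemma hull_inter (hK : K ∈ 𝒯.cells) (hL : L ∈ 𝒯.cells) (hxK : x ∈ convexHull ℝ (K : Set Plane))
    (hxL : x ∈ convexHull ℝ (L : Set Plane)) :
    x ∈ convexHull ℝ ((K : Set Plane) ∩ (L : Set Plane)) := by
  rw [← 𝒯.conforming K hK L hL]
  exact ⟨hxK, hxL⟩

lemma bary_eq_zero_of_inter (hK : K ∈ 𝒯.cells) (hz : z ∈ K) (hzL : z ∉ L)
    (hx : x ∈ convexHull ℝ ((K : Set Plane) ∩ (L : Set Plane))) : bary K z x = 0 := by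
  refine affineMap_eqOn_convexHull (g := 0) (fun u hu => ?_) x hx
  exact bary_of_ne hK hz hu.1 fun h => hzL (h ▸ hu.2)

lemma bary_eq_bary (hK : K ∈ 𝒯.cells) (hL : L ∈ 𝒯.cells) (hzK : z ∈ K) (hzL : z ∈ L)
    (hx : x ∈ convexHull ℝ ((K : Set Plane) ∩ (L : Set Plane))) : bary K z x = bary L z x := by
  refine affineMap_eqOn_convexHull (fun u hu => ?_) x hx
  rcases eq_or_ne u z with rfl | hne
  · rw [bary_self hK hzK, bary_self hL hzL]
  · rw [bary_of_ne hK hzK hu.1 hne, bary_of_ne hL hzL hu.2 hne]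

/-- A vertex of the mesh is a vertex of every triangle that contains it. -/
lemma vertex_mem_of_mem_hull (hK : K ∈ 𝒯.cells) (hL : L ∈ 𝒯.cells) (hz : z ∈ L)
    (hzK : z ∈ convexHull ℝ (K : Set Plane)) : z ∈ K := by
  by_contra hcon
  have h := bary_eq_zero_of_inter hL hz hcon (hull_inter hL hK (subset_convexHull ℝ _ hz) hzK)
  rw [bary_self hL hz] at h
  exact one_ne_zero h

lemma isClosed_hull (K : Finset Plane) : IsClosed (convexHull ℝ (K : Set Plane)) :=
  (K.finite_toSet.isCompact_convexHull ℝ).isClosed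

lemma hull_subset_closure (hK : K ∈ 𝒯.cells) : convexHull ℝ (K : Set Plane) ⊆ closure Ω := by
  rw [← 𝒯.covers]
  exact subset_biUnion_of_mem (u := fun K : Finset Plane => convexHull ℝ (K : Set Plane)) hK

lemma exists_cell (𝒯 : TriMesh Ω Ωc) (hx : x ∈ closure Ω) :
    ∃ K ∈ 𝒯.cells, x ∈ convexHull ℝ (K : Set Plane) := by
  rw [← 𝒯.covers] at hx
  simpa using hx

/-- Two different triangles of a mesh have no interior points in common. -/
lemma interior_hull_inter_eq_empty (hK : K ∈ 𝒯.cells) (hL : L ∈ 𝒯.cells) (hne : K ≠ L) :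
    interior (convexHull ℝ (K : Set Plane) ∩ convexHull ℝ (L : Set Plane)) = ∅ := by
  rw [eq_empty_iff_forall_notMem]
  intro x hx
  obtain ⟨z, hzK, hzL⟩ : ∃ z ∈ K, z ∉ L := by
    by_contra! hcon
    exact hne (Finset.eq_of_subset_of_card_le hcon (by rw [𝒯.card_eq K hK, 𝒯.card_eq L hL]))
  obtain ⟨y, hyK, hyz⟩ := Finset.exists_mem_ne (by rw [𝒯.card_eq K hK]; norm_num : 1 < K.card) z
  have hz0 : ∀ u ∈ convexHull ℝ (K : Set Plane) ∩ convexHull ℝ (L : Set Plane), bary K z u = 0 :=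
    fun u hu => bary_eq_zero_of_inter hK hzK hzL (hull_inter hK hL hu.1 hu.2)
  -- the coordinate of `z` would vanish on an open set, though it grows in the direction `z - y`
  have hcont : Filter.Tendsto (fun t : ℝ => x + t • (z - y)) (nhds 0) (nhds x) := by
    have : Continuous fun t : ℝ => x + t • (z - y) := by fun_prop
    simpa using this.tendsto 0
  have hev := hcont.eventually (mem_interior_iff_mem_nhds.1 hx)
  obtain ⟨ε, hε, hball⟩ := Metric.eventually_nhds_iff.1 hev
  have h1 := hz0 _ (hball (y := ε / 2) (by
    rw [Real.dist_eq, sub_zero, abs_of_pos (by positivity)]; linarith))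
  have h2 := hz0 x (interior_subset hx)
  have h3 : bary K z (x + (ε / 2) • (z - y)) = bary K z x + ε / 2 * (bary K z z - bary K z y) := by
    rw [add_comm, ← vadd_eq_add, AffineMap.map_vadd, map_smul, vadd_eq_add, add_comm]
    congr 2
    rw [← vsub_eq_sub, AffineMap.linearMap_vsub, vsub_eq_sub]
  rw [h1, h2, bary_self hK hzK, bary_of_ne hK hzK hyK hyz] at h3
  linarith

lemma bary_combo (f : Plane →ᵃ[ℝ] ℝ) (p v : Plane) : f (p + v) = f p + f.linear v := by
  rw [add_comm, ← vadd_eq_add, AffineMap.map_vadd, vadd_eq_add, add_comm]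

/-- The open star of a vertex in `Ω` lies in `Ω`: the mesh looks the same at all points in the
relative interior of one face, and the face reaches the vertex. -/
theorem mem_of_bary_pos (hΩ : IsLipschitzPolygon Ω) (hK : K ∈ 𝒯.cells) (hz : z ∈ K) (hzΩ : z ∈ Ω)
    (hx : x ∈ convexHull ℝ (K : Set Plane)) (hpos : 0 < bary K z x) : x ∈ Ω := by
  -- a point of the face close to the vertex
  have hcont : Filter.Tendsto (fun t : ℝ => z + t • (x - z)) (nhds 0) (nhds z) := by
    have : Continuous fun t : ℝ => z + t • (x - z) := by fun_prop
    simpa using this.tendsto 0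
  obtain ⟨ε, hε, hball⟩ := Metric.eventually_nhds_iff.1 (hcont.eventually (hΩ.1.mem_nhds hzΩ))
  set t := min (ε / 2) (1 / 2) with ht
  have ht0 : 0 < t := by positivity
  have ht1 : t < 1 := (min_le_right _ _).trans_lt (by norm_num)
  set p := z + t • (x - z) with hp
  have hpΩ : p ∈ Ω := hball (y := t) (by
    rw [Real.dist_eq, sub_zero, abs_of_pos ht0]
    exact (min_le_left _ _).trans_lt (by linarith))
  have hcoord : ∀ f : Plane →ᵃ[ℝ] ℝ, f p = (1 - t) * f z + t * f x := by
    intro f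
    rw [hp, bary_combo, map_smul, ← vsub_eq_sub, AffineMap.linearMap_vsub, vsub_eq_sub, smul_eq_mul]
    ring
  -- `p` lies in the relative interior of the same face as `x`, so a triangle that contains `p + v`,
  -- for small `v`, contains `x + v` too
  have hlocal : ∀ L ∈ 𝒯.cells, ∀ᶠ v in nhds (0 : Plane),
      p + v ∈ convexHull ℝ (L : Set Plane) → x + v ∈ convexHull ℝ (L : Set Plane) := by
    intro L hL
    by_cases hpL : p ∈ convexHull ℝ (L : Set Plane)
    swap
    · have : Filter.Tendsto (fun v : Plane => p + v) (nhds 0) (nhds p) := by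
        have : Continuous fun v : Plane => p + v := by fun_prop
        simpa using this.tendsto 0
      filter_upwards [this.eventually ((isClosed_hull L).isOpen_compl.mem_nhds hpL)] with v hv hv'
      exact absurd hv' hv
    have hpK : p ∈ convexHull ℝ (K : Set Plane) := by
      rw [mem_hull_iff hK]
      intro j hj
      rw [hcoord]
      have h1 := (mem_hull_iff hK).1 hx j hj
      have h2 := (mem_hull_iff hK).1 (subset_convexHull ℝ _ hz : z ∈ convexHull ℝ (K : Set Plane))
        j hj
      have : 0 ≤ 1 - t := by linarith
      positivity
    have hpKL := hull_inter hK hL hpK hpL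
    have hzL : z ∈ L := by
      by_contra hzL
      have h1 := bary_eq_zero_of_inter hK hz hzL hpKL
      rw [hcoord, bary_self hK hz] at h1
      have : 0 < t * bary K z x := by positivity
      linarith
    have hxKL : x ∈ convexHull ℝ ((K : Set Plane) ∩ (L : Set Plane)) := by
      have hzero : ∀ j ∈ K, j ∉ L → bary K j x = 0 := by
        intro j hj hjL
        have h1 := bary_eq_zero_of_inter hK hj hjL hpKL
        have hne : z ≠ j := fun h => hjL (h ▸ hzL)
        rw [hcoord, bary_of_ne hK hj hz hne] at h1
        simpa [ht0.ne'] using h1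
      classical
      have hsum1 : ∑ j ∈ K ∩ L, bary K j x = 1 := by
        rw [← sum_bary hK x]
        refine Finset.sum_subset Finset.inter_subset_left fun j hj hjn => hzero j hj fun h => ?_
        exact hjn (Finset.mem_inter.2 ⟨hj, h⟩)
      have hsum2 : ∑ j ∈ K ∩ L, bary K j x • j = x := by
        conv_rhs => rw [← sum_bary_smul hK x]
        refine Finset.sum_subset Finset.inter_subset_left fun j hj hjn => ?_
        rw [hzero j hj fun h => hjn (Finset.mem_inter.2 ⟨hj, h⟩), zero_smul]
      rw [← hsum2]
      refine (convex_convexHull ℝ _).sum_mem (fun j hj => ?_) hsum1 fun j hj => ?_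
      · exact (mem_hull_iff hK).1 hx j (Finset.mem_inter.1 hj).1
      · exact subset_convexHull ℝ _ (Finset.mem_inter.1 hj)
    have hxL : x ∈ convexHull ℝ (L : Set Plane) := convexHull_mono inter_subset_right hxKL
    have hcoords : ∀ i ∈ L, ∀ᶠ v in nhds (0 : Plane),
        p + v ∈ convexHull ℝ (L : Set Plane) → 0 ≤ bary L i (x + v) := by
      intro i hi
      rcases ((mem_hull_iff hL).1 hxL i hi).eq_or_lt with h0 | h0
      · have hne : z ≠ i := by
          rintro rfl
          rw [← bary_eq_bary hK hL hz hzL hxKL] at h0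
          exact hpos.ne h0
        refine Filter.Eventually.of_forall fun v hv => ?_
        have h1 := (mem_hull_iff hL).1 hv i hi
        rw [bary_combo, hcoord, bary_of_ne hL hi hzL hne, ← h0] at h1
        rw [bary_combo, ← h0]
        linarith
      · have : Filter.Tendsto (fun v : Plane => bary L i (x + v)) (nhds 0) (nhds (bary L i x)) := by
          have : Continuous fun v : Plane => bary L i (x + v) :=
            (AffineMap.continuous_of_finiteDimensional _).comp (by fun_prop)
          simpa using this.tendsto 0
        filter_upwards [this.eventually (lt_mem_nhds h0)] with v hv _
        exact hv.le
    have hall := (Filter.eventually_all_finset L).2 hcoords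
    filter_upwards [hall] with v hv hpv
    exact (mem_hull_iff hL).2 fun i hi => hv i hi hpv
  have hpv : ∀ᶠ v in nhds (0 : Plane), p + v ∈ Ω := by
    have : Filter.Tendsto (fun v : Plane => p + v) (nhds 0) (nhds p) := by
      have : Continuous fun v : Plane => p + v := by fun_prop
      simpa using this.tendsto 0
    exact this.eventually (hΩ.1.mem_nhds hpΩ)
  have hxv : ∀ᶠ v in nhds (0 : Plane), x + v ∈ closure Ω := by
    filter_upwards [hpv, (Filter.eventually_all_finset 𝒯.cells).2 hlocal] with v hv hl
    obtain ⟨L, hL, hvL⟩ := exists_cell 𝒯 (subset_closure hv)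
    exact hull_subset_closure hL (hl L hL hvL)
  rw [← hΩ.interior_closure, mem_interior_iff_mem_nhds]
  have hsub : Filter.Tendsto (fun u : Plane => u - x) (nhds x) (nhds 0) := by
    have : Continuous fun u : Plane => u - x := by fun_prop
    simpa using this.tendsto x
  filter_upwards [hsub.eventually hxv] with u hu
  simpa using hu

end Barycentric

/-! ### Triangles at a common vertex -/

section ShapeRegular

variable {Ω Ωc : Set Plane} {𝒯 : TriMesh Ω Ωc} {K L : Finset Plane} {z x y : Plane} {κ : ℝ}

/-- The diameter of the triangle with vertex set `K`. -/
noncomputable def triDiam (K : Finset Plane) : ℝ := Metric.diam (convexHull ℝ (K : Set Plane))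

/-- Shape regularity with constant `κ`: each triangle contains a disc whose radius is at least its
diameter divided by `κ`. -/
def IsShapeRegular (κ : ℝ) (𝒯 : TriMesh Ω Ωc) : Prop :=
  ∀ K ∈ 𝒯.cells, ∃ (x : Plane) (r : ℝ), 0 < r ∧
    Metric.closedBall x r ⊆ convexHull ℝ (K : Set Plane) ∧ triDiam K ≤ κ * r

lemma dist_le_triDiam (hx : x ∈ convexHull ℝ (K : Set Plane))
    (hy : y ∈ convexHull ℝ (K : Set Plane)) : dist x y ≤ triDiam K :=
  Metric.dist_le_diam_of_mem (K.finite_toSet.isCompact_convexHull ℝ).isBounded hx hy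

lemma two_mul_le_triDiam {r : ℝ} (hr : 0 < r)
    (h : closedBall x r ⊆ convexHull ℝ (K : Set Plane)) : 2 * r ≤ triDiam K := by
  obtain ⟨e, he⟩ := exists_norm_eq Plane (zero_le_one (α := ℝ))
  have h1 : ∀ s : ℝ, |s| = 1 → x + (s * r) • e ∈ closedBall x r := by
    intro s hs
    rw [mem_closedBall, dist_eq_norm, add_sub_cancel_left, norm_smul, he, Real.norm_eq_abs,
      abs_mul, hs, abs_of_pos hr]
    linarith
  have h2 := dist_le_triDiam (h (h1 1 (by simp))) (h (h1 (-1) (by simp)))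
  rw [dist_eq_norm, add_sub_add_left_eq_sub, ← sub_smul, norm_smul, he, Real.norm_eq_abs] at h2
  rw [show (1 : ℝ) * r - -1 * r = 2 * r by ring, abs_of_pos (by linarith)] at h2
  linarith

lemma triDiam_pos (hr : IsShapeRegular κ 𝒯) (hK : K ∈ 𝒯.cells) : 0 < triDiam K := by
  obtain ⟨x, r, hr0, hsub, -⟩ := hr K hK
  linarith [two_mul_le_triDiam hr0 hsub]

lemma two_le_of_isShapeRegular (hr : IsShapeRegular κ 𝒯) (hK : K ∈ 𝒯.cells) : 2 ≤ κ := by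
  obtain ⟨x, r, hr0, hsub, hκ⟩ := hr K hK
  have := two_mul_le_triDiam hr0 hsub
  nlinarith

/-- The image of a disc in a triangle under a contraction towards a point of the triangle. -/
lemma ball_homothety_subset (hz : z ∈ convexHull ℝ (K : Set Plane)) {r t : ℝ} (ht : 0 < t)
    (ht1 : t ≤ 1) (h : closedBall x r ⊆ convexHull ℝ (K : Set Plane)) :
    ball (z + t • (x - z)) (t * r) ⊆ convexHull ℝ (K : Set Plane) ∩ closedBall z (t * triDiam K) := by
  intro u hu
  have hu' : z + t⁻¹ • (u - z) ∈ closedBall x r := by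
    rw [mem_ball, dist_eq_norm] at hu
    rw [mem_closedBall, dist_eq_norm]
    have e : u - (z + t • (x - z)) = t • (z + t⁻¹ • (u - z) - x) := by
      simp only [smul_sub, smul_add, smul_inv_smul₀ ht.ne']
      abel
    rw [e, norm_smul, Real.norm_of_nonneg ht.le] at hu
    exact (lt_of_mul_lt_mul_left hu ht.le).le
  have hmem := h hu'
  have e2 : u = z + t • (z + t⁻¹ • (u - z) - z) := by
    rw [add_sub_cancel_left, smul_inv_smul₀ ht.ne', add_sub_cancel]
  constructor
  · rw [e2]
    exact (convex_convexHull ℝ _).add_smul_sub_mem hz hmem ⟨ht.le, ht1⟩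
  · rw [mem_closedBall, e2, dist_eq_norm, add_sub_cancel_left, norm_smul,
      Real.norm_of_nonneg ht.le, ← dist_eq_norm]
    gcongr
    exact dist_le_triDiam hmem hz

/-- The edges of a triangle are at least as long as the diameter of each disc in it. -/
lemma two_mul_le_dist_vertices (hK : K ∈ 𝒯.cells) (hz : z ∈ K) (hy : y ∈ K) (hne : y ≠ z) {r : ℝ}
    (hr : 0 < r) (h : closedBall x r ⊆ convexHull ℝ (K : Set Plane)) : 2 * r ≤ dist y z := by
  -- the width of the triangle orthogonally to another edge at `z`
  have hcard := 𝒯.card_eq K hK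
  obtain ⟨q, hq, hqz, hqy⟩ : ∃ q ∈ K, q ≠ z ∧ q ≠ y := by
    have h2 : ({z, y} : Finset Plane).card < K.card :=
      lt_of_le_of_lt Finset.card_le_two (by rw [hcard]; norm_num)
    obtain ⟨q, hq, hqn⟩ := Finset.exists_mem_notMem_of_card_lt_card h2
    simp only [Finset.mem_insert, Finset.mem_singleton, not_or] at hqn
    exact ⟨q, hq, hqn.1, hqn.2⟩
  have hKeq : ∀ u ∈ K, u = z ∨ u = y ∨ u = q := by
    have h3 : ({z, y, q} : Finset Plane) = K := by
      refine Finset.eq_of_subset_of_card_le ?_ ?_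
      · intro u hu
        simp only [Finset.mem_insert, Finset.mem_singleton] at hu
        rcases hu with rfl | rfl | rfl <;> assumption
      · rw [hcard, Finset.card_eq_three.2 ⟨z, y, q, hne.symm, hqz.symm, hqy.symm, rfl⟩]
    intro u hu
    rw [← h3] at hu
    simpa using hu
  set p : Plane := !₂[-((q - z) 1), (q - z) 0] with hp
  have hpn : 0 < ‖p‖ := by
    rw [norm_pos_iff]
    intro h0
    apply hqz
    have h1 : p 0 = 0 := by rw [h0]; rfl
    have h2 : p 1 = 0 := by rw [h0]; rfl
    rw [← sub_eq_zero]
    ext i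
    fin_cases i
    · simpa [hp] using h2
    · have h3 : -((q - z) 1) = 0 := h1
      exact neg_eq_zero.1 h3
  have horth : ⟪p, q⟫ = ⟪p, z⟫ := by
    rw [← sub_eq_zero, ← inner_sub_right, PiLp.inner_apply, Fin.sum_univ_two]
    simp [hp]
    ring
  set m := min ⟪p, z⟫ ⟪p, y⟫ with hm
  set M := max ⟪p, z⟫ ⟪p, y⟫ with hM
  have hbounds : convexHull ℝ (K : Set Plane) ⊆ {u | ⟪p, u⟫ ∈ Icc m M} := by
    refine convexHull_min (fun u hu => ?_) ?_
    · rcases hKeq u hu with rfl | rfl | rfl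
      · exact ⟨min_le_left _ _, le_max_left _ _⟩
      · exact ⟨min_le_right _ _, le_max_right _ _⟩
      · simp only [mem_ofPred_eq, horth]
        exact ⟨min_le_left _ _, le_max_left _ _⟩
    · exact (convex_Icc m M).linear_preimage (innerₛₗ ℝ p)
  have hMm : M - m ≤ ‖p‖ * dist y z := by
    have e : M - m = |⟪p, y - z⟫| := by rw [hM, hm, max_sub_min_eq_abs, inner_sub_right]
    rw [e, dist_eq_norm]
    exact abs_real_inner_le_norm _ _
  have hmem : ∀ s : ℝ, |s| = 1 → x + (s * r / ‖p‖) • p ∈ closedBall x r := by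
    intro s hs
    rw [mem_closedBall, dist_eq_norm, add_sub_cancel_left, norm_smul, Real.norm_eq_abs, abs_div,
      abs_mul, hs, abs_of_pos hr, abs_of_pos hpn, one_mul, div_mul_cancel₀ _ hpn.ne']
  have h1 := hbounds (h (hmem 1 (by simp)))
  have h2 := hbounds (h (hmem (-1) (by simp)))
  simp only [mem_ofPred_eq, inner_add_right, real_inner_smul_right, real_inner_self_eq_norm_sq,
    mem_Icc] at h1 h2
  have e1 : 1 * r / ‖p‖ * ‖p‖ ^ 2 = r * ‖p‖ := by field_simp
  have e2 : -1 * r / ‖p‖ * ‖p‖ ^ 2 = -(r * ‖p‖) := by field_simp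
  rw [e1] at h1
  rw [e2] at h2
  have : ‖p‖ * (2 * r) ≤ ‖p‖ * dist y z := by linarith [h1.2, h2.1]
  exact le_of_mul_le_mul_left this hpn

lemma triDiam_le_of_common_edge (hr : IsShapeRegular κ 𝒯) (hK : K ∈ 𝒯.cells) (hyK : y ∈ K)
    (hzK : z ∈ K) (hyL : y ∈ L) (hzL : z ∈ L) (hne : y ≠ z) : triDiam K ≤ κ * triDiam L := by
  obtain ⟨x, r, hr0, hsub, hκ⟩ := hr K hK
  have h2 := two_le_of_isShapeRegular hr hK
  have h3 := two_mul_le_dist_vertices hK hzK hyK hne hr0 hsub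
  have h4 := dist_le_triDiam (subset_convexHull ℝ _ hyL : y ∈ convexHull ℝ (L : Set Plane))
    (subset_convexHull ℝ _ hzL)
  have : r ≤ triDiam L := by linarith
  exact hκ.trans (by gcongr)

lemma exists_ball_diff_hull (𝒯 : TriMesh Ω Ωc) (z : Plane) :
    ∃ s > 0, ∀ K ∈ 𝒯.cells, z ∉ convexHull ℝ (K : Set Plane) →
      ∀ u ∈ ball z s, u ∉ convexHull ℝ (K : Set Plane) := by
  have h : ∀ K ∈ 𝒯.cells, ∀ᶠ u in nhds z, z ∉ convexHull ℝ (K : Set Plane) →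
      u ∉ convexHull ℝ (K : Set Plane) := by
    intro K hK
    by_cases hz : z ∈ convexHull ℝ (K : Set Plane)
    · exact Filter.Eventually.of_forall fun u h => absurd hz h
    · filter_upwards [(isClosed_hull K).isOpen_compl.mem_nhds hz] with u hu _
      exact hu
  obtain ⟨s, hs, hball⟩ := Metric.eventually_nhds_iff_ball.1 ((Filter.eventually_all_finset _).2 h)
  exact ⟨s, hs, fun K hK hz u hu => hball u hu K hK hz⟩

open Classical in
/-- The triangles of the mesh with vertex `z`. -/
noncomputable def starCells (𝒯 : TriMesh Ω Ωc) (z : Plane) : Finset (Finset Plane) :=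
  𝒯.cells.filter fun K => z ∈ K

lemma mem_starCells : K ∈ starCells 𝒯 z ↔ K ∈ 𝒯.cells ∧ z ∈ K := by
  classical
  simp [starCells]

lemma hull_inter_punctured_nonempty (hΩ : IsLipschitzPolygon Ω) (hr : IsShapeRegular κ 𝒯)
    (hK : K ∈ starCells 𝒯 z) {s : ℝ} (hs : 0 < s) :
    (convexHull ℝ (K : Set Plane) ∩ ((Ω ∩ ball z s) \ {z})).Nonempty := by
  obtain ⟨hK, hz⟩ := mem_starCells.1 hK
  obtain ⟨x, r, hr0, hsub, -⟩ := hr K hK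
  have hz' : z ∈ convexHull ℝ (K : Set Plane) := subset_convexHull ℝ _ hz
  have hd := triDiam_pos hr hK
  set t := min 1 (s / (2 * triDiam K)) with ht
  have ht0 : 0 < t := by positivity
  have hts : t * triDiam K < s := by
    calc t * triDiam K ≤ s / (2 * triDiam K) * triDiam K := by gcongr; exact min_le_right _ _
      _ = s / 2 := by field_simp
      _ < s := by linarith
  have hball := ball_homothety_subset hz' ht0 (min_le_left _ _) hsub
  obtain ⟨u, hu, huz⟩ : ∃ u ∈ ball (z + t • (x - z)) (t * r), u ≠ z := by
    by_contra! hcon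
    have hsing : ball (z + t • (x - z)) (t * r) ⊆ {z} := fun u hu => hcon u hu
    have h0 : volume (ball (z + t • (x - z)) (t * r)) = 0 :=
      measure_mono_null hsing (measure_singleton _)
    exact (measure_ball_pos volume _ (by positivity)).ne' h0
  refine ⟨u, (hball hu).1, ⟨?_, ?_⟩, huz⟩
  · rw [← hΩ.interior_closure]
    refine interior_mono (hull_subset_closure hK) ?_
    exact interior_maximal (hball.trans inter_subset_left) isOpen_ball hu
  · exact mem_ball.2 ((mem_closedBall.1 (hball hu).2).trans_lt hts)

/-- Two parts of the star of a vertex share an edge, because the domain minus the vertex is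
connected near the vertex. -/
lemma exists_common_edge (hΩ : IsLipschitzPolygon Ω) (hr : IsShapeRegular κ 𝒯)
    {A B : Finset (Finset Plane)} (hAB : ∀ K, K ∈ starCells 𝒯 z ↔ K ∈ A ∨ K ∈ B) (hA : A.Nonempty)
    (hB : B.Nonempty) : ∃ K ∈ A, ∃ L ∈ B, ∃ y ≠ z, y ∈ K ∧ y ∈ L := by
  obtain ⟨K₀, hK₀⟩ := hA
  obtain ⟨L₀, hL₀⟩ := hB
  have hK₀' := (hAB K₀).2 (Or.inl hK₀)
  have hL₀' := (hAB L₀).2 (Or.inr hL₀)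
  obtain ⟨hK₀c, hzK₀⟩ := mem_starCells.1 hK₀'
  have hzc : z ∈ closure Ω := hull_subset_closure hK₀c (subset_convexHull ℝ _ hzK₀)
  obtain ⟨s, hs, hsep⟩ := exists_ball_diff_hull 𝒯 z
  obtain ⟨Q, hQc, hQs, s', hs', hQ⟩ := exists_punctured_preconnected hΩ hzc hs
  set F : Finset (Finset Plane) → Set Plane := fun A => ⋃ K ∈ A, convexHull ℝ (K : Set Plane)
    with hF
  have hFc : ∀ A, IsClosed (F A) := fun A =>
    isClosed_biUnion_finset fun K _ => isClosed_hull K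
  have hcov : Q ⊆ F A ∪ F B := by
    intro u hu
    obtain ⟨⟨huΩ, hus⟩, -⟩ := hQs hu
    obtain ⟨K, hK, huK⟩ := exists_cell 𝒯 (subset_closure huΩ)
    have hzK : z ∈ convexHull ℝ (K : Set Plane) := by
      by_contra hcon
      exact hsep K hK hcon u hus huK
    have hKs : K ∈ starCells 𝒯 z := mem_starCells.2 ⟨hK, vertex_mem_of_mem_hull hK hK₀c hzK₀ hzK⟩
    rcases (hAB K).1 hKs with h | h
    · exact Or.inl (mem_biUnion h huK)
    · exact Or.inr (mem_biUnion h huK)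
  have hmeet : ∀ K ∈ starCells 𝒯 z, (Q ∩ convexHull ℝ (K : Set Plane)).Nonempty := by
    intro K hK
    obtain ⟨u, hu1, hu2⟩ := hull_inter_punctured_nonempty hΩ hr hK hs'
    exact ⟨u, hQ hu2, hu1⟩
  obtain ⟨u, huQ, huA, huB⟩ := isPreconnected_closed_iff.1 hQc (F A) (F B) (hFc A) (hFc B) hcov
    ((hmeet K₀ hK₀').mono (inter_subset_inter_right _ (subset_biUnion_of_mem
      (u := fun K : Finset Plane => convexHull ℝ (K : Set Plane)) hK₀)))
    ((hmeet L₀ hL₀').mono (inter_subset_inter_right _ (subset_biUnion_of_mem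
      (u := fun K : Finset Plane => convexHull ℝ (K : Set Plane)) hL₀)))
  simp only [hF, mem_iUnion, exists_prop] at huA huB
  obtain ⟨K, hKA, huK⟩ := huA
  obtain ⟨L, hLB, huL⟩ := huB
  have hK := (mem_starCells.1 ((hAB K).2 (Or.inl hKA))).1
  have hL := (mem_starCells.1 ((hAB L).2 (Or.inr hLB))).1
  have huz : u ≠ z := (hQs huQ).2
  refine ⟨K, hKA, L, hLB, ?_⟩
  by_contra! hcon
  have hsub : ((K : Set Plane) ∩ (L : Set Plane)) ⊆ {z} := by
    intro y hy
    by_contra hyz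
    exact hcon y hyz hy.1 hy.2
  have := convexHull_mono hsub (hull_inter hK hL huK huL)
  rw [convexHull_singleton] at this
  exact huz this

/-- The number of triangles at a vertex is bounded: scaled to the same size, they contain disjoint
discs of comparable radii in a common disc. -/
lemma card_starCells_le (hr : IsShapeRegular κ 𝒯) (z : Plane) : ((starCells 𝒯 z).card : ℝ) ≤ κ ^ 2 := by
  rcases (starCells 𝒯 z).eq_empty_or_nonempty with h0 | hne
  · rw [h0]
    simpa using sq_nonneg κ
  obtain ⟨K₀, hK₀, hmin⟩ := Finset.exists_min_image _ triDiam hne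
  set s := triDiam K₀ with hs
  have hs0 : 0 < s := triDiam_pos hr (mem_starCells.1 hK₀).1
  have hκ : 2 ≤ κ := two_le_of_isShapeRegular hr (mem_starCells.1 hK₀).1
  have hball : ∀ K : Finset Plane, ∃ c : Plane, K ∈ starCells 𝒯 z →
      ball c (s / κ) ⊆ convexHull ℝ (K : Set Plane) ∩ closedBall z s := by
    intro K
    by_cases hK : K ∈ starCells 𝒯 z
    · obtain ⟨x, r, hr0, hsub, hκr⟩ := hr K (mem_starCells.1 hK).1
      have hd := triDiam_pos hr (mem_starCells.1 hK).1
      have hle : s ≤ triDiam K := hmin K hK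
      have h1 := ball_homothety_subset (subset_convexHull ℝ _ (mem_starCells.1 hK).2)
        (t := s / triDiam K) (by positivity) (div_le_one_of_le₀ hle hd.le) hsub
      rw [div_mul_cancel₀ _ hd.ne'] at h1
      refine ⟨_, fun _ => (ball_subset_ball ?_).trans h1⟩
      rw [div_mul_eq_mul_div, div_le_div_iff₀ (by linarith) hd, mul_assoc]
      gcongr
      linarith
    · exact ⟨0, fun h => absurd h hK⟩
  choose c hc using hball
  have hdisj : (starCells 𝒯 z : Set (Finset Plane)).PairwiseDisjoint fun K => ball (c K) (s / κ) := by
    intro K hK L hL hne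
    rw [Function.onFun, Set.disjoint_left]
    intro u huK huL
    have h1 := interior_hull_inter_eq_empty (mem_starCells.1 hK).1 (mem_starCells.1 hL).1 hne
    have h2 : u ∈ interior (convexHull ℝ (K : Set Plane) ∩ convexHull ℝ (L : Set Plane)) := by
      refine interior_maximal ?_ (isOpen_ball.inter isOpen_ball) (⟨huK, huL⟩ :
        u ∈ ball (c K) (s / κ) ∩ ball (c L) (s / κ))
      exact inter_subset_inter ((hc K hK).trans inter_subset_left)
        ((hc L hL).trans inter_subset_left)
    rw [h1] at h2
    exact h2
  have hmeas : ∑ K ∈ starCells 𝒯 z, volume (ball (c K) (s / κ)) ≤ volume (closedBall z s) := by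
    rw [← measure_biUnion_finset hdisj fun _ _ => measurableSet_ball]
    exact measure_mono (iUnion₂_subset fun K hK => (hc K hK).trans inter_subset_right)
  have hB0 := (measure_ball_pos volume (0 : Plane) one_pos).ne'
  have hBt : volume (ball (0 : Plane) 1) ≠ ⊤ := measure_ball_lt_top.ne
  simp only [Measure.addHaar_ball volume _ (div_pos hs0 (by linarith : 0 < κ)).le,
    Measure.addHaar_closedBall volume _ hs0.le, Finset.sum_const, nsmul_eq_mul,
    finrank_euclideanSpace_fin] at hmeas
  rw [← mul_assoc, ENNReal.mul_le_mul_iff_left hB0 hBt, ← ENNReal.ofReal_natCast,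
    ← ENNReal.ofReal_mul (by positivity), ENNReal.ofReal_le_ofReal_iff (by positivity)] at hmeas
  have hκ0 : 0 < κ := by linarith
  rw [div_pow, mul_div_assoc', div_le_iff₀ (by positivity), mul_comm] at hmeas
  exact le_of_mul_le_mul_left hmeas (by positivity)

/-- The constant in the comparison of the diameters of the triangles at a vertex. -/
noncomputable def comparConst (κ : ℝ) : ℝ := κ ^ ⌈κ ^ 2⌉₊

/-- In a shape-regular mesh of a Lipschitz polygon, the triangles at a vertex have comparable
diameters: starting from one triangle, each factor `κ` in the size reaches at least one more triangle
of the star, if there is one left. -/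
theorem triDiam_le_of_mem_starCells (hΩ : IsLipschitzPolygon Ω) (hr : IsShapeRegular κ 𝒯)
    (hK : K ∈ starCells 𝒯 z) (hL : L ∈ starCells 𝒯 z) : triDiam K ≤ comparConst κ * triDiam L := by
  classical
  have hκ : 2 ≤ κ := two_le_of_isShapeRegular hr (mem_starCells.1 hK).1
  have hpos : ∀ L ∈ starCells 𝒯 z, 0 < triDiam L := fun L hL => triDiam_pos hr (mem_starCells.1 hL).1
  set S : ℕ → Finset (Finset Plane) := fun j =>
    (starCells 𝒯 z).filter fun L => triDiam K ≤ κ ^ j * triDiam L with hS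
  -- passing from `S j` to `S (j + 1)` reaches another triangle as long as one is missing
  have hgrow : ∀ j, min (j + 1) (starCells 𝒯 z).card ≤ (S j).card := by
    intro j
    induction j with
    | zero =>
      refine (min_le_left _ _).trans (Finset.card_pos.2 ⟨K, ?_⟩)
      simp [hS, hK]
    | succ j ih =>
      have hmono : S j ⊆ S (j + 1) := by
        intro L hL
        simp only [hS, Finset.mem_filter] at hL ⊢
        refine ⟨hL.1, hL.2.trans ?_⟩
        have := hpos L hL.1
        gcongr
        · linarith
        · omega
      by_cases hB : (starCells 𝒯 z \ S j).Nonempty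
      · have hA : (S j).Nonempty := ⟨K, by
          simp only [hS, Finset.mem_filter]
          exact ⟨hK, le_mul_of_one_le_left (hpos K hK).le (one_le_pow₀ (by linarith))⟩⟩
        obtain ⟨K', hK', L', hL', y, hyz, hyK, hyL⟩ := exists_common_edge (z := z) hΩ hr
          (A := S j) (B := starCells 𝒯 z \ S j) (fun M => by
            by_cases hM : M ∈ S j
            · simp [hM, (Finset.mem_filter.1 hM).1]
            · simp [hM]) hA hB
        have hK's := Finset.mem_filter.1 hK'
        have hL's := Finset.mem_sdiff.1 hL'
        have hedge := triDiam_le_of_common_edge hr (mem_starCells.1 hK's.1).1 hyK (mem_starCells.1 hK's.1).2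
          hyL (mem_starCells.1 hL's.1).2 hyz
        have hmem : L' ∈ S (j + 1) := by
          simp only [hS, Finset.mem_filter]
          refine ⟨hL's.1, hK's.2.trans ?_⟩
          rw [pow_succ, mul_assoc]
          gcongr
        have hlt : (S j).card < (S (j + 1)).card :=
          Finset.card_lt_card ⟨hmono, fun h => hL's.2 (h hmem)⟩
        have := min_le_min_right (starCells 𝒯 z).card (Nat.le_succ (j + 1))
        omega
      · rw [Finset.not_nonempty_iff_eq_empty, Finset.sdiff_eq_empty_iff_subset] at hB
        exact (min_le_right _ _).trans (Finset.card_le_card (hB.trans hmono))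
  have hcard : (starCells 𝒯 z).card ≤ ⌈κ ^ 2⌉₊ := by
    have := (card_starCells_le hr z).trans (Nat.le_ceil _)
    exact_mod_cast this
  have hfull : S ⌈κ ^ 2⌉₊ = starCells 𝒯 z :=
    Finset.eq_of_subset_of_card_le (Finset.filter_subset _ _) (by
      have := hgrow ⌈κ ^ 2⌉₊
      omega)
  have := hfull.symm ▸ hL
  exact (Finset.mem_filter.1 this).2

end ShapeRegular

/-! ### Piecewise affine interpolation -/

section Interpolation

/-- A function on an interval that is Lipschitz on each member of a finite closed cover is
Lipschitz: from the left endpoint one moves to the last point of a member containing it, which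
does not have to be used again. -/
lemma abs_sub_le_of_closed_cover {ι : Type*} [DecidableEq ι] (C : ι → Set ℝ) (M : ℝ) (g : ℝ → ℝ)
    (S : Finset ι) (hC : ∀ i ∈ S, IsClosed (C i))
    (hg : ∀ i ∈ S, ∀ s ∈ C i, ∀ t ∈ C i, |g s - g t| ≤ M * |s - t|) {a b : ℝ} (hab : a ≤ b)
    (hcov : Icc a b ⊆ ⋃ i ∈ S, C i) : |g b - g a| ≤ M * (b - a) := by
  induction hn : S.card generalizing S a with
  | zero =>
    rw [Finset.card_eq_zero] at hn
    subst hn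
    simpa using hcov (left_mem_Icc.2 hab)
  | succ n ih =>
    have ha := hcov (left_mem_Icc.2 hab)
    simp only [mem_iUnion, exists_prop] at ha
    obtain ⟨i, hi, hai⟩ := ha
    have hcomp : IsCompact (C i ∩ Icc a b) := isCompact_Icc.inter_left (hC i hi)
    obtain ⟨hs, hmax⟩ := hcomp.isGreatest_sSup ⟨a, hai, left_mem_Icc.2 hab⟩
    set s := sSup (C i ∩ Icc a b) with hs_def
    have h1 := hg i hi s hs.1 a hai
    rw [abs_of_nonneg (by linarith [hs.2.1] : (0 : ℝ) ≤ s - a)] at h1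
    rcases hs.2.2.eq_or_lt with hsb | hsb
    · rwa [hsb] at h1
    have hcov' : Icc s b ⊆ ⋃ j ∈ S.erase i, C j := by
      rw [← closure_Ioc hsb.ne]
      refine closure_minimal (fun t ht => ?_) (isClosed_biUnion_finset fun j hj =>
        hC j (Finset.mem_of_mem_erase hj))
      have htab : t ∈ Icc a b := ⟨hs.2.1.trans ht.1.le, ht.2⟩
      have htc := hcov htab
      simp only [mem_iUnion, exists_prop] at htc ⊢
      obtain ⟨j, hj, htj⟩ := htc
      refine ⟨j, Finset.mem_erase.2 ⟨fun hji => ?_, hj⟩, htj⟩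
      subst hji
      exact (hmax ⟨htj, htab⟩).not_gt ht.1
    have h2 := ih (S.erase i) (fun j hj => hC j (Finset.mem_of_mem_erase hj))
      (fun j hj => hg j (Finset.mem_of_mem_erase hj)) hsb.le hcov'
      (by rw [Finset.card_erase_of_mem hi, hn]; rfl)
    calc |g b - g a| = |(g b - g s) + (g s - g a)| := by congr 1; ring
      _ ≤ |g b - g s| + |g s - g a| := abs_add_le _ _
      _ ≤ M * (b - s) + M * (s - a) := add_le_add h2 h1
      _ = M * (b - a) := by ring

variable {Ω Ωc : Set Plane} {𝒯 : TriMesh Ω Ωc} {K L : Finset Plane} {z x y : Plane} {κ : ℝ}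

open Classical in
/-- The function that is affine on each triangle and takes the values `c` at the vertices, extended
by zero outside the mesh. -/
noncomputable def interp (𝒯 : TriMesh Ω Ωc) (c : Plane → ℝ) (x : Plane) : ℝ :=
  if h : ∃ K ∈ 𝒯.cells, x ∈ convexHull ℝ (K : Set Plane) then
    ∑ z ∈ h.choose, bary h.choose z x * c z
  else 0

lemma interp_eq_sum (hK : K ∈ 𝒯.cells) (hx : x ∈ convexHull ℝ (K : Set Plane)) (c : Plane → ℝ) :
    interp 𝒯 c x = ∑ z ∈ K, bary K z x * c z := by
  classical
  have h : ∃ K ∈ 𝒯.cells, x ∈ convexHull ℝ (K : Set Plane) := ⟨K, hK, hx⟩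
  rw [interp, dif_pos h]
  obtain ⟨hL, hxL⟩ := h.choose_spec
  set L := h.choose with hL_def
  have hinter := hull_inter hK hL hx hxL
  have hinter' := hull_inter hL hK hxL hx
  calc ∑ z ∈ L, bary L z x * c z = ∑ z ∈ K ∩ L, bary L z x * c z := by
        refine (Finset.sum_subset Finset.inter_subset_right fun z hz hzn => ?_).symm
        rw [bary_eq_zero_of_inter hL hz (fun h => hzn (Finset.mem_inter.2 ⟨h, hz⟩)) hinter',
          zero_mul]
    _ = ∑ z ∈ K ∩ L, bary K z x * c z := by
        refine Finset.sum_congr rfl fun z hz => ?_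
        rw [bary_eq_bary hK hL (Finset.mem_inter.1 hz).1 (Finset.mem_inter.1 hz).2 hinter]
    _ = ∑ z ∈ K, bary K z x * c z := by
        refine Finset.sum_subset Finset.inter_subset_left fun z hz hzn => ?_
        rw [bary_eq_zero_of_inter hK hz (fun h => hzn (Finset.mem_inter.2 ⟨hz, h⟩)) hinter,
          zero_mul]

lemma exists_slope (f : Plane →ᵃ[ℝ] ℝ) : ∃ (a : ℝ) (b : Plane), ∀ x, f x = a + ⟪b, x⟫ := by
  refine ⟨f 0, (InnerProductSpace.toDual ℝ Plane).symm f.linear.toContinuousLinearMap, fun x => ?_⟩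
  rw [InnerProductSpace.toDual_symm_apply, LinearMap.coe_toContinuousLinearMap']
  have := bary_combo f 0 x
  rwa [zero_add] at this

lemma exists_interp_affine (hK : K ∈ 𝒯.cells) (c : Plane → ℝ) :
    ∃ (a : ℝ) (b : Plane), (∀ x ∈ convexHull ℝ (K : Set Plane), interp 𝒯 c x = a + ⟪b, x⟫) ∧
      ∀ z ∈ K, a + ⟪b, z⟫ = c z := by
  choose a' b' h using fun z => exists_slope (bary K z)
  set a := ∑ z ∈ K, c z * a' z
  set b := ∑ z ∈ K, c z • b' z
  have hint : ∀ x ∈ convexHull ℝ (K : Set Plane), interp 𝒯 c x = a + ⟪b, x⟫ := by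
    intro x hx
    rw [interp_eq_sum hK hx, sum_inner, ← Finset.sum_add_distrib]
    refine Finset.sum_congr rfl fun z _ => ?_
    rw [h, real_inner_smul_left]
    ring
  refine ⟨a, b, hint, fun z hz => ?_⟩
  rw [← hint z (subset_convexHull ℝ _ hz), interp_eq_sum hK (subset_convexHull ℝ _ hz),
    Finset.sum_eq_single z]
  · rw [bary_self hK hz, one_mul]
  · intro y hy hne
    rw [bary_of_ne hK hy hz hne.symm, zero_mul]
  · exact fun h => absurd hz h

/-- Nodal values that vanish at the boundary vertices give a function that vanishes outside the
domain. -/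
lemma interp_eq_zero (hΩ : IsLipschitzPolygon Ω) {c : Plane → ℝ}
    (hc : ∀ K ∈ 𝒯.cells, ∀ z ∈ K, z ∉ Ω → c z = 0) (hx : x ∉ Ω) : interp 𝒯 c x = 0 := by
  by_cases h : ∃ K ∈ 𝒯.cells, x ∈ convexHull ℝ (K : Set Plane)
  · obtain ⟨K, hK, hxK⟩ := h
    rw [interp_eq_sum hK hxK]
    refine Finset.sum_eq_zero fun z hz => ?_
    by_cases hzΩ : z ∈ Ω
    · rcases ((mem_hull_iff hK).1 hxK z hz).eq_or_lt with h0 | h0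
      · rw [← h0, zero_mul]
      · exact absurd (mem_of_bary_pos hΩ hK hz hzΩ hxK h0) hx
    · rw [hc K hK z hz hzΩ, mul_zero]
  · rw [interp, dif_neg h]

theorem exists_lipschitzWith_interp (hΩ : IsLipschitzPolygon Ω) {c : Plane → ℝ}
    (hc : ∀ K ∈ 𝒯.cells, ∀ z ∈ K, z ∉ Ω → c z = 0) : ∃ M, LipschitzWith M (interp 𝒯 c) := by
  classical
  have h : ∀ K : Finset Plane, ∃ M : ℝ, 0 ≤ M ∧ (K ∈ 𝒯.cells →
      ∀ x ∈ convexHull ℝ (K : Set Plane), ∀ y ∈ convexHull ℝ (K : Set Plane),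
        |interp 𝒯 c x - interp 𝒯 c y| ≤ M * ‖x - y‖) := by
    intro K
    by_cases hK : K ∈ 𝒯.cells
    · obtain ⟨a, b, hab, -⟩ := exists_interp_affine hK c
      refine ⟨‖b‖, norm_nonneg _, fun _ x hx y hy => ?_⟩
      rw [hab x hx, hab y hy, add_sub_add_left_eq_sub, ← inner_sub_right]
      exact abs_real_inner_le_norm _ _
    · exact ⟨0, le_rfl, fun h => absurd h hK⟩
  choose m hm0 hm using h
  set M := ∑ K ∈ 𝒯.cells, m K with hM
  have hM0 : 0 ≤ M := Finset.sum_nonneg fun K _ => hm0 K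
  refine ⟨M.toNNReal, LipschitzWith.of_dist_le_mul fun y x => ?_⟩
  rw [Real.dist_eq, dist_eq_norm, Real.coe_toNNReal M hM0]
  -- the segment is covered by the triangles and the complement of the domain
  set γ : ℝ → Plane := fun t => x + t • (y - x) with hγ
  have hγc : Continuous γ := by fun_prop
  set C : Option (Finset Plane) → Set ℝ := fun o =>
    γ ⁻¹' (o.elim Ωᶜ fun K => convexHull ℝ (K : Set Plane)) with hC
  have hdist : ∀ s t : ℝ, ‖γ s - γ t‖ = |s - t| * ‖y - x‖ := by
    intro s t
    simp only [hγ]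
    rw [add_sub_add_left_eq_sub, ← sub_smul, norm_smul, Real.norm_eq_abs]
  have key := abs_sub_le_of_closed_cover C (M * ‖y - x‖) (fun t => interp 𝒯 c (γ t))
    (insert none (𝒯.cells.image some)) (by
      intro o ho
      rcases o with _ | K
      · exact hΩ.1.isClosed_compl.preimage hγc
      · exact (isClosed_hull K).preimage hγc) (by
      intro o ho s hs t ht
      rcases o with _ | K
      · have h1 : γ s ∉ Ω := hs
        have h2 : γ t ∉ Ω := ht
        rw [interp_eq_zero hΩ hc h1, interp_eq_zero hΩ hc h2, sub_zero, abs_zero]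
        positivity
      · have hK : K ∈ 𝒯.cells := by simpa using ho
        refine (hm K hK _ hs _ ht).trans ?_
        rw [hdist]
        have : m K ≤ M := Finset.single_le_sum (fun K _ => hm0 K) hK
        calc m K * (|s - t| * ‖y - x‖) ≤ M * (|s - t| * ‖y - x‖) := by gcongr
          _ = M * ‖y - x‖ * |s - t| := by ring) (a := 0) (b := 1) zero_le_one (by
      intro t _
      by_cases ht : γ t ∈ Ω
      · obtain ⟨K, hK, htK⟩ := exists_cell 𝒯 (subset_closure ht)
        exact mem_biUnion (x := some K) (by simp [hK]) htK
      · exact mem_biUnion (x := none) (by simp) ht)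
  simpa [hγ] using key

/-- Almost every point of the domain is an interior point of a triangle. -/
lemma ae_mem_interior_hull (𝒯 : TriMesh Ω Ωc) :
    ∀ᵐ x ∂(volume.restrict (closure Ω)),
      ∃ K ∈ 𝒯.cells, x ∈ interior (convexHull ℝ (K : Set Plane)) := by
  rw [ae_restrict_iff' isClosed_closure.measurableSet]
  have h : ∀ K ∈ 𝒯.cells, ∀ᵐ x : Plane, x ∉ frontier (convexHull ℝ (K : Set Plane)) := fun K _ =>
    measure_eq_zero_iff_ae_notMem.1 ((convex_convexHull ℝ (K : Set Plane)).addHaar_frontier volume)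
  filter_upwards [(Filter.eventually_all_finset 𝒯.cells).2 h] with x hx hxΩ
  obtain ⟨K, hK, hxK⟩ := exists_cell 𝒯 hxΩ
  refine ⟨K, hK, ?_⟩
  by_contra hcon
  exact hx K hK ((isClosed_hull K).frontier_eq ▸ ⟨hxK, hcon⟩)

lemma gradient_eq_of_eqOn_affine {f : Plane → ℝ} {s : Set Plane} {a : ℝ} {b : Plane}
    (h : ∀ x ∈ s, f x = a + ⟪b, x⟫) (hx : x ∈ interior s) : gradient f x = b := by
  have h1 : f =ᶠ[nhds x] fun u => a + ⟪b, u⟫ := by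
    filter_upwards [mem_interior_iff_mem_nhds.1 hx] with u hu using h u hu
  rw [h1.gradient_eq]
  refine HasGradientAt.gradient ?_
  have h2 : HasFDerivAt (fun u : Plane => a + ⟪b, u⟫) (innerSL ℝ b) x :=
    (innerSL ℝ b).hasFDerivAt.const_add a
  exact h2

end Interpolation

/-! ### Lipschitz functions in `H¹₀(Ω)` -/

section LipschitzFunctions

open Filter Topology

/-- Dominated convergence in `L²` of a finite measure. -/
lemma exists_Lp_tendsto_of_ae {α F : Type*} [MeasurableSpace α] {μ : Measure α} [IsFiniteMeasure μ]
    [NormedAddCommGroup F] {u : ℕ → Lp F 2 μ} {g : ℕ → α → F} {f : α → F} {B : ℝ}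
    (hu : ∀ k, u k =ᵐ[μ] g k) (hB : ∀ k, ∀ᵐ x ∂μ, ‖g k x‖ ≤ B)
    (hlim : ∀ᵐ x ∂μ, Tendsto (fun k => g k x) atTop (𝓝 (f x))) :
    ∃ w : Lp F 2 μ, w =ᵐ[μ] f ∧ Tendsto u atTop (𝓝 w) := by
  have hgm : ∀ k, AEStronglyMeasurable (g k) μ := fun k =>
    (Lp.aestronglyMeasurable (u k)).congr (hu k)
  have hfm : AEStronglyMeasurable f μ := aestronglyMeasurable_of_tendsto_ae atTop hgm hlim
  have hfB : ∀ᵐ x ∂μ, ‖f x‖ ≤ B := by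
    filter_upwards [hlim, ae_all_iff.2 hB] with x hx hBx
    exact le_of_tendsto' hx.norm hBx
  have hfL : MemLp f 2 μ := MemLp.of_bound hfm B hfB
  refine ⟨hfL.toLp f, hfL.coeFn_toLp, ?_⟩
  rw [tendsto_iff_norm_sub_tendsto_zero]
  have hsq : Tendsto (fun k => ∫⁻ x, ‖u k x - hfL.toLp f x‖ₑ ^ 2 ∂μ) atTop (𝓝 0) := by
    have h := tendsto_lintegral_of_dominated_convergence' (μ := μ)
      (F := fun k x => ‖u k x - hfL.toLp f x‖ₑ ^ 2) (f := fun _ => 0)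
      (fun _ => ENNReal.ofReal (B + B) ^ 2)
      (fun k => ((Lp.aestronglyMeasurable (u k)).sub
        (Lp.aestronglyMeasurable (hfL.toLp f))).enorm.pow_const 2) ?_ ?_ ?_
    · simpa using h
    · intro k
      filter_upwards [hu k, hB k, hfL.coeFn_toLp, hfB] with x h1 h2 h3 h4
      rw [h1, h3, ← ofReal_norm]
      gcongr
      exact (norm_sub_le _ _).trans (add_le_add h2 h4)
    · rw [lintegral_const]
      exact ENNReal.mul_ne_top (ENNReal.pow_ne_top ENNReal.ofReal_ne_top) (measure_ne_top _ _)
    · filter_upwards [ae_all_iff.2 hu, hfL.coeFn_toLp, hlim] with x h1 h2 h3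
      have h4 : Tendsto (fun k => ‖g k x - f x‖ₑ ^ 2) atTop (𝓝 (‖f x - f x‖ₑ ^ 2)) :=
        ((ENNReal.continuous_pow 2).comp continuous_enorm).tendsto _ |>.comp
          (h3.sub tendsto_const_nhds)
      simpa [h1, h2] using h4
  have hnorm : ∀ k, ‖u k - hfL.toLp f‖ ^ 2 = (∫⁻ x, ‖u k x - hfL.toLp f x‖ₑ ^ 2 ∂μ).toReal := by
    intro k
    rw [← ENNReal.toReal_ofReal (sq_nonneg ‖u k - hfL.toLp f‖), ← lintegral_enorm_sq_coeFn]
    congr 1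
    refine lintegral_congr_ae ?_
    filter_upwards [Lp.coeFn_sub (u k) (hfL.toLp f)] with x hx
    rw [hx, Pi.sub_apply]
  have h2 : Tendsto (fun k => ‖u k - hfL.toLp f‖ ^ 2) atTop (𝓝 0) := by
    simp_rw [hnorm]
    exact (ENNReal.tendsto_toReal ENNReal.zero_ne_top).comp hsq
  have h3 := h2.sqrt
  simpa [Real.sqrt_sq (norm_nonneg _)] using h3

variable {Ω : Set Plane}

/-- `H¹₀(Ω)` is closed under bounded almost everywhere convergence of functions and gradients. -/
lemma exists_H01_of_tendsto [IsFiniteMeasure (volume.restrict Ω)] {v : ℕ → H01 Ω}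
    {g : ℕ → Plane → ℝ} {G : ℕ → Plane → Plane} {f : Plane → ℝ} {F : Plane → Plane} {B : ℝ}
    (hv : ∀ k, toL2 (v k) =ᵐ[volume.restrict Ω] g k)
    (hV : ∀ k, wgrad (v k) =ᵐ[volume.restrict Ω] G k)
    (hB : ∀ k, ∀ᵐ x ∂(volume.restrict Ω), ‖g k x‖ ≤ B)
    (hB' : ∀ k, ∀ᵐ x ∂(volume.restrict Ω), ‖G k x‖ ≤ B)
    (hlim : ∀ᵐ x ∂(volume.restrict Ω), Tendsto (fun k => g k x) atTop (𝓝 (f x)))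
    (hlim' : ∀ᵐ x ∂(volume.restrict Ω), Tendsto (fun k => G k x) atTop (𝓝 (F x))) :
    ∃ w : H01 Ω, toL2 w =ᵐ[volume.restrict Ω] f ∧ wgrad w =ᵐ[volume.restrict Ω] F := by
  obtain ⟨p, hp, hpl⟩ := exists_Lp_tendsto_of_ae hv hB hlim
  obtain ⟨q, hq, hql⟩ := exists_Lp_tendsto_of_ae hV hB' hlim'
  have hmem : (WithLp.toLp 2 (p, q) : L2Pair Ω) ∈ H01 Ω := by
    have hcl : IsClosed (H01 Ω : Set (L2Pair Ω)) := Submodule.isClosed_topologicalClosure _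
    refine hcl.mem_of_tendsto (b := atTop) (f := fun k => (v k : L2Pair Ω)) ?_
      (Eventually.of_forall fun k => (v k).2)
    have h := (WithLp.prod_continuous_toLp 2 (L2 Ω) (L2Vec Ω)).tendsto (p, q) |>.comp
      (hpl.prodMk_nhds hql)
    exact h
  exact ⟨⟨_, hmem⟩, hp, hq⟩

lemma exists_H01_of_test {φ : Plane → ℝ} (hφ : ContDiff ℝ ∞ φ) (hφc : HasCompactSupport φ)
    (hφs : tsupport φ ⊆ Ω) :
    ∃ w : H01 Ω, toL2 w =ᵐ[volume.restrict Ω] φ ∧ wgrad w =ᵐ[volume.restrict Ω] gradient φ := by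
  have h1 : MemLp φ 2 (volume.restrict Ω) :=
    (hφ.continuous.memLp_of_hasCompactSupport hφc).restrict Ω
  have hg : gradient φ = fun x => (InnerProductSpace.toDual ℝ Plane).symm (fderiv ℝ φ x) := rfl
  have hgc : Continuous (gradient φ) := by
    rw [hg]
    exact (LinearIsometryEquiv.continuous _).comp (hφ.continuous_fderiv (by simp))
  have hgs : HasCompactSupport (gradient φ) := by
    rw [hg]
    exact (hφc.fderiv ℝ).comp_left (map_zero _)
  have h2 : MemLp (gradient φ) 2 (volume.restrict Ω) :=
    (hgc.memLp_of_hasCompactSupport hgs).restrict Ω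
  have hmem : (WithLp.toLp 2 (h1.toLp φ, h2.toLp (gradient φ)) : L2Pair Ω) ∈ H01 Ω :=
    Submodule.le_topologicalClosure _ (Submodule.subset_span
      ⟨φ, hφ, hφc, hφs, h1.coeFn_toLp, h2.coeFn_toLp⟩)
  exact ⟨⟨_, hmem⟩, h1.coeFn_toLp, h2.coeFn_toLp⟩

/-- The mollification of a Lipschitz function is differentiated by mollifying the almost everywhere
defined derivative. -/
lemma hasFDerivAt_mollify {f : Plane → ℝ} {M : ℝ≥0} (hf : LipschitzWith M f)
    (φ : ContDiffBump (0 : Plane)) (x : Plane) :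
    HasFDerivAt (convolution (φ.normed volume) f (ContinuousLinearMap.lsmul ℝ ℝ) volume)
      (convolution (φ.normed volume) (fderiv ℝ f) (ContinuousLinearMap.lsmul ℝ ℝ) volume x) x := by
  have hφc : Continuous (φ.normed volume) := (φ.contDiff_normed (n := 0)).continuous
  have hφi : Integrable (φ.normed volume) volume :=
    hφc.integrable_of_hasCompactSupport φ.hasCompactSupport_normed
  have hcont : ∀ y : Plane, Continuous fun t => φ.normed volume t * f (y - t) := fun y =>
    hφc.mul (hf.continuous.comp (by fun_prop))
  have hdiff : ∀ᵐ t, DifferentiableAt ℝ f (x - t) :=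
    (quasiMeasurePreserving_sub_left_of_right_invariant volume x).ae hf.ae_differentiableAt
  have h := hasFDerivAt_integral_of_dominated_loc_of_lip (𝕜 := ℝ) (μ := (volume : Measure Plane))
    (F := fun y t => φ.normed volume t * f (y - t))
    (F' := fun t => φ.normed volume t • fderiv ℝ f (x - t)) (x₀ := x)
    (bound := fun t => M * φ.normed volume t) (s := univ) Filter.univ_mem
    (Eventually.of_forall fun y => (hcont y).aestronglyMeasurable)
    ((hcont x).integrable_of_hasCompactSupport φ.hasCompactSupport_normed.mul_right)
    (hφc.aestronglyMeasurable.smul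
      (((measurable_fderiv ℝ f).comp (measurable_const_sub x)).aestronglyMeasurable))
    (Eventually.of_forall fun t => ?_) (hφi.const_mul _) ?_
  · exact h.2
  · refine LipschitzWith.lipschitzOnWith (LipschitzWith.of_dist_le_mul fun y z => ?_)
    have h1 := hf.dist_le_mul (y - t) (z - t)
    rw [dist_sub_right] at h1
    have h2 := φ.nonneg_normed (μ := volume) t
    rw [Real.coe_nnabs, abs_of_nonneg (mul_nonneg (NNReal.coe_nonneg M) h2), Real.dist_eq,
      ← mul_sub, abs_mul, abs_of_nonneg h2, ← Real.dist_eq]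
    calc φ.normed volume t * dist (f (y - t)) (f (z - t)) ≤ φ.normed volume t * (M * dist y z) := by
          gcongr
      _ = M * φ.normed volume t * dist y z := by ring
  · filter_upwards [hdiff] with t ht
    have h1 : HasFDerivAt (fun y => f (y - t)) (fderiv ℝ f (x - t)) x := by
      have h2 := ht.hasFDerivAt.comp x ((hasFDerivAt_id x).sub_const t)
      rw [ContinuousLinearMap.comp_id] at h2
      exact h2
    exact h1.const_mul _

lemma norm_gradient_le_of_lipschitz {f : Plane → ℝ} {M : ℝ≥0} (hf : LipschitzWith M f)
    (x : Plane) : ‖gradient f x‖ ≤ M := by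
  rw [gradient, LinearIsometryEquiv.norm_map]
  exact norm_fderiv_le_of_lipschitz ℝ hf

lemma exists_H01_of_lipschitz_compactSupport (hΩ : IsOpen Ω) (hb : Bornology.IsBounded Ω)
    {f : Plane → ℝ} {M : ℝ≥0} (hf : LipschitzWith M f) (hfc : HasCompactSupport f)
    (hfs : tsupport f ⊆ Ω) :
    ∃ w : H01 Ω, toL2 w =ᵐ[volume.restrict Ω] f ∧ wgrad w =ᵐ[volume.restrict Ω] gradient f := by
  have : IsFiniteMeasure (volume.restrict Ω) := isFiniteMeasure_restrict.2 hb.measure_lt_top.ne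
  -- mollification at a scale below the distance `δ` from the support to the boundary gives test
  -- functions with support in `Ω`
  obtain ⟨δ, hδ, hδΩ⟩ := IsCompact.exists_cthickening_subset_open hfc hΩ hfs
  set ρ : ℕ → ℝ := fun k => δ / (k + 1) with hρ
  have hρ0 : ∀ k, 0 < ρ k := fun k => by positivity
  have hρδ : ∀ k, ρ k ≤ δ := fun k => div_le_self hδ.le (by
    have : (0 : ℝ) ≤ k := k.cast_nonneg
    linarith)
  have hρlim : Tendsto ρ atTop (𝓝 0) := by
    have := tendsto_one_div_add_atTop_nhds_zero_nat (𝕜 := ℝ)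
    simpa [hρ, div_eq_mul_inv] using this.const_mul δ
  set φ : ℕ → ContDiffBump (0 : Plane) := fun k =>
    ⟨ρ k / 2, ρ k, half_pos (hρ0 k), half_lt_self (hρ0 k)⟩ with hφ
  set g : ℕ → Plane → ℝ := fun k =>
    convolution ((φ k).normed volume) f (ContinuousLinearMap.lsmul ℝ ℝ) volume with hg
  have hg_smooth : ∀ k, ContDiff ℝ ∞ (g k) := fun k =>
    (φ k).hasCompactSupport_normed.contDiff_convolution_left (n := ⊤) _ (φ k).contDiff_normed
      hf.continuous.locallyIntegrable
  have hg_comp : ∀ k, HasCompactSupport (g k) := fun k =>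
    (φ k).hasCompactSupport_normed.convolution _ hfc
  have hg_supp : ∀ k, tsupport (g k) ⊆ Ω := by
    intro k
    refine (closure_minimal ?_ isClosed_cthickening).trans hδΩ
    refine (support_convolution_subset _).trans ?_
    rintro _ ⟨s, hs, t, ht, rfl⟩
    rw [(φ k).support_normed_eq, mem_ball_zero_iff] at hs
    refine mem_cthickening_of_dist_le _ t δ _ (subset_tsupport _ ht) ?_
    rw [dist_eq_norm, add_sub_cancel_right]
    exact hs.le.trans (hρδ k)
  have hg_near : ∀ k x, dist (g k x) (f x) ≤ M * ρ k := by
    intro k x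
    refine ContDiffBump.dist_normed_convolution_le hf.continuous.aestronglyMeasurable
      fun y hy => ?_
    refine (hf.dist_le_mul y x).trans ?_
    gcongr
    exact (mem_ball.1 hy).le
  have hg_lip : ∀ k x, ‖gradient (g k) x‖ ≤ M := by
    intro k x
    rw [gradient, LinearIsometryEquiv.norm_map, (hasFDerivAt_mollify hf (φ k) x).fderiv,
      convolution_def]
    refine (norm_integral_le_of_norm_le
      (g := fun t => (φ k).normed volume t * M) ?_ ?_).trans (le_of_eq ?_)
    · exact (((φ k).contDiff_normed (n := 0)).continuous.integrable_of_hasCompactSupport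
        (φ k).hasCompactSupport_normed).mul_const _
    · refine Eventually.of_forall fun t => ?_
      rw [ContinuousLinearMap.lsmul_apply, norm_smul, Real.norm_of_nonneg ((φ k).nonneg_normed t)]
      exact mul_le_mul_of_nonneg_left (norm_fderiv_le_of_lipschitz ℝ hf) ((φ k).nonneg_normed t)
    · rw [integral_mul_const, (φ k).integral_normed, one_mul]
  obtain ⟨B, hB⟩ := hf.continuous.bounded_above_of_compact_support hfc
  choose v hv1 hv2 using fun k => exists_H01_of_test (hg_smooth k) (hg_comp k) (hg_supp k)
  have hfd : LocallyIntegrable (fderiv ℝ f) (volume : Measure Plane) := by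
    refine (memLp_top_of_bound (measurable_fderiv ℝ f).aestronglyMeasurable M
      (Eventually.of_forall fun x => norm_fderiv_le_of_lipschitz ℝ hf)).locallyIntegrable le_top
  have hae := ContDiffBump.ae_convolution_tendsto_right_of_locallyIntegrable (φ := φ) (l := atTop)
    (K := 2) hρlim (Eventually.of_forall fun k => by simp [hφ]; linarith) hfd
  refine exists_H01_of_tendsto (B := max (B + M * δ) M) hv1 hv2 (fun k => ?_) (fun k => ?_) ?_ ?_
  · refine Eventually.of_forall fun x => le_trans ?_ (le_max_left _ _)
    have h1 := hg_near k x
    have h2 : (M : ℝ) * ρ k ≤ M * δ := by gcongr; exact hρδ k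
    rw [dist_eq_norm, norm_sub_rev] at h1
    have h3 := norm_le_norm_add_norm_sub (f x) (g k x)
    linarith [hB x]
  · exact Eventually.of_forall fun x => (hg_lip k x).trans (le_max_right _ _)
  · refine Eventually.of_forall fun x => ?_
    rw [tendsto_iff_dist_tendsto_zero]
    refine squeeze_zero (fun k => dist_nonneg) (fun k => hg_near k x) ?_
    simpa using hρlim.const_mul (M : ℝ)
  · filter_upwards [ae_restrict_of_ae hae] with x hx
    have : Tendsto (fun k => (InnerProductSpace.toDual ℝ Plane).symm (fderiv ℝ (g k) x)) atTop
        (𝓝 ((InnerProductSpace.toDual ℝ Plane).symm (fderiv ℝ f x))) := by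
      refine ((LinearIsometryEquiv.continuous _).tendsto _).comp ?_
      refine hx.congr fun k => ?_
      exact (hasFDerivAt_mollify hf (φ k) x).fderiv.symm
    exact this

/-- The derivative of a Lipschitz function vanishes almost everywhere on its zero set: where the
absolute value is differentiable as well, it has a minimum. -/
lemma ae_gradient_eq_zero {f : Plane → ℝ} {M : ℝ≥0} (hf : LipschitzWith M f) :
    ∀ᵐ x, f x = 0 → gradient f x = 0 := by
  have habs : LipschitzWith M fun x => |f x| := by
    refine LipschitzWith.of_dist_le_mul fun x y => ?_
    rw [Real.dist_eq]
    exact (abs_abs_sub_abs_le _ _).trans (hf.dist_le_mul x y)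
  filter_upwards [habs.ae_differentiableAt (μ := volume)] with x hx h0
  have hmin : IsLocalMin (fun x => |f x|) x :=
    Eventually.of_forall fun y => by simp [h0]
  have h1 := hx.hasFDerivAt
  rw [hmin.fderiv_eq_zero] at h1
  have h2 : HasFDerivAt f (0 : Plane →L[ℝ] ℝ) x := by
    rw [hasFDerivAt_iff_isLittleO_nhds_zero] at h1 ⊢
    refine Asymptotics.IsBigO.trans_isLittleO ?_ h1
    refine Asymptotics.IsBigO.of_bound 1 (Eventually.of_forall fun h => ?_)
    simp [h0]
  rw [gradient, h2.fderiv, map_zero]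

/-- A Lipschitz function that vanishes outside the bounded open set `Ω` belongs to `H¹₀(Ω)`, with
its almost everywhere defined gradient as weak gradient. -/
theorem exists_H01_of_lipschitz (hΩ : IsOpen Ω) (hb : Bornology.IsBounded Ω)
    {f : Plane → ℝ} {M : ℝ≥0} (hf : LipschitzWith M f) (hf0 : ∀ x, x ∉ Ω → f x = 0) :
    ∃ w : H01 Ω, toL2 w =ᵐ[volume.restrict Ω] f ∧ wgrad w =ᵐ[volume.restrict Ω] gradient f := by
  have : IsFiniteMeasure (volume.restrict Ω) := isFiniteMeasure_restrict.2 hb.measure_lt_top.ne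
  -- the values between `-ε` and `ε` are removed
  set ε : ℕ → ℝ := fun k => 1 / ((k : ℝ) + 1) with hε
  have hε0 : ∀ k, 0 < ε k := fun k => by positivity
  have hεlim : Tendsto ε atTop (𝓝 0) := tendsto_one_div_add_atTop_nhds_zero_nat
  set g : ℕ → Plane → ℝ := fun k x => f x - max (min (f x) (ε k)) (-ε k) with hg
  have hg_lip : ∀ k, LipschitzWith (M + M) (g k) := fun k =>
    hf.sub ((hf.min_const _).max_const _)
  have hg_zero : ∀ k x, |f x| ≤ ε k → g k x = 0 := by
    intro k x hx
    simp only [hg]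
    rw [abs_le] at hx
    rw [min_eq_left hx.2, max_eq_left hx.1, sub_self]
  have hg_near : ∀ k x, |g k x - f x| ≤ ε k := by
    intro k x
    simp only [hg, sub_sub_cancel_left, abs_neg]
    exact abs_le.2 ⟨le_max_right _ _, max_le (min_le_right _ _) (by linarith [hε0 k])⟩
  have hg_supp : ∀ k, tsupport (g k) ⊆ {x | ε k ≤ |f x|} := by
    intro k
    refine closure_minimal (fun x hx => ?_) (isClosed_le continuous_const hf.continuous.abs)
    by_contra hcon
    exact hx (hg_zero k x (not_le.1 hcon).le)
  have hsub : ∀ k, tsupport (g k) ⊆ Ω := by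
    intro k x hx
    by_contra hcon
    have h1 : ε k ≤ |f x| := hg_supp k hx
    rw [hf0 x hcon, abs_zero] at h1
    exact absurd h1 (not_le.2 (hε0 k))
  have hcomp : ∀ k, HasCompactSupport (g k) := fun k =>
    Metric.isCompact_of_isClosed_isBounded (isClosed_tsupport _) (hb.subset (hsub k))
  choose v hv1 hv2 using fun k =>
    exists_H01_of_lipschitz_compactSupport hΩ hb (hg_lip k) (hcomp k) (hsub k)
  have hfc : HasCompactSupport f := by
    refine HasCompactSupport.of_support_subset_isCompact
      (Metric.isCompact_of_isClosed_isBounded isClosed_closure hb.closure) fun x hx => ?_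
    by_contra hcon
    exact hx (hf0 x fun h => hcon (subset_closure h))
  obtain ⟨B, hB⟩ := hf.continuous.bounded_above_of_compact_support hfc
  refine exists_H01_of_tendsto (B := max (B + 1) (M + M)) hv1 hv2 (fun k => ?_) (fun k => ?_) ?_ ?_
  · refine Eventually.of_forall fun x => le_trans ?_ (le_max_left _ _)
    have h1 := hg_near k x
    have h2 : ε k ≤ 1 := by
      rw [hε]
      exact div_le_one_of_le₀ (by linarith [(k.cast_nonneg : (0 : ℝ) ≤ k)]) (by positivity)
    rw [← Real.norm_eq_abs, norm_sub_rev] at h1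
    have h3 := norm_le_norm_add_norm_sub (f x) (g k x)
    linarith [hB x]
  · exact Eventually.of_forall fun x =>
      (norm_gradient_le_of_lipschitz (hg_lip k) x).trans (le_max_right _ _)
  · refine Eventually.of_forall fun x => ?_
    rw [tendsto_iff_dist_tendsto_zero]
    exact squeeze_zero (fun k => dist_nonneg) (fun k => hg_near k x) hεlim
  · filter_upwards [ae_restrict_of_ae (ae_gradient_eq_zero hf)] with x hx
    by_cases h0 : f x = 0
    · rw [hx h0]
      refine tendsto_const_nhds.congr fun k => ?_
      have h1 : g k =ᶠ[𝓝 x] fun _ => 0 := by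
        have h2 : ∀ᶠ y in 𝓝 x, |f y| < ε k := by
          refine hf.continuous.abs.continuousAt.eventually (gt_mem_nhds ?_)
          simpa [h0] using hε0 k
        filter_upwards [h2] with y hy using hg_zero k y hy.le
      rw [h1.gradient_eq]
      simp [gradient]
    · refine tendsto_const_nhds.congr' ?_
      filter_upwards [hεlim.eventually (gt_mem_nhds (abs_pos.2 h0))] with k hk
      have h2 : ∀ᶠ y in 𝓝 x, ε k < |f y| :=
        hf.continuous.abs.continuousAt.eventually (lt_mem_nhds hk)
      -- near the point the truncation subtracts a constant
      have h3 : ∃ c : ℝ, g k =ᶠ[𝓝 x] fun y => f y - c := by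
        rcases lt_or_gt_of_ne h0 with hneg | hpos
        · refine ⟨-ε k, ?_⟩
          filter_upwards [h2, hf.continuous.continuousAt.eventually (gt_mem_nhds hneg)] with y h4 h5
          rw [abs_of_neg h5] at h4
          simp only [hg]
          rw [min_eq_left (by linarith [hε0 k]), max_eq_right (by linarith)]
        · refine ⟨ε k, ?_⟩
          filter_upwards [h2, hf.continuous.continuousAt.eventually (lt_mem_nhds hpos)] with y h4 h5
          rw [abs_of_pos h5] at h4
          simp only [hg]
          rw [min_eq_right h4.le, max_eq_left (by linarith [hε0 k])]
      obtain ⟨c, hc⟩ := h3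
      rw [hc.gradient_eq]
      simp only [gradient]
      rw [fderiv_sub_const]

end LipschitzFunctions

/-! ### Finite element functions at the vertices -/

section DiscreteExtension

open Filter Topology

variable {Ω Ωc : Set Plane} {𝒯 : TriMesh Ω Ωc} {K L : Finset Plane} {z x y : Plane} {κ : ℝ}

lemma IsLipschitzPolygon.volume_frontier {D : Set Plane} (hD : IsLipschitzPolygon D) :
    volume (frontier D) = 0 := by
  obtain ⟨S, hS⟩ := hD.2.2.1
  refine measure_mono_null hS ((measure_biUnion_null_iff S.countable_toSet).2 fun p _ => ?_)
  have hsub : segment ℝ p.1 p.2 ⊆ (affineSpan ℝ {p.1, p.2} : Set Plane) := by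
    rw [← convexHull_pair]
    exact convexHull_subset_affineSpan _
  refine measure_mono_null hsub (Measure.addHaar_affineSubspace volume _ fun htop => ?_)
  have h1 := collinear_iff_finrank_le_one.1 (collinear_pair ℝ p.1 p.2)
  rw [← direction_affineSpan, htop, AffineSubspace.direction_top, finrank_top,
    finrank_euclideanSpace_fin] at h1
  omega

lemma hull_subset_closure_of_mem (hΩc : IsOpen Ωc) (hK : K ∈ 𝒯.cells)
    (hx : x ∈ convexHull ℝ (K : Set Plane)) (hxc : x ∈ Ωc) :
    convexHull ℝ (K : Set Plane) ⊆ closure Ωc := by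
  refine (𝒯.fitted K hK).resolve_right fun h => ?_
  obtain ⟨u, huc, -, hu⟩ := mem_closure_iff.1 (h hx) Ωc hΩc hxc
  exact hu (subset_closure huc)

lemma exists_starCells_subset_closure (hΩc : IsOpen Ωc) (hsub : Ωc ⊆ Ω) (hK : K ∈ 𝒯.cells)
    (hz : z ∈ K) (hzc : z ∈ closure Ωc) :
    ∃ L ∈ starCells 𝒯 z, convexHull ℝ (L : Set Plane) ⊆ closure Ωc := by
  classical
  set S : Finset (Finset Plane) := 𝒯.cells.filter fun L : Finset Plane => convexHull ℝ (L : Set Plane) ⊆ closure Ωc with hS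
  have hcov : closure Ωc ⊆ ⋃ L ∈ S, convexHull ℝ (L : Set Plane) := by
    refine closure_minimal (fun u hu => ?_) (isClosed_biUnion_finset fun L _ => isClosed_hull L)
    obtain ⟨L, hL, huL⟩ := exists_cell 𝒯 (subset_closure (hsub hu))
    exact mem_biUnion (Finset.mem_filter.2 ⟨hL, hull_subset_closure_of_mem hΩc hL huL hu⟩) huL
  have h := hcov hzc
  simp only [mem_iUnion, exists_prop] at h
  obtain ⟨L, hL, hzL⟩ := h
  rw [hS, Finset.mem_filter] at hL
  exact ⟨L, mem_starCells.2 ⟨hL.1, vertex_mem_of_mem_hull hL.1 hK hz hzL⟩, hL.2⟩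

lemma one_le_comparConst (hκ : 2 ≤ κ) : 1 ≤ comparConst κ := one_le_pow₀ (by linarith)

/-- The value at a vertex of a function that is affine on a triangle at the vertex, compared with
the values at distance at most `h`, where `h` is bounded by the size of the triangle. -/
lemma ae_abs_vertex_sub_le (hΩ : MeasurableSet Ω) (hr : IsShapeRegular κ 𝒯)
    (hL : L ∈ starCells 𝒯 z) (w : H01 Ω) {a : ℝ} {b : Plane}
    (haff : ∀ᵐ u ∂(volume.restrict (convexHull ℝ (L : Set Plane))), zeroExt w u = a + ⟪b, u⟫)
    {C h : ℝ} (hC : 1 ≤ C) (hh : 0 < h) (hhL : h ≤ C * triDiam L) :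
    ∀ᵐ x, x ∈ ball z h →
      |a + ⟪b, z⟫ - zeroExt w x| ≤ nodalConst (1 / (2 * C * κ)) * h * gradMax w x := by
  obtain ⟨hLc, hz⟩ := mem_starCells.1 hL
  obtain ⟨x₀, r, hr0, hsub, hκr⟩ := hr L hLc
  have hκ := two_le_of_isShapeRegular hr hLc
  have hd := triDiam_pos hr hLc
  have hC0 : 0 < C := by linarith
  set t := h / (2 * C * triDiam L) with ht
  have ht0 : 0 < t := by positivity
  have ht1 : t ≤ 1 := by
    rw [ht, div_le_one (by positivity)]
    nlinarith
  have htd : t * triDiam L = h / (2 * C) := by rw [ht]; field_simp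
  have hball := ball_homothety_subset (subset_convexHull ℝ _ hz) ht0 ht1 hsub
  have hle : 1 / (2 * C * κ) * h ≤ t * r := by
    have h1 : h / (2 * C) ≤ t * (κ * r) := by rw [← htd]; gcongr
    have h2 : 1 / (2 * C * κ) * h = h / (2 * C) / κ := by field_simp
    rw [h2, div_le_iff₀ (by linarith)]
    linarith
  have hball' := (ball_subset_ball hle).trans hball
  refine ae_abs_affine_sub_le hΩ w (y := z + t • (x₀ - z)) (by positivity) hh ?_
    (ae_restrict_of_ae_restrict_of_subset (hball'.trans inter_subset_left) haff)
  refine hball'.trans (inter_subset_right.trans (closedBall_subset_ball ?_))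
  rw [htd, div_lt_iff₀ (by positivity)]
  nlinarith

lemma zeroExt_ae_eq {D : Set Plane} (hD : IsLipschitzPolygon D) (hsub : D ⊆ Ω) {w : H01 Ω}
    {f : Plane → ℝ} (hf : toL2 w =ᵐ[volume.restrict D] f) {s : Set Plane} (hs : MeasurableSet s)
    (hsD : s ⊆ closure D) : zeroExt w =ᵐ[volume.restrict s] f := by
  have h1 : ∀ᵐ x : Plane, x ∉ frontier D := measure_eq_zero_iff_ae_notMem.1 hD.volume_frontier
  change ∀ᵐ x ∂(volume.restrict s), zeroExt w x = f x
  rw [ae_restrict_iff' hs]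
  filter_upwards [h1, (ae_restrict_iff' hD.1.measurableSet).1 hf] with x hx1 hx2 hxs
  have hxD : x ∈ D := by
    by_contra hcon
    exact hx1 (hD.1.frontier_eq ▸ ⟨hsD hxs, hcon⟩)
  rw [zeroExt, indicator_of_mem (hsub hxD), hx2 hxD]

/-- A finite element function in `H¹₀(Ω)` vanishes at the vertices on the boundary: otherwise the
maximal function of its gradient would not be square integrable near the vertex. -/
lemma vertex_value_eq_zero (hΩ : IsLipschitzPolygon Ω) (hr : IsShapeRegular κ 𝒯) {d : H01 Ω}
    {f : Plane → ℝ} (hdf : toL2 d =ᵐ[volume.restrict Ω] f) (hK : K ∈ 𝒯.cells) {a : ℝ} {b : Plane}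
    (hf : ∀ x ∈ convexHull ℝ (K : Set Plane), f x = a + ⟪b, x⟫) (hz : z ∈ K) (hzΩ : z ∉ Ω) :
    f z = 0 := by
  have hzc : z ∈ closure Ω := hull_subset_closure hK (subset_convexHull ℝ _ hz)
  have hzf : z ∈ frontier Ω := hΩ.1.frontier_eq ▸ ⟨hzc, hzΩ⟩
  have hΩm := hΩ.1.measurableSet
  have hd := triDiam_pos hr hK
  have hKm : MeasurableSet (convexHull ℝ (K : Set Plane)) := (isClosed_hull K).measurableSet
  have haff : ∀ᵐ u ∂(volume.restrict (convexHull ℝ (K : Set Plane))),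
      zeroExt d u = a + ⟪b, u⟫ := by
    filter_upwards [zeroExt_ae_eq hΩ Subset.rfl hdf hKm (hull_subset_closure hK),
      self_mem_ae_restrict hKm] with u h1 h2
    rw [h1, hf u h2]
  obtain ⟨c, hc, hext⟩ := exists_exterior_ball hΩ hd
  set A := nodalConst (1 / (2 * 1 * κ)) + 8 / c ^ 2 with hA
  set V := volume.real (ball (0 : Plane) 1) with hV
  have hV0 : 0 < V := ENNReal.toReal_pos (measure_ball_pos _ _ one_pos).ne' measure_ball_lt_top.ne
  have hG := integrable_gradMax_sq hΩm d
  have hbound : ∀ h, 0 < h → h ≤ triDiam K →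
      f z ^ 2 * V ≤ A ^ 2 * ∫ x in ball z h, gradMax d x ^ 2 := by
    intro h hh hhd
    obtain ⟨y, hy⟩ := hext z hzf h hh hhd
    have h1 := ae_abs_vertex_sub_le hΩm hr (mem_starCells.2 ⟨hK, hz⟩) d haff le_rfl hh
      (by rwa [one_mul])
    have h2 := ae_abs_zeroExt_le hΩm d hc hh hy
    have h3 : ∀ᵐ x ∂(volume.restrict (ball z h)), f z ^ 2 ≤ A ^ 2 * h ^ 2 * gradMax d x ^ 2 := by
      rw [ae_restrict_iff' measurableSet_ball]
      filter_upwards [h1, h2] with x h1 h2 hx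
      have h4 : |f z| ≤ A * h * gradMax d x := by
        rw [hf z (subset_convexHull ℝ _ hz)]
        calc |a + ⟪b, z⟫| = |(a + ⟪b, z⟫ - zeroExt d x) + zeroExt d x| := by rw [sub_add_cancel]
          _ ≤ |a + ⟪b, z⟫ - zeroExt d x| + |zeroExt d x| := abs_add_le _ _
          _ ≤ _ := (add_le_add (h1 hx) (h2 hx)).trans (le_of_eq (by rw [hA]; ring))
      rw [← sq_abs, ← mul_pow, ← mul_pow]
      exact pow_le_pow_left₀ (abs_nonneg _) h4 2
    have hconst : IntegrableOn (fun _ : Plane => f z ^ 2) (ball z h) :=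
      integrableOn_const measure_ball_lt_top.ne
    have h5 := integral_mono_ae (μ := volume.restrict (ball z h)) hconst ((hG.integrableOn (s := ball z h)).const_mul _) h3
    rw [setIntegral_const, integral_const_mul, smul_eq_mul] at h5
    have h6 : volume.real (ball z h) = h ^ 2 * V := by
      simp only [hV, Measure.real, Measure.addHaar_ball volume _ hh.le, ENNReal.toReal_mul,
        finrank_euclideanSpace_fin]
      rw [ENNReal.toReal_ofReal (by positivity)]
    rw [h6] at h5
    have h7 : h ^ 2 * (f z ^ 2 * V) ≤ h ^ 2 * (A ^ 2 * ∫ x in ball z h, gradMax d x ^ 2) := by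
      linarith
    exact le_of_mul_le_mul_left h7 (by positivity)
  have hlim : Tendsto (fun n : ℕ => ∫ x in ball z (1 / ((n : ℝ) + 1)), gradMax d x ^ 2) atTop
      (𝓝 0) := by
    have h1 := tendsto_setIntegral_of_antitone (μ := volume) (f := fun x => gradMax d x ^ 2)
      (s := fun n : ℕ => ball z (1 / ((n : ℝ) + 1))) (fun _ => measurableSet_ball)
      (fun m n hmn => ball_subset_ball (Nat.one_div_le_one_div hmn)) ⟨0, hG.integrableOn⟩
    have h2 : ⋂ n : ℕ, ball z (1 / ((n : ℝ) + 1)) = {z} := by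
      ext u
      simp only [mem_iInter, mem_ball, mem_singleton_iff]
      refine ⟨fun h => ?_, fun h n => by rw [h, dist_self]; positivity⟩
      by_contra hne
      obtain ⟨n, hn⟩ := exists_nat_one_div_lt (dist_pos.2 hne)
      exact absurd (h n) (not_lt.2 hn.le)
    rw [h2] at h1
    simpa using h1
  have hev : ∀ᶠ n : ℕ in atTop, f z ^ 2 * V
      ≤ A ^ 2 * ∫ x in ball z (1 / ((n : ℝ) + 1)), gradMax d x ^ 2 := by
    filter_upwards [(tendsto_one_div_add_atTop_nhds_zero_nat (𝕜 := ℝ)).eventually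
      (gt_mem_nhds hd)] with n hn
    exact hbound _ (by positivity) hn.le
  have hle := ge_of_tendsto (hlim.const_mul (A ^ 2)) hev
  rw [mul_zero] at hle
  have : f z ^ 2 ≤ 0 := by
    by_contra! hcon
    exact absurd hle (not_le.2 (mul_pos hcon hV0))
  exact pow_eq_zero_iff two_ne_zero |>.1 (le_antisymm this (sq_nonneg _))

end DiscreteExtension

/-! ### The discrete extension -/

section DiscreteExtension

open Filter Topology

variable {Ω Ωc : Set Plane} {𝒯 : TriMesh Ω Ωc} {K L : Finset Plane} {z x y : Plane} {κ : ℝ}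

/-- The nodal values of the discrete extension: `0` outside `Ω`, the given value on the closure of
`Ωc`, and a local average of `w` at the other vertices. In each case the value at `z` is close to
`w` on a ball about `z` containing the triangles at `z`. -/
lemma exists_nodal_value (hΩ : IsLipschitzPolygon Ω) (hΩc : IsLipschitzPolygon Ωc) (hsub : Ωc ⊆ Ω)
    (hκ : 2 ≤ κ) : ∃ A : ℝ, 0 < A ∧ ∀ 𝒯 : TriMesh Ω Ωc, IsShapeRegular κ 𝒯 →
      ∀ (w : H01 Ω) (f : Plane → ℝ),
        (∀ K ∈ 𝒯.cells, ∃ (a : ℝ) (b : Plane), ∀ x ∈ convexHull ℝ (K : Set Plane),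
          f x = a + ⟪b, x⟫) →
        toL2 w =ᵐ[volume.restrict Ωc] f →
        ∀ z, (∃ K ∈ 𝒯.cells, z ∈ K) → ∃ c : ℝ, (z ∉ Ω → c = 0) ∧
          (z ∈ closure Ωc → z ∈ Ω → c = f z) ∧
          ∀ K ∈ starCells 𝒯 z, ∀ᵐ x, x ∈ ball z (2 * comparConst κ * triDiam K) →
            |c - zeroExt w x| ≤ A * (2 * comparConst κ * triDiam K) * gradMax w x := by
  have hΩm := hΩ.1.measurableSet
  set C := comparConst κ with hC
  have hC1 : 1 ≤ C := one_le_comparConst hκ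
  set D := diam (closure Ω) with hD
  have hD0 : 0 ≤ D := diam_nonneg
  obtain ⟨c₀, hc₀, hext⟩ := exists_exterior_ball hΩ (d := 2 * C * D + 1) (by positivity)
  have hA1 : 0 < nodalConst (1 / (2 * (2 * C ^ 2) * κ)) := nodalConst_pos (by positivity)
  set A := 8 / c₀ ^ 2 + nodalConst (1 / (2 * (2 * C ^ 2) * κ)) + 8 * (2 * C ^ 2) ^ 2 with hA
  have hA0 : 0 < A := by positivity
  refine ⟨A, hA0, fun 𝒯 hr w f hf hwf z ⟨K₀, hK₀, hzK₀⟩ => ?_⟩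
  have hpos : ∀ K ∈ starCells 𝒯 z, 0 < 2 * C * triDiam K := fun K hK =>
    mul_pos (by positivity) (triDiam_pos hr (mem_starCells.1 hK).1)
  have hmono : ∀ {B : ℝ} {K : Finset Plane} (x : Plane), K ∈ starCells 𝒯 z → B ≤ A →
      B * (2 * C * triDiam K) * gradMax w x ≤ A * (2 * C * triDiam K) * gradMax w x :=
    fun x hK hB => mul_le_mul_of_nonneg_right
      (mul_le_mul_of_nonneg_right hB (hpos _ hK).le) (gradMax_nonneg w x)
  have hzc : z ∈ closure Ω := hull_subset_closure hK₀ (subset_convexHull ℝ _ hzK₀)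
  by_cases hzΩ : z ∈ Ω
  · by_cases hzΩc : z ∈ closure Ωc
    · refine ⟨f z, fun h => absurd hzΩ h, fun _ _ => rfl, fun K hK => ?_⟩
      obtain ⟨L, hL, hLc⟩ := exists_starCells_subset_closure hΩc.1 hsub hK₀ hzK₀ hzΩc
      obtain ⟨a, b, hab⟩ := hf L (mem_starCells.1 hL).1
      have hLm : MeasurableSet (convexHull ℝ (L : Set Plane)) := (isClosed_hull L).measurableSet
      have haff : ∀ᵐ u ∂(volume.restrict (convexHull ℝ (L : Set Plane))),
          zeroExt w u = a + ⟪b, u⟫ := by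
        filter_upwards [zeroExt_ae_eq hΩc hsub hwf hLm hLc, self_mem_ae_restrict hLm] with u h1 h2
        rw [h1, hab u h2]
      have hle : 2 * C * triDiam K ≤ 2 * C ^ 2 * triDiam L := by
        have := triDiam_le_of_mem_starCells hΩ hr hK hL
        calc 2 * C * triDiam K ≤ 2 * C * (C * triDiam L) := by gcongr
          _ = _ := by ring
      filter_upwards [ae_abs_vertex_sub_le hΩm hr hL w haff (by nlinarith : 1 ≤ 2 * C ^ 2)
        (hpos K hK) hle] with x hx hxz
      rw [hab z (subset_convexHull ℝ _ (mem_starCells.1 hL).2)]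
      refine (hx hxz).trans (hmono x hK ?_)
      rw [hA]
      linarith [show 0 ≤ 8 / c₀ ^ 2 by positivity, show 0 ≤ 8 * (2 * C ^ 2) ^ 2 by positivity]
    · set ρ := triDiam K₀ with hρ
      have hK₀' : K₀ ∈ starCells 𝒯 z := mem_starCells.2 ⟨hK₀, hzK₀⟩
      have hρ0 : 0 < ρ := triDiam_pos hr hK₀
      refine ⟨⨍ u in ball z ρ, zeroExt w u, fun h => absurd hzΩ h, fun h => absurd h hzΩc,
        fun K hK => ?_⟩
      have hH := hpos K hK
      set H := 2 * C * triDiam K with hHdef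
      have h1 := triDiam_le_of_mem_starCells hΩ hr hK₀' hK
      have h2 := triDiam_le_of_mem_starCells hΩ hr hK hK₀'
      have hρH : ρ ≤ H := by rw [hHdef]; nlinarith
      have hHρ : H ≤ 2 * C ^ 2 * ρ := by
        calc 2 * C * triDiam K ≤ 2 * C * (C * ρ) := by gcongr
          _ = _ := by ring
      have hcH : ρ / H * H = ρ := div_mul_cancel₀ _ hH.ne'
      have h3 := ae_abs_average_sub_le hΩm w (y := z) (z := z) (div_pos hρ0 hH) hH
        (ball_subset_ball (by rw [hcH]; exact hρH))
      rw [hcH] at h3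
      filter_upwards [h3] with x hx hxz
      refine (hx hxz).trans (hmono x hK ?_)
      have h4 : 8 / (ρ / H) ^ 2 ≤ 8 * (2 * C ^ 2) ^ 2 := by
        rw [div_pow, div_div_eq_mul_div, div_le_iff₀ (by positivity), mul_assoc, ← mul_pow]
        gcongr
      rw [hA]
      linarith [show 0 ≤ 8 / c₀ ^ 2 by positivity]
  · refine ⟨0, fun _ => rfl, fun _ h => absurd h hzΩ, fun K hK => ?_⟩
    have hzf : z ∈ frontier Ω := hΩ.1.frontier_eq ▸ ⟨hzc, hzΩ⟩
    have hKD : triDiam K ≤ D := diam_mono (hull_subset_closure (mem_starCells.1 hK).1)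
      hΩ.2.1.closure
    obtain ⟨y, hy⟩ := hext z hzf (2 * C * triDiam K) (hpos K hK) (by
      have : 2 * C * triDiam K ≤ 2 * C * D := by gcongr
      linarith)
    filter_upwards [ae_abs_zeroExt_le hΩm w hc₀ (hpos K hK) hy] with x hx hxz
    rw [zero_sub, abs_neg]
    refine (hx hxz).trans (hmono x hK ?_)
    rw [hA]
    linarith [show 0 ≤ 8 * (2 * C ^ 2) ^ 2 by positivity]

/-- The slope of an affine function that is within `Q` of a constant at the vertices of a
triangle containing a disc of radius `r`. -/
lemma norm_slope_le {a q Q r : ℝ} {b x₀ : Plane} (hr : 0 < r)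
    (hsub : closedBall x₀ r ⊆ convexHull ℝ (K : Set Plane))
    (h : ∀ z ∈ K, |a + ⟪b, z⟫ - q| ≤ Q) : ‖b‖ ≤ Q / r := by
  have hconv : Convex ℝ {u : Plane | |a + ⟪b, u⟫ - q| ≤ Q} := by
    have h1 : {u : Plane | |a + ⟪b, u⟫ - q| ≤ Q} = innerSL ℝ b ⁻¹' closedBall (q - a) Q := by
      ext u
      rw [mem_preimage, mem_closedBall, Real.dist_eq, innerSL_apply_apply, mem_ofPred_eq,
        show a + ⟪b, u⟫ - q = ⟪b, u⟫ - (q - a) by ring]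
    rw [h1]
    exact (convex_closedBall (q - a) Q).is_linear_preimage (innerSL ℝ b).isLinear
  have hall : convexHull ℝ (K : Set Plane) ⊆ {u : Plane | |a + ⟪b, u⟫ - q| ≤ Q} :=
    convexHull_min (fun z hz => h z hz) hconv
  set e : Plane := ‖b‖⁻¹ • b with he
  have hen : ‖e‖ ≤ 1 := by
    rw [he, norm_smul, norm_inv, norm_norm]
    exact inv_mul_le_one
  have hbe : ⟪b, e⟫ = ‖b‖ := by
    rw [he, real_inner_smul_right, real_inner_self_eq_norm_sq]
    rcases eq_or_ne ‖b‖ 0 with h0 | h0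
    · rw [h0]; simp
    · field_simp
  have hre : ‖r • e‖ ≤ r := by
    rw [norm_smul, Real.norm_of_nonneg hr.le]
    nlinarith
  have hp : x₀ + r • e ∈ closedBall x₀ r := by
    rwa [mem_closedBall, dist_eq_norm, add_sub_cancel_left]
  have hm : x₀ - r • e ∈ closedBall x₀ r := by
    rwa [mem_closedBall, dist_eq_norm, sub_sub_cancel_left, norm_neg]
  have h1 := hall (hsub hp)
  have h2 := hall (hsub hm)
  simp only [mem_ofPred_eq, inner_add_right, inner_sub_right, real_inner_smul_right, hbe] at h1 h2
  rw [le_div_iff₀ hr]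
  linarith [(abs_le.1 h1).2, (abs_le.1 h2).1]

/-- If the nodal values are close to `w`, the gradient of the interpolant is controlled by the
maximal function of the gradient of `w`. -/
lemma ae_norm_gradient_interp_le (hr : IsShapeRegular κ 𝒯) (hκ : 2 ≤ κ)
    {w : H01 Ω} {c : Plane → ℝ} {A : ℝ} (hA : 0 < A)
    (hc : ∀ K ∈ 𝒯.cells, ∀ z ∈ K, ∀ᵐ x, x ∈ ball z (2 * comparConst κ * triDiam K) →
      |c z - zeroExt w x| ≤ A * (2 * comparConst κ * triDiam K) * gradMax w x) :
    ∀ᵐ x ∂(volume.restrict (closure Ω)),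
      ‖gradient (interp 𝒯 c) x‖ ≤ A * (2 * comparConst κ * κ) * gradMax w x := by
  have hC1 : 1 ≤ comparConst κ := one_le_comparConst hκ
  have hall : ∀ᵐ x : Plane, ∀ K ∈ 𝒯.cells, ∀ z ∈ K,
      x ∈ ball z (2 * comparConst κ * triDiam K) →
      |c z - zeroExt w x| ≤ A * (2 * comparConst κ * triDiam K) * gradMax w x :=
    (eventually_all_finset 𝒯.cells).2 fun K hK => (eventually_all_finset K).2 fun z hz => hc K hK z hz
  filter_upwards [ae_mem_interior_hull 𝒯, ae_restrict_of_ae hall] with x ⟨K, hK, hxK⟩ hx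
  obtain ⟨x₀, r, hr0, hsub, hκr⟩ := hr K hK
  have hd := triDiam_pos hr hK
  obtain ⟨a, b, hab, habv⟩ := exists_interp_affine hK c
  rw [gradient_eq_of_eqOn_affine hab hxK]
  have hG := gradMax_nonneg w x
  have h1 := norm_slope_le hr0 hsub (a := a) (b := b) (q := zeroExt w x)
    (Q := A * (2 * comparConst κ * triDiam K) * gradMax w x) fun z hz => by
      rw [habv z hz]
      refine hx K hK z hz ?_
      rw [mem_ball]
      have := dist_le_triDiam (interior_subset hxK) (subset_convexHull ℝ _ hz)
      nlinarith
  refine h1.trans ?_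
  rw [div_le_iff₀ hr0]
  calc A * (2 * comparConst κ * triDiam K) * gradMax w x
      ≤ A * (2 * comparConst κ * (κ * r)) * gradMax w x := by gcongr
    _ = _ := by ring

lemma norm_sq_le_of_ae_norm_le_gradMax (hΩ : MeasurableSet Ω) (w : H01 Ω) {g : L2Vec Ω} {B : ℝ}
    (h : ∀ᵐ x ∂(volume.restrict Ω), ‖g x‖ ≤ B * gradMax w x) :
    ‖g‖ ^ 2 ≤ B ^ 2 * (200 * ‖wgrad w‖ ^ 2) := by
  have hi := (integrable_gradMax_sq hΩ w).const_mul (B ^ 2)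
  have h1 : ENNReal.ofReal (‖g‖ ^ 2) ≤ ENNReal.ofReal (∫ x, B ^ 2 * gradMax w x ^ 2) := by
    rw [← lintegral_enorm_sq_coeFn,
      ofReal_integral_eq_lintegral_ofReal hi (Eventually.of_forall fun x => by positivity)]
    refine (lintegral_mono_ae ?_).trans (setLIntegral_le_lintegral Ω _)
    filter_upwards [h] with x hx
    rw [← ofReal_norm, ← ENNReal.ofReal_pow (norm_nonneg _), ← mul_pow]
    exact ENNReal.ofReal_le_ofReal (pow_le_pow_left₀ (norm_nonneg _) hx 2)
  rw [ENNReal.ofReal_le_ofReal_iff (integral_nonneg fun x => by positivity),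
    integral_const_mul] at h1
  exact h1.trans (mul_le_mul_of_nonneg_left (integral_gradMax_sq_le hΩ w) (sq_nonneg _))

/-- Uniform discrete extension: if a finite element function agrees on `Ωc` with some
`w ∈ H¹₀(Ω)`, then it agrees on `Ωc` with a finite element function whose norm is bounded by that
of `w`, uniformly over a shape-regular family of meshes. -/
theorem exists_discrete_extension (hΩ : IsLipschitzPolygon Ω) (hΩc : IsLipschitzPolygon Ωc)
    (hsub : Ωc ⊆ Ω) (κ : ℝ) : ∃ C : ℝ, 0 < C ∧ ∀ 𝒯 : TriMesh Ω Ωc, IsShapeRegular κ 𝒯 →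
      ∀ d ∈ P1 𝒯, ∀ w : H01 Ω, toL2 w =ᵐ[volume.restrict Ωc] toL2 d →
        ∃ y ∈ P1 𝒯, toL2 y =ᵐ[volume.restrict Ωc] toL2 d ∧ ‖y‖ ≤ C * ‖w‖ := by
  set κ' := max κ 2 with hκ'
  have hκ : 2 ≤ κ' := le_max_right _ _
  have hΩm := hΩ.1.measurableSet
  obtain ⟨A, hA, hnodal⟩ := exists_nodal_value hΩ hΩc hsub hκ
  obtain ⟨CP, hCP, hP⟩ := exists_poincare hΩm hΩ.2.1
  have hC1 : 1 ≤ comparConst κ' := one_le_comparConst hκ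
  set B := A * (2 * comparConst κ' * κ') with hB
  have hB0 : 0 < B := by positivity
  refine ⟨CP * (B * 15), by positivity, fun 𝒯 hr₀ d hd w hwd => ?_⟩
  have hr : IsShapeRegular κ' 𝒯 := fun K hK => by
    obtain ⟨x, r, h1, h2, h3⟩ := hr₀ K hK
    exact ⟨x, r, h1, h2, h3.trans (mul_le_mul_of_nonneg_right (le_max_left _ _) h1.le)⟩
  obtain ⟨f, -, hf, hdf⟩ := hd
  have hdfc : toL2 d =ᵐ[volume.restrict Ωc] f := ae_restrict_of_ae_restrict_of_subset hsub hdf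
  have hex : ∀ z : Plane, ∃ c : ℝ, (∃ K ∈ 𝒯.cells, z ∈ K) → (z ∉ Ω → c = 0) ∧
      (z ∈ closure Ωc → z ∈ Ω → c = f z) ∧
      ∀ K ∈ starCells 𝒯 z, ∀ᵐ x, x ∈ ball z (2 * comparConst κ' * triDiam K) →
        |c - zeroExt w x| ≤ A * (2 * comparConst κ' * triDiam K) * gradMax w x := by
    intro z
    by_cases h : ∃ K ∈ 𝒯.cells, z ∈ K
    · obtain ⟨c, hc⟩ := hnodal 𝒯 hr w f hf (hwd.trans hdfc) z h
      exact ⟨c, fun _ => hc⟩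
    · exact ⟨0, fun h' => absurd h' h⟩
  choose c hc using hex
  have hc0 : ∀ K ∈ 𝒯.cells, ∀ z ∈ K, z ∉ Ω → c z = 0 := fun K hK z hz => (hc z ⟨K, hK, hz⟩).1
  obtain ⟨M, hM⟩ := exists_lipschitzWith_interp hΩ hc0
  obtain ⟨y, hy, hgy⟩ := exists_H01_of_lipschitz hΩ.1 hΩ.2.1 hM fun x hx =>
    interp_eq_zero hΩ hc0 hx
  refine ⟨y, ⟨interp 𝒯 c, hM.continuous.continuousOn, fun K hK => ?_, hy⟩, ?_, ?_⟩
  · obtain ⟨a, b, h, -⟩ := exists_interp_affine hK c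
    exact ⟨a, b, h⟩
  · have hyc : toL2 y =ᵐ[volume.restrict Ωc] interp 𝒯 c :=
      ae_restrict_of_ae_restrict_of_subset hsub hy
    filter_upwards [hyc, hdfc, self_mem_ae_restrict hΩc.1.measurableSet] with x h1 h2 hx
    rw [h1, h2]
    obtain ⟨K, hK, hxK⟩ := exists_cell 𝒯 (subset_closure (hsub hx))
    have hKc := hull_subset_closure_of_mem hΩc.1 hK hxK hx
    obtain ⟨a, b, hab⟩ := hf K hK
    have hcz : ∀ z ∈ K, c z = a + ⟪b, z⟫ := by
      intro z hz
      have hzh := subset_convexHull ℝ (K : Set Plane) hz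
      rw [← hab z hzh]
      by_cases hzΩ : z ∈ Ω
      · exact (hc z ⟨K, hK, hz⟩).2.1 (hKc hzh) hzΩ
      · rw [hc0 K hK z hz hzΩ, vertex_value_eq_zero hΩ hr hdf hK hab hz hzΩ]
    rw [interp_eq_sum hK hxK, hab x hxK, Finset.sum_congr rfl fun z hz => by rw [hcz z hz]]
    simp only [mul_add, Finset.sum_add_distrib, ← Finset.sum_mul]
    rw [sum_bary hK, one_mul]
    conv_rhs => rw [← sum_bary_smul hK x, inner_sum]
    simp only [real_inner_smul_right]
  · have hgrad : ∀ᵐ x ∂(volume.restrict Ω), ‖wgrad y x‖ ≤ B * gradMax w x := by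
      filter_upwards [hgy, ae_restrict_of_ae_restrict_of_subset subset_closure
        (ae_norm_gradient_interp_le hr hκ hA fun K hK z hz =>
          (hc z ⟨K, hK, hz⟩).2.2 K (mem_starCells.2 ⟨hK, hz⟩))] with x h1 h2
      rwa [h1]
    have h1 := norm_sq_le_of_ae_norm_le_gradMax hΩm w hgrad
    have h2 : ‖wgrad y‖ ≤ B * 15 * ‖wgrad w‖ := by
      refine abs_le_of_sq_le_sq' ?_ (by positivity) |>.2
      nlinarith [sq_nonneg (B * ‖wgrad w‖)]
    have h3 : ‖wgrad w‖ ≤ ‖w‖ := by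
      refine abs_le_of_sq_le_sq' ?_ (norm_nonneg _) |>.2
      rw [norm_sq_eq]
      nlinarith [sq_nonneg ‖toL2 w‖]
    calc ‖y‖ ≤ CP * ‖wgrad y‖ := hP y
      _ ≤ CP * (B * 15 * ‖w‖) := by
        gcongr
        exact h2.trans (by gcongr)
      _ = _ := by ring

end DiscreteExtension

/-! ### Finite dimension of the finite element space -/

section WeakGradient

variable {Ω Ωc : Set Plane} {𝒯 : TriMesh Ω Ωc}

lemma inner_gradient (φ : Plane → ℝ) (x e : Plane) : ⟪gradient φ x, e⟫ = fderiv ℝ φ x e :=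
  InnerProductSpace.toDual_symm_apply

/-- The second component of an element of `H¹₀(Ω)` is its weak gradient. -/
lemma integral_toL2_mul_fderiv (v : H01 Ω) {ψ : Plane → ℝ} (hψ : ContDiff ℝ ∞ ψ)
    (hψc : HasCompactSupport ψ) (e : Plane) :
    ∫ x in Ω, toL2 v x * fderiv ℝ ψ x e = -∫ x in Ω, ⟪wgrad v x, ψ x • e⟫ := by
  have hc1 : Continuous fun x => fderiv ℝ ψ x e :=
    (hψ.continuous_fderiv (by simp)).clm_apply continuous_const
  have hs1 : HasCompactSupport fun x => fderiv ℝ ψ x e := (hψc.fderiv_apply (𝕜 := ℝ) e)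
  have hg : MemLp (fun x => fderiv ℝ ψ x e) 2 (volume.restrict Ω) :=
    hc1.memLp_of_hasCompactSupport hs1
  have hG : MemLp (fun x => ψ x • e) 2 (volume.restrict Ω) :=
    (hψ.continuous.smul continuous_const).memLp_of_hasCompactSupport hψc.smul_right
  set z₀ : L2Pair Ω := WithLp.toLp 2 (hg.toLp _, hG.toLp _) with hz₀
  have hinner : ∀ z : L2Pair Ω, inner ℝ z₀ z
      = (∫ x in Ω, z.fst x * fderiv ℝ ψ x e) + ∫ x in Ω, ⟪z.snd x, ψ x • e⟫ := by
    intro z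
    rw [WithLp.prod_inner_apply, L2.inner_def, L2.inner_def]
    congr 1
    · refine integral_congr_ae ?_
      filter_upwards [hg.coeFn_toLp] with x hx
      change inner ℝ (hg.toLp _ x) (z.fst x) = _
      rw [hx]
      rfl
    · refine integral_congr_ae ?_
      filter_upwards [hG.coeFn_toLp] with x hx
      change inner ℝ (hG.toLp _ x) (z.snd x) = _
      rw [hx, real_inner_comm]
  -- the identity says that `z` is orthogonal to `z₀`, a closed condition to be checked on test
  -- functions only
  have hle : H01 Ω ≤ (Submodule.span ℝ {z₀})ᗮ := by
    refine Submodule.topologicalClosure_minimal _ (Submodule.span_le.2 ?_)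
      (Submodule.isClosed_orthogonal _)
    rintro z ⟨φ, hφ, hφc, hφs, h1, h2⟩
    rw [SetLike.mem_coe, Submodule.mem_orthogonal_singleton_iff_inner_right, hinner]
    have h3 : ∫ x in Ω, z.fst x * fderiv ℝ ψ x e = ∫ x, φ x * fderiv ℝ ψ x e := by
      rw [← setIntegral_eq_integral_of_forall_compl_eq_zero (s := Ω)
        (f := fun x => φ x * fderiv ℝ ψ x e) fun x hx => by
          rw [image_eq_zero_of_notMem_tsupport fun h => hx (hφs h), zero_mul]]
      refine integral_congr_ae ?_
      filter_upwards [h1] with x hx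
      rw [hx]
    have h4 : ∫ x in Ω, ⟪z.snd x, ψ x • e⟫ = ∫ x, fderiv ℝ φ x e * ψ x := by
      rw [← setIntegral_eq_integral_of_forall_compl_eq_zero (s := Ω)
        (f := fun x => fderiv ℝ φ x e * ψ x) fun x hx => by
          rw [image_eq_zero_of_notMem_tsupport fun h => hx (hφs (tsupport_fderiv_subset ℝ h)),
            zero_apply, zero_mul]]
      refine integral_congr_ae ?_
      filter_upwards [h2] with x hx
      rw [hx, real_inner_smul_right, inner_gradient, mul_comm]
    have hc2 : Continuous fun x => fderiv ℝ φ x e :=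
      (hφ.continuous_fderiv (by simp)).clm_apply continuous_const
    rw [h3, h4, integral_mul_fderiv_eq_neg_fderiv_mul_of_integrable]
    · ring
    · exact (hc2.mul hψ.continuous).integrable_of_hasCompactSupport hψc.mul_left
    · exact (hφ.continuous.mul hc1).integrable_of_hasCompactSupport hs1.mul_left
    · exact (hφ.continuous.mul hψ.continuous).integrable_of_hasCompactSupport hψc.mul_left
    · exact fun x _ => (hφ.differentiable (by simp)).differentiableAt
    · exact fun x _ => (hψ.differentiable (by simp)).differentiableAt
  have h := Submodule.mem_orthogonal_singleton_iff_inner_right.1 (hle v.2)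
  rw [hinner] at h
  exact eq_neg_of_add_eq_zero_left h

/-- An element of `H¹₀(Ω)` is determined by its function. -/
lemma toL2_injective : Function.Injective (toL2 : H01 Ω → L2 Ω) := by
  suffices h : ∀ v : H01 Ω, toL2 v = 0 → v = 0 by
    intro v w hvw
    exact sub_eq_zero.1 (h (v - w) (show toL2 v - toL2 w = 0 from sub_eq_zero.2 hvw))
  intro v hv
  have h0 : toL2 v =ᵐ[volume.restrict Ω] 0 := hv ▸ Lp.coeFn_zero _ _ _
  have hloc := (Lp.memLp (wgrad v)).locallyIntegrable (by norm_num)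
  have h1 : ∀ᵐ x ∂(volume.restrict Ω), wgrad v x = 0 := by
    refine ae_eq_zero_of_integral_contDiff_smul_eq_zero hloc fun ψ hψ hψc => ?_
    refine ext_inner_right ℝ fun e => ?_
    have hi : Integrable (fun x => ψ x • wgrad v x) (volume.restrict Ω) :=
      hloc.integrable_smul_left_of_hasCompactSupport hψ.continuous hψc
    have h2 := integral_toL2_mul_fderiv v hψ hψc e
    have h3 : ∫ x in Ω, toL2 v x * fderiv ℝ ψ x e = 0 :=
      integral_eq_zero_of_ae (by filter_upwards [h0] with x hx; rw [hx]; simp)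
    rw [inner_zero_left, real_inner_comm, ← integral_inner hi, ← neg_eq_zero, ← h3, h2]
    congr 1
    refine integral_congr_ae (Filter.Eventually.of_forall fun x => ?_)
    simp only [real_inner_smul_right, real_inner_comm e]
  have h2 : wgrad v = 0 := (Lp.eq_zero_iff_ae_eq_zero).2 h1
  have h3 := norm_sq_eq v
  rw [hv, h2] at h3
  simpa using h3

lemma coeFn_toL2_sum {α : Type*} (s : Finset α) (c : α → ℝ) (w : α → H01 Ω) :
    toL2 (∑ i ∈ s, c i • w i) =ᵐ[volume.restrict Ω] fun x => ∑ i ∈ s, c i * toL2 (w i) x := by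
  classical
  induction s using Finset.induction_on with
  | empty => exact Lp.coeFn_zero ℝ 2 (volume.restrict Ω)
  | insert a s ha ih =>
    rw [Finset.sum_insert ha]
    have h1 : toL2 (c a • w a + ∑ i ∈ s, c i • w i)
      = c a • toL2 (w a) + toL2 (∑ i ∈ s, c i • w i) := rfl
    rw [h1]
    filter_upwards [Lp.coeFn_add (c a • toL2 (w a)) (toL2 (∑ i ∈ s, c i • w i)),
      Lp.coeFn_smul (c a) (toL2 (w a)), ih] with x h2 h3 h4
    rw [h2, Pi.add_apply, h3, h4, Finset.sum_insert ha, Pi.smul_apply, smul_eq_mul]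

/-- The finite element space is spanned by its nodal basis functions. -/
lemma finiteDimensional_P1 {κ : ℝ} (hΩ : IsLipschitzPolygon Ω) (hr : IsShapeRegular κ 𝒯) :
    FiniteDimensional ℝ (P1 𝒯) := by
  classical
  set V : Finset Plane := (𝒯.cells.biUnion id).filter fun z => z ∈ Ω with hV
  have hmem : ∀ {z}, z ∈ V ↔ (∃ K ∈ 𝒯.cells, z ∈ K) ∧ z ∈ Ω := by
    intro z
    simp [hV]
  have hex : ∀ z : Plane, ∃ w : H01 Ω, z ∈ V →
      toL2 w =ᵐ[volume.restrict Ω] interp 𝒯 (Pi.single z 1) := by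
    intro z
    by_cases hz : z ∈ V
    · have h0 : ∀ K ∈ 𝒯.cells, ∀ y ∈ K, y ∉ Ω → (Pi.single z 1 : Plane → ℝ) y = 0 := by
        intro K _ y _ hy
        rw [Pi.single_eq_of_ne]
        rintro rfl
        exact hy (hmem.1 hz).2
      obtain ⟨M, hM⟩ := exists_lipschitzWith_interp hΩ h0
      obtain ⟨w, hw, -⟩ := exists_H01_of_lipschitz hΩ.1 hΩ.2.1 hM fun x hx =>
        interp_eq_zero hΩ h0 hx
      exact ⟨w, fun _ => hw⟩
    · exact ⟨0, fun h => absurd h hz⟩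
  choose w hw using hex
  -- the space is spanned by the hat functions `w z` of the vertices inside `Ω`
  have hle : P1 𝒯 ≤ Submodule.span ℝ (V.image w : Set (H01 Ω)) := by
    rintro v ⟨f, -, hf, hvf⟩
    have hsum : v = ∑ z ∈ V, f z • w z := by
      refine toL2_injective (Lp.ext ?_)
      have hall : ∀ᵐ x ∂(volume.restrict Ω), ∀ z ∈ V, toL2 (w z) x = interp 𝒯 (Pi.single z 1) x :=
        (Filter.eventually_all_finset V).2 fun z hz => hw z hz
      filter_upwards [coeFn_toL2_sum V f w, hvf, hall, self_mem_ae_restrict hΩ.1.measurableSet]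
        with x h1 h2 h3 hx
      rw [h1, h2, Finset.sum_congr rfl fun z hz => by rw [h3 z hz]]
      obtain ⟨K, hK, hxK⟩ := exists_cell 𝒯 (subset_closure hx)
      obtain ⟨a, b, hab⟩ := hf K hK
      have h4 : f x = ∑ z ∈ K, bary K z x * f z := by
        rw [hab x hxK, Finset.sum_congr rfl fun z hz => by
          rw [hab z (subset_convexHull ℝ _ hz)]]
        simp only [mul_add, Finset.sum_add_distrib, ← Finset.sum_mul]
        rw [sum_bary hK, one_mul]
        conv_lhs => rw [← sum_bary_smul hK x, inner_sum]
        simp only [real_inner_smul_right]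
      have h5 : ∀ z ∈ V, f z * interp 𝒯 (Pi.single z 1) x
          = if z ∈ K then bary K z x * f z else 0 := by
        intro z _
        rw [interp_eq_sum hK hxK]
        simp only [Pi.single_apply, mul_ite, mul_one, mul_zero, Finset.sum_ite_eq']
        rw [mul_comm]
      rw [Finset.sum_congr rfl h5, ← Finset.sum_filter, h4]
      refine (Finset.sum_subset (fun z hz => (Finset.mem_filter.1 hz).2) fun z hz hzV => ?_).symm
      have hzΩ : z ∉ Ω := fun h => hzV (Finset.mem_filter.2 ⟨hmem.2 ⟨⟨K, hK, hz⟩, h⟩, hz⟩)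
      rw [vertex_value_eq_zero hΩ hr hvf hK hab hz hzΩ, mul_zero]
    rw [hsum]
    exact Submodule.sum_mem _ fun z hz => Submodule.smul_mem _ _
      (Submodule.subset_span (Finset.mem_coe.2 (Finset.mem_image_of_mem w hz)))
  have := FiniteDimensional.span_finset ℝ (V.image w)
  exact Submodule.finiteDimensional_of_le hle

end WeakGradient

/-! ### The mass and stiffness forms -/

section Forms

section Weighted

variable {α F : Type*} [MeasurableSpace α] {m : Measure α} [NormedAddCommGroup F]
  [InnerProductSpace ℝ F]

lemma integrable_weighted_inner {k : α → ℝ} {M : ℝ} (hk : AEMeasurable k m)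
    (hM : ∀ᵐ x ∂m, |k x| ≤ M) (f g : Lp F 2 m) : Integrable (fun x => k x * ⟪f x, g x⟫) m := by
  have h : Integrable (fun x => ⟪f x, g x⟫) m := L2.integrable_inner f g
  exact h.bdd_mul hk.aestronglyMeasurable hM

/-- The bilinear form `∫ k ⟪f, g⟫` on `L²` for a bounded weight `k`. -/
lemma exists_weighted_form {k : α → ℝ} {M : ℝ} (hM0 : 0 ≤ M) (hk : AEMeasurable k m)
    (hM : ∀ᵐ x ∂m, |k x| ≤ M) :
    ∃ B : Lp F 2 m →L[ℝ] Lp F 2 m →L[ℝ] ℝ, ∀ f g, B f g = ∫ x, k x * ⟪f x, g x⟫ ∂m := by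
  have hi := integrable_weighted_inner (F := F) hk hM
  have hbound : ∀ f g : Lp F 2 m, ‖∫ x, k x * ⟪f x, g x⟫ ∂m‖ ≤ M * ‖f‖ * ‖g‖ := by
    intro f g
    have h1 : Integrable (fun x => ‖f x‖ * ‖g x‖) m :=
      (Lp.memLp f).norm.integrable_mul (Lp.memLp g).norm
    have h2 : ∫ x, ‖f x‖ * ‖g x‖ ∂m ≤ ‖f‖ * ‖g‖ := by
      set f' : Lp ℝ 2 m := (Lp.memLp f).norm.toLp _ with hf'
      set g' : Lp ℝ 2 m := (Lp.memLp g).norm.toLp _ with hg'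
      have hf : ‖f'‖ = ‖f‖ := by rw [hf', Lp.norm_toLp, eLpNorm_norm, Lp.norm_def]
      have hg : ‖g'‖ = ‖g‖ := by rw [hg', Lp.norm_toLp, eLpNorm_norm, Lp.norm_def]
      rw [← hf, ← hg]
      refine le_trans (le_of_eq ?_) (real_inner_le_norm f' g')
      rw [L2.inner_def]
      refine integral_congr_ae ?_
      filter_upwards [(Lp.memLp f).norm.coeFn_toLp, (Lp.memLp g).norm.coeFn_toLp] with x h1 h2
      rw [hf', hg', h1, h2]
      exact mul_comm _ _
    refine (norm_integral_le_of_norm_le (h1.const_mul M) ?_).trans ?_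
    · filter_upwards [hM] with x hx
      rw [norm_mul]
      exact mul_le_mul hx (norm_inner_le_norm _ _) (norm_nonneg _) hM0
    · rw [integral_const_mul, mul_assoc]
      exact mul_le_mul_of_nonneg_left h2 hM0
  refine ⟨LinearMap.mkContinuous₂ (LinearMap.mk₂ ℝ (fun f g : Lp F 2 m => ∫ x, k x * ⟪f x, g x⟫ ∂m)
    ?_ ?_ ?_ ?_) M hbound, fun f g => rfl⟩
  · intro f f' g
    rw [← integral_add (hi f g) (hi f' g)]
    refine integral_congr_ae ?_
    filter_upwards [Lp.coeFn_add f f'] with x hx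
    rw [hx, Pi.add_apply, inner_add_left, mul_add]
  · intro c f g
    rw [smul_eq_mul, ← integral_const_mul]
    refine integral_congr_ae ?_
    filter_upwards [Lp.coeFn_smul c f] with x hx
    rw [hx, Pi.smul_apply, real_inner_smul_left]
    ring
  · intro f g g'
    rw [← integral_add (hi f g) (hi f g')]
    refine integral_congr_ae ?_
    filter_upwards [Lp.coeFn_add g g'] with x hx
    rw [hx, Pi.add_apply, inner_add_right, mul_add]
  · intro c f g
    rw [smul_eq_mul, ← integral_const_mul]
    refine integral_congr_ae ?_
    filter_upwards [Lp.coeFn_smul c g] with x hx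
    rw [hx, Pi.smul_apply, real_inner_smul_right]
    ring

end Weighted

variable {Ω Ωc : Set Plane} {σ μ : Plane → ℝ} {σmin σmax μmin μmax : ℝ}

/-- The embedding of `H¹₀(Ω)` into `L²(Ω)` as a continuous linear map. -/
noncomputable def toL2L (Ω : Set Plane) : H01 Ω →L[ℝ] L2 Ω :=
  (WithLp.fstL 2 ℝ (L2 Ω) (L2Vec Ω)).comp (H01 Ω).subtypeL

/-- The weak gradient on `H¹₀(Ω)` as a continuous linear map. -/
noncomputable def wgradL (Ω : Set Plane) : H01 Ω →L[ℝ] L2Vec Ω :=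
  (WithLp.sndL 2 ℝ (L2 Ω) (L2Vec Ω)).comp (H01 Ω).subtypeL

lemma sigmaNormSq_eq_rForm (w : L2 Ω) : sigmaNormSq σ Ωc w = rForm σ Ωc w w := by
  unfold sigmaNormSq rForm
  refine integral_congr_ae (Filter.Eventually.of_forall fun x => ?_)
  simp only [sq_abs]
  ring

lemma rForm_comm (v w : L2 Ω) : rForm σ Ωc v w = rForm σ Ωc w v := by
  unfold rForm
  refine integral_congr_ae (Filter.Eventually.of_forall fun x => ?_)
  ring

lemma rForm_self_nonneg (hσmin : 0 < σmin)
    (hσ : ∀ᵐ x ∂(volume.restrict Ωc), σmin ≤ σ x ∧ σ x ≤ σmax) (w : L2 Ω) :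
    0 ≤ rForm σ Ωc w w := by
  refine integral_nonneg_of_ae ?_
  filter_upwards [hσ] with x hx
  have : 0 ≤ σ x := hσmin.le.trans hx.1
  change 0 ≤ σ x * w x * w x
  rw [mul_assoc]
  exact mul_nonneg this (mul_self_nonneg _)

lemma exists_rForm_clm (hΩc : MeasurableSet Ωc) (hsub : Ωc ⊆ Ω) (hσmin : 0 < σmin)
    (hσm : AEMeasurable σ (volume.restrict Ωc))
    (hσ : ∀ᵐ x ∂(volume.restrict Ωc), σmin ≤ σ x ∧ σ x ≤ σmax) :
    ∃ B : L2 Ω →L[ℝ] L2 Ω →L[ℝ] ℝ, ∀ v w, B v w = rForm σ Ωc v w := by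
  have hk : AEMeasurable (Ωc.indicator σ) (volume.restrict Ω) := by
    rw [aemeasurable_indicator_iff hΩc, Measure.restrict_restrict hΩc, inter_eq_left.2 hsub]
    exact hσm
  have hM : ∀ᵐ x ∂(volume.restrict Ω), |Ωc.indicator σ x| ≤ max σmax 0 := by
    refine ae_restrict_of_ae ?_
    filter_upwards [(ae_restrict_iff' hΩc).1 hσ] with x hx
    by_cases h : x ∈ Ωc
    · rw [indicator_of_mem h, abs_of_nonneg (hσmin.le.trans (hx h).1)]
      exact (hx h).2.trans (le_max_left _ _)
    · rw [indicator_of_notMem h, abs_zero]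
      exact le_max_right _ _
  obtain ⟨B, hB⟩ := exists_weighted_form (F := ℝ) (le_max_right _ _) hk hM
  refine ⟨B, fun v w => ?_⟩
  rw [hB, rForm]
  have h1 : ∀ x, Ωc.indicator σ x * ⟪v x, w x⟫ = Ωc.indicator (fun x => σ x * v x * w x) x := by
    intro x
    by_cases h : x ∈ Ωc
    · rw [indicator_of_mem h, indicator_of_mem h, mul_assoc]
      congr 1
      exact mul_comm _ _
    · rw [indicator_of_notMem h, indicator_of_notMem h, zero_mul]
  simp only [h1]
  rw [setIntegral_indicator hΩc, inter_eq_right.2 hsub]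

lemma ae_eq_zero_of_rForm_self_eq_zero (hsub : Ωc ⊆ Ω) (hσmin : 0 < σmin)
    (hσm : AEMeasurable σ (volume.restrict Ωc))
    (hσ : ∀ᵐ x ∂(volume.restrict Ωc), σmin ≤ σ x ∧ σ x ≤ σmax) {w : L2 Ω}
    (hw : rForm σ Ωc w w = 0) : w =ᵐ[volume.restrict Ωc] 0 := by
  have hle : volume.restrict Ωc ≤ volume.restrict Ω := Measure.restrict_mono hsub le_rfl
  have hwm : MemLp w 2 (volume.restrict Ωc) := (Lp.memLp w).mono_measure hle
  have hint : Integrable (fun x => σ x * w x * w x) (volume.restrict Ωc) := by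
    have h1 : Integrable (fun x => w x * w x) (volume.restrict Ωc) := hwm.integrable_mul hwm
    have h2 := h1.bdd_mul (c := σmax) hσm.aestronglyMeasurable (by
      filter_upwards [hσ] with x hx
      rw [Real.norm_of_nonneg (hσmin.le.trans hx.1)]
      exact hx.2)
    simpa only [mul_assoc] using h2
  have hnn : 0 ≤ᵐ[volume.restrict Ωc] fun x => σ x * w x * w x := by
    filter_upwards [hσ] with x hx
    have : 0 ≤ σ x := hσmin.le.trans hx.1
    change 0 ≤ σ x * w x * w x
    rw [mul_assoc]
    exact mul_nonneg this (mul_self_nonneg _)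
  have h0 := (integral_eq_zero_iff_of_nonneg_ae hnn hint).1 hw
  filter_upwards [h0, hσ] with x hx hσx
  have : σ x ≠ 0 := (hσmin.trans_le hσx.1).ne'
  simpa [this] using hx

lemma ae_eq_zero_rForm (v : L2 Ω) {w : L2 Ω} (hw : w =ᵐ[volume.restrict Ωc] 0) :
    rForm σ Ωc w v = 0 := by
  refine integral_eq_zero_of_ae ?_
  filter_upwards [hw] with x hx
  simp [hx]

lemma exists_aForm_clm (hμmin : 0 < μmin) (hμm : AEMeasurable μ (volume.restrict Ω))
    (hμ : ∀ᵐ x ∂(volume.restrict Ω), μmin ≤ μ x ∧ μ x ≤ μmax) :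
    ∃ B : H01 Ω →L[ℝ] H01 Ω →L[ℝ] ℝ, ∀ v w, B v w = aForm μ v w := by
  have hM : ∀ᵐ x ∂(volume.restrict Ω), |(μ x)⁻¹| ≤ μmin⁻¹ := by
    filter_upwards [hμ] with x hx
    rw [abs_of_pos (inv_pos.2 (hμmin.trans_le hx.1))]
    exact inv_anti₀ hμmin hx.1
  obtain ⟨B, hB⟩ := exists_weighted_form (F := Plane) (inv_pos.2 hμmin).le hμm.inv hM
  exact ⟨B.bilinearComp (wgradL Ω) (wgradL Ω), fun v w => hB _ _⟩

lemma aForm_comm (v w : H01 Ω) : aForm μ v w = aForm μ w v := by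
  unfold aForm
  refine integral_congr_ae (Filter.Eventually.of_forall fun x => ?_)
  simp only [real_inner_comm]

/-- Coercivity of the stiffness form, from the upper bound for `μ` and Poincaré's inequality. -/
lemma exists_aForm_coercive (hΩ : IsLipschitzPolygon Ω) (hμmin : 0 < μmin)
    (hμm : AEMeasurable μ (volume.restrict Ω))
    (hμ : ∀ᵐ x ∂(volume.restrict Ω), μmin ≤ μ x ∧ μ x ≤ μmax) :
    ∃ α : ℝ, 0 < α ∧ ∀ v : H01 Ω, α * ‖v‖ ^ 2 ≤ aForm μ v v := by
  obtain ⟨CP, hCP, hP⟩ := exists_poincare hΩ.1.measurableSet hΩ.2.1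
  set M := max μmax 1 with hMdef
  have hM0 : 0 < M := zero_lt_one.trans_le (le_max_right _ _)
  have hM : ∀ᵐ x ∂(volume.restrict Ω), |(μ x)⁻¹| ≤ μmin⁻¹ := by
    filter_upwards [hμ] with x hx
    rw [abs_of_pos (inv_pos.2 (hμmin.trans_le hx.1))]
    exact inv_anti₀ hμmin hx.1
  refine ⟨M⁻¹ / CP ^ 2, by positivity, fun v => ?_⟩
  have h1 : M⁻¹ * ‖wgrad v‖ ^ 2 ≤ aForm μ v v := by
    rw [← real_inner_self_eq_norm_sq (wgrad v), L2.inner_def, ← integral_const_mul]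
    refine integral_mono_ae ((L2.integrable_inner (𝕜 := ℝ) (wgrad v) (wgrad v)).const_mul _)
      (integrable_weighted_inner hμm.inv hM _ _) ?_
    filter_upwards [hμ] with x hx
    refine mul_le_mul_of_nonneg_right ?_ real_inner_self_nonneg
    exact inv_anti₀ (hμmin.trans_le hx.1) (hx.2.trans (le_max_left _ _))
  refine le_trans ?_ h1
  have h2 : ‖v‖ ^ 2 ≤ CP ^ 2 * ‖wgrad v‖ ^ 2 := by
    rw [← mul_pow]
    exact pow_le_pow_left₀ (norm_nonneg _) (hP v) 2
  rw [div_mul_eq_mul_div, div_le_iff₀ (by positivity), mul_assoc]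
  exact mul_le_mul_of_nonneg_left (by linarith) (inv_pos.2 hM0).le

lemma load_eq_inner (f : L2 Ω) (v : H01 Ω) : load f v = inner ℝ f (toL2 v) := by
  rw [L2.inner_def]
  refine integral_congr_ae (Filter.Eventually.of_forall fun x => ?_)
  exact mul_comm _ _

end Forms

/-! ### Continuous representatives in time -/

section TimeRegularity

variable {E : Type*} [NormedAddCommGroup E] [NormedSpace ℝ E] {T : ℝ} {u w : ℝ → E}

lemma isTimeTest_primitive {χ : ℝ → ℝ} (hχ : IsTimeTest T χ) (h0 : ∫ t, χ t = 0) :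
    IsTimeTest T (fun t => ∫ s in (0 : ℝ)..t, χ s) ∧
      deriv (fun t => ∫ s in (0 : ℝ)..t, χ s) = χ := by
  obtain ⟨hd, hc, hs⟩ := hχ
  have hderiv : ∀ t, HasDerivAt (fun t => ∫ s in (0 : ℝ)..t, χ s) (χ t) t := fun t =>
    hd.continuous.integral_hasStrictDerivAt 0 t |>.hasDerivAt
  have hdeq : deriv (fun t => ∫ s in (0 : ℝ)..t, χ s) = χ := funext fun t => (hderiv t).deriv
  have hK : IsCompact (tsupport χ) := hc
  have hzero : ∀ t, t ∉ convexHull ℝ (tsupport χ) → ∫ s in (0 : ℝ)..t, χ s = 0 := by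
    intro t ht
    by_cases hlt : ∃ s ∈ tsupport χ, s < t
    · obtain ⟨s₀, hs₀, hst⟩ := hlt
      have hall : ∀ s ∈ tsupport χ, s < t := by
        intro s hs'
        by_contra! hcon
        exact ht ((convex_convexHull ℝ _).ordConnected.out (subset_convexHull ℝ _ hs₀)
          (subset_convexHull ℝ _ hs') ⟨hst.le, hcon⟩)
      rw [intervalIntegral.integral_eq_integral_of_support_subset, h0]
      intro s hs'
      exact ⟨(hs (subset_tsupport _ hs')).1, (hall s (subset_tsupport _ hs')).le⟩
    · push Not at hlt
      refine (intervalIntegral.integral_congr (g := fun _ => (0 : ℝ)) fun s hs' => ?_).trans (by simp)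
      by_contra hne
      have h1 : s ∈ tsupport χ := subset_tsupport _ hne
      have h2 := (hs h1).1
      have h3 : t < s := lt_of_le_of_ne (hlt s h1) (by
        rintro rfl
        exact ht (subset_convexHull ℝ _ h1))
      rcases le_total 0 t with h | h
      · rw [uIcc_of_le h] at hs'
        linarith [hs'.2]
      · rw [uIcc_of_ge h] at hs'
        linarith [hs'.2]
  have hcomp : IsCompact (convexHull ℝ (tsupport χ)) := by
    rcases (tsupport χ).eq_empty_or_nonempty with h | h
    · simp [h]
    · obtain ⟨a, ha⟩ := hK.exists_isLeast h
      obtain ⟨b, hb⟩ := hK.exists_isGreatest h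
      have : convexHull ℝ (tsupport χ) = Icc a b :=
        (convexHull_min (t := Icc a b) (fun t ht => ⟨ha.2 ht, hb.2 ht⟩)
          (convex_Icc a b)).antisymm
          ((convex_convexHull ℝ _).ordConnected.out (subset_convexHull ℝ _ ha.1)
            (subset_convexHull ℝ _ hb.1))
      rw [this]
      exact isCompact_Icc
  refine ⟨⟨?_, ?_, ?_⟩, hdeq⟩
  · rw [contDiff_infty_iff_deriv, hdeq]
    exact ⟨fun t => (hderiv t).differentiableAt, hd⟩
  · exact HasCompactSupport.intro hcomp fun t ht => hzero t ht
  · refine (closure_minimal (fun t ht => ?_) hcomp.isClosed).trans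
      (convexHull_min hs (convex_Ioo 0 T))
    by_contra hcon
    exact ht (hzero t hcon)

lemma intervalIntegrable_of_timeMeasure (hT : 0 < T) (hw : Integrable w (timeMeasure T)) {s t : ℝ}
    (hs : s ∈ Icc 0 T) (ht : t ∈ Icc 0 T) : IntervalIntegrable w volume s t := by
  have h : IntervalIntegrable w volume 0 T :=
    (intervalIntegrable_iff_integrableOn_Ioo_of_le hT.le).2 hw
  exact h.mono_set ((uIcc_of_le hT.le).symm ▸ uIcc_subset_Icc hs ht)

lemma MemLp.integrable_timeMeasure (hw : MemLp w 2 (timeMeasure T)) :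
    Integrable w (timeMeasure T) :=
  hw.integrable (by norm_num)

lemma continuousOn_primitive_Icc (hT : 0 < T) (hw : Integrable w (timeMeasure T)) :
    ContinuousOn (fun t => ∫ s in (0 : ℝ)..t, w s) (Icc 0 T) := by
  have h := intervalIntegral.continuousOn_primitive_interval' (μ := volume) (a := 0)
    (intervalIntegrable_of_timeMeasure hT hw (left_mem_Icc.2 hT.le) (right_mem_Icc.2 hT.le))
    left_mem_uIcc
  rwa [uIcc_of_le hT.le] at h

/-- Integration by parts against a primitive, by Fubini's theorem. -/
lemma isTimeDeriv_primitive [CompleteSpace E] (hw : Integrable w (timeMeasure T)) :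
    IsTimeDeriv T (fun t => ∫ s in (0 : ℝ)..t, w s) w := by
  rintro φ ⟨hd, hc, hs⟩
  have hdc : Continuous (deriv φ) := hd.continuous_deriv (by simp)
  have hdi : Integrable (deriv φ) (timeMeasure T) :=
    (hdc.integrable_of_hasCompactSupport hc.deriv).integrableOn
  have hmeas : MeasurableSet {z : ℝ × ℝ | z.2 ≤ z.1} := measurableSet_le measurable_snd measurable_fst
  have hF : Integrable ({z : ℝ × ℝ | z.2 ≤ z.1}.indicator fun z => deriv φ z.1 • w z.2)
      ((timeMeasure T).prod (timeMeasure T)) := (hdi.smul_prod hw).indicator hmeas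
  have hswap := integral_integral_swap
    (f := fun t s => ({z : ℝ × ℝ | z.2 ≤ z.1}.indicator fun z => deriv φ z.1 • w z.2) (t, s)) hF
  have hl : ∀ t ∈ Ioo 0 T,
      ∫ s, ({z : ℝ × ℝ | z.2 ≤ z.1}.indicator fun z => deriv φ z.1 • w z.2) (t, s) ∂(timeMeasure T)
        = deriv φ t • ∫ s in (0 : ℝ)..t, w s := by
    intro t ht
    have h1 : ∀ s, ({z : ℝ × ℝ | z.2 ≤ z.1}.indicator fun z => deriv φ z.1 • w z.2) (t, s)
        = (Iic t).indicator (fun s => deriv φ t • w s) s := by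
      intro s
      by_cases h : s ≤ t
      · rw [indicator_of_mem (show (t, s) ∈ {z : ℝ × ℝ | z.2 ≤ z.1} from h),
          indicator_of_mem (show s ∈ Iic t from h)]
      · rw [indicator_of_notMem (show (t, s) ∉ {z : ℝ × ℝ | z.2 ≤ z.1} from h),
          indicator_of_notMem (show s ∉ Iic t from h)]
    simp only [h1]
    rw [setIntegral_indicator measurableSet_Iic, integral_smul, intervalIntegral.integral_of_le ht.1.le]
    congr 2
    have : Ioo 0 T ∩ Iic t = Ioc 0 t := by
      ext s
      simp only [mem_inter_iff, mem_Ioo, mem_Iic, mem_Ioc]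
      exact ⟨fun h => ⟨h.1.1, h.2⟩, fun h => ⟨⟨h.1, h.2.trans_lt ht.2⟩, h.2⟩⟩
    rw [this]
  have hr : ∀ s ∈ Ioo 0 T,
      ∫ t, ({z : ℝ × ℝ | z.2 ≤ z.1}.indicator fun z => deriv φ z.1 • w z.2) (t, s) ∂(timeMeasure T)
        = -(φ s • w s) := by
    intro s hsT
    have h1 : ∀ t, ({z : ℝ × ℝ | z.2 ≤ z.1}.indicator fun z => deriv φ z.1 • w z.2) (t, s)
        = (Ici s).indicator (fun t => deriv φ t • w s) t := by
      intro t
      by_cases h : s ≤ t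
      · rw [indicator_of_mem (show (t, s) ∈ {z : ℝ × ℝ | z.2 ≤ z.1} from h),
          indicator_of_mem (show t ∈ Ici s from h)]
      · rw [indicator_of_notMem (show (t, s) ∉ {z : ℝ × ℝ | z.2 ≤ z.1} from h),
          indicator_of_notMem (show t ∉ Ici s from h)]
    simp only [h1]
    have h2 : Ioo 0 T ∩ Ici s = Ico s T := by
      ext t
      simp only [mem_inter_iff, mem_Ioo, mem_Ici, mem_Ico]
      exact ⟨fun h => ⟨h.2, h.1.2⟩, fun h => ⟨⟨hsT.1.trans_le h.1, h.2⟩, h.1⟩⟩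
    rw [setIntegral_indicator measurableSet_Ici, h2, integral_smul_const, integral_Ico_eq_integral_Ioc,
      ← intervalIntegral.integral_of_le hsT.2.le,
      intervalIntegral.integral_deriv_eq_sub (fun t _ => (hd.differentiable (by simp)).differentiableAt)
        (hdc.intervalIntegrable _ _),
      image_eq_zero_of_notMem_tsupport (fun h => lt_irrefl T (hs h).2), zero_sub, neg_smul]
  rw [setIntegral_congr_fun measurableSet_Ioo hl, setIntegral_congr_fun measurableSet_Ioo hr,
    integral_neg] at hswap
  rw [hswap, neg_neg]

/-- A function on `(0,T)` with generalized derivative `w` is the primitive of `w` up to a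
constant (the lemma of du Bois-Reymond). -/
lemma exists_ae_eq_const_add_primitive [CompleteSpace E] (hT : 0 < T)
    (hu : Integrable u (timeMeasure T)) (hw : Integrable w (timeMeasure T))
    (h : IsTimeDeriv T u w) :
    ∃ c : E, u =ᵐ[timeMeasure T] fun t => c + ∫ s in (0 : ℝ)..t, w s := by
  set W : ℝ → E := fun t => ∫ s in (0 : ℝ)..t, w s with hW
  have hWi : Integrable W (timeMeasure T) :=
    ((continuousOn_primitive_Icc hT hw).integrableOn_compact isCompact_Icc).mono_set Ioo_subset_Icc_self
  have hbd : ∀ {φ : ℝ → ℝ} {g : ℝ → E}, Continuous φ → HasCompactSupport φ →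
      Integrable g (timeMeasure T) → Integrable (fun t => φ t • g t) (timeMeasure T) := by
    intro φ g hφ hφc hg
    obtain ⟨M, hM⟩ := hφc.exists_bound_of_continuous hφ
    exact hg.bdd_smul M hφ.aestronglyMeasurable (Filter.Eventually.of_forall hM)
  set D : ℝ → E := fun t => u t - W t with hD
  have hDi : Integrable D (timeMeasure T) := hu.sub hWi
  have hzero : ∀ φ, IsTimeTest T φ → ∫ t, deriv φ t • D t ∂(timeMeasure T) = 0 := by
    intro φ hφ
    have hdc : Continuous (deriv φ) := hφ.1.continuous_deriv (by simp)
    have h1 := h φ hφ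
    have h2 := isTimeDeriv_primitive hw φ hφ
    rw [h1, neg_inj] at h2
    simp only [hD, smul_sub]
    rw [integral_sub (hbd hdc hφ.2.1.deriv hu) (hbd hdc hφ.2.1.deriv hWi), sub_eq_zero]
    exact h2
  -- `r` is a test function of integral one, so `ψ - (∫ ψ) r` is the derivative of a test function
  let ρ : ContDiffBump (T / 2) := ⟨T / 8, T / 4, by linarith, by linarith⟩
  set r : ℝ → ℝ := ρ.normed volume with hr
  have hrT : IsTimeTest T r := by
    refine ⟨ρ.contDiff_normed, ρ.hasCompactSupport_normed, ?_⟩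
    rw [hr, ρ.tsupport_normed_eq, Real.closedBall_eq_Icc]
    intro t ht
    simp only [ρ] at ht
    exact ⟨by linarith [ht.1], by linarith [ht.2]⟩
  have hr1 : ∫ t, r t = 1 := ρ.integral_normed
  set c : E := ∫ t, r t • D t ∂(timeMeasure T) with hc
  refine ⟨c, ?_⟩
  have hfin : ∀ᵐ t, t ∈ Ioo 0 T → D t - c = 0 := by
    refine isOpen_Ioo.ae_eq_zero_of_integral_contDiff_smul_eq_zero ?_ fun ψ hψ hψc hψs => ?_
    · exact IntegrableOn.locallyIntegrableOn (hDi.sub (integrable_const c))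
    · have hψi : Integrable ψ := hψ.continuous.integrable_of_hasCompactSupport hψc
      have hri : Integrable r := hrT.1.continuous.integrable_of_hasCompactSupport hrT.2.1
      set k := ∫ t, ψ t with hk
      have hχ : IsTimeTest T fun t => ψ t - k * r t := by
        refine ⟨hψ.sub (contDiff_const.mul hrT.1), hψc.sub hrT.2.1.mul_left, ?_⟩
        refine (tsupport_sub ψ (fun t => k * r t)).trans (union_subset hψs ?_)
        exact (tsupport_mul_subset_right (f := fun _ => k)).trans hrT.2.2
      obtain ⟨hp, hpd⟩ := isTimeTest_primitive hχ (by
        rw [integral_sub hψi (hri.const_mul k), integral_const_mul, hr1, mul_one, sub_self])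
      have h1 := hzero _ hp
      rw [hpd] at h1
      simp only [sub_smul, mul_smul] at h1
      have hki : Integrable (fun t => k • r t • D t) (timeMeasure T) :=
        (hbd hrT.1.continuous hrT.2.1 hDi).smul k
      rw [integral_sub (hbd hψ.continuous hψc hDi) hki, integral_smul, ← hc] at h1
      rw [← setIntegral_eq_integral_of_forall_compl_eq_zero (s := Ioo 0 T)
        (f := fun t => ψ t • (D t - c)) fun t ht => by
          rw [image_eq_zero_of_notMem_tsupport fun hmem => ht (hψs hmem), zero_smul]]
      simp only [smul_sub]
      rw [integral_sub (hbd hψ.continuous hψc hDi)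
        (hbd hψ.continuous hψc (integrable_const c)), integral_smul_const,
        setIntegral_eq_integral_of_forall_compl_eq_zero (s := Ioo 0 T) (f := ψ) fun t ht =>
          image_eq_zero_of_notMem_tsupport fun hmem => ht (hψs hmem)]
      exact h1
  change ∀ᵐ t ∂(timeMeasure T), u t = c + W t
  rw [ae_restrict_iff' measurableSet_Ioo]
  filter_upwards [hfin] with t ht hmem
  have := ht hmem
  rw [hD] at this
  rw [sub_sub, sub_eq_zero] at this
  rw [this, add_comm]

/-- The continuous representative of a function with square integrable derivative. -/
lemma exists_isContRep [CompleteSpace E] (hT : 0 < T)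
    (hu : Integrable u (timeMeasure T)) (hw : Integrable w (timeMeasure T))
    (h : IsTimeDeriv T u w) :
    ∃ g : ℝ → E, IsContRep T u g ∧
      ∀ s ∈ Icc 0 T, ∀ t ∈ Icc 0 T, g t - g s = ∫ r in s..t, w r := by
  obtain ⟨c, hc⟩ := exists_ae_eq_const_add_primitive hT hu hw h
  refine ⟨_, ⟨continuousOn_const.add (continuousOn_primitive_Icc hT hw), hc⟩, fun s hs t ht => ?_⟩
  have h0 : (0 : ℝ) ∈ Icc 0 T := left_mem_Icc.2 hT.le
  change (c + ∫ r in (0 : ℝ)..t, w r) - (c + ∫ r in (0 : ℝ)..s, w r) = _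
  rw [add_sub_add_left_eq_sub, intervalIntegral.integral_interval_sub_left
    (intervalIntegrable_of_timeMeasure hT hw h0 ht) (intervalIntegrable_of_timeMeasure hT hw h0 hs)]

lemma eqOn_Icc_of_ae_eq {f g : ℝ → E} (hT : 0 < T) (hf : ContinuousOn f (Icc 0 T))
    (hg : ContinuousOn g (Icc 0 T)) (h : f =ᵐ[timeMeasure T] g) : EqOn f g (Icc 0 T) := by
  refine Measure.eqOn_Icc_of_ae_eq volume hT.ne ?_ hf hg
  rwa [timeMeasure, restrict_Ioo_eq_restrict_Icc] at h

end TimeRegularity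

/-! ### Ritz projection and stability of the backward Euler scheme -/

section AbstractEstimates

variable {H L : Type*} [NormedAddCommGroup H] [InnerProductSpace ℝ H] [CompleteSpace H]
  [NormedAddCommGroup L] [InnerProductSpace ℝ L] [CompleteSpace L] {V : Submodule ℝ H}

/-- The squared distance to a finite-dimensional subspace is attained at the orthogonal
projection. -/
lemma iInf_norm_sub_sq_eq [FiniteDimensional ℝ V] (v : H) :
    ⨅ y : V, ‖v - y‖ ^ 2 = ‖v - V.starProjection v‖ ^ 2 := by
  have hbdd : BddBelow (range fun y : V => ‖v - y‖ ^ 2) := ⟨0, by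
    rintro _ ⟨y, rfl⟩
    positivity⟩
  refine le_antisymm (ciInf_le hbdd ⟨V.starProjection v, V.starProjection_apply_mem v⟩)
    (le_ciInf fun y => ?_)
  have h := V.starProjection_minimal v
  rw [h]
  refine pow_le_pow_left₀ (Real.iInf_nonneg fun _ => norm_nonneg _) (ciInf_le ⟨0, ?_⟩ y) 2
  rintro _ ⟨y, rfl⟩
  exact norm_nonneg _

lemma continuous_iInf_norm_sub_sq [FiniteDimensional ℝ V] :
    Continuous fun v : H => ⨅ y : V, ‖v - y‖ ^ 2 := by
  simp only [iInf_norm_sub_sq_eq]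
  fun_prop

lemma iInf_norm_sub_sq_nonneg (v : H) : 0 ≤ ⨅ y : V, ‖v - y‖ ^ 2 :=
  Real.iInf_nonneg fun _ => sq_nonneg _

lemma iInf_norm_sub_sq_le (v : H) : ⨅ y : V, ‖v - y‖ ^ 2 ≤ ‖v‖ ^ 2 := by
  refine (ciInf_le ⟨0, ?_⟩ (0 : V)).trans (le_of_eq (by simp))
  rintro _ ⟨y, rfl⟩
  exact sq_nonneg _

/-- The Ritz projection of a coercive symmetric form onto a finite-dimensional subspace is quasi
optimal (Céa's lemma). -/
lemma exists_ritz_projection (a : H →L[ℝ] H →L[ℝ] ℝ) (ha : ∀ v w, a v w = a w v) {α : ℝ}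
    (hα : 0 < α) (hcoer : ∀ v, α * ‖v‖ ^ 2 ≤ a v v) (V : Submodule ℝ H) [FiniteDimensional ℝ V] :
    ∃ R : H →L[ℝ] H, (∀ v, R v ∈ V) ∧ (∀ v, ∀ y ∈ V, a (R v) y = a v y) ∧
      ∀ v, ‖v - R v‖ ^ 2 ≤ ‖a‖ / α * ⨅ y : V, ‖v - y‖ ^ 2 := by
  set aV : V →L[ℝ] V →L[ℝ] ℝ := a.bilinearComp V.subtypeL V.subtypeL with haV
  have hc : IsCoercive aV := ⟨α, hα, fun v => by
    rw [mul_assoc, ← sq]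
    exact hcoer v⟩
  set S := hc.continuousLinearEquivOfBilin
  set A : H →L[ℝ] H := InnerProductSpace.continuousLinearMapOfBilin (𝕜 := ℝ) a
  set P : H →L[ℝ] V := V.orthogonalProjectionOnto
  set R : H →L[ℝ] H := V.subtypeL.comp ((S.symm : V →L[ℝ] V).comp (P.comp A)) with hR
  have hRV : ∀ v, R v ∈ V := fun v => (S.symm (P (A v))).2
  have hRa : ∀ v, ∀ y ∈ V, a (R v) y = a v y := by
    intro v y hy
    have h1 := hc.continuousLinearEquivOfBilin_apply (S.symm (P (A v))) ⟨y, hy⟩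
    rw [ContinuousLinearEquiv.apply_symm_apply] at h1
    have h2 : inner ℝ (P (A v)) (⟨y, hy⟩ : V) = inner ℝ (A v) y :=
      Submodule.inner_orthogonalProjectionOnto_eq_of_mem_right ⟨y, hy⟩ (A v)
    rw [h2, InnerProductSpace.continuousLinearMapOfBilin_apply] at h1
    exact h1.symm
  refine ⟨R, hRV, hRa, fun v => ?_⟩
  rw [Real.mul_iInf_of_nonneg (by positivity)]
  refine le_ciInf fun y => ?_
  have h0 : ∀ z ∈ V, a (v - R v) z = 0 := fun z hz => by
    rw [map_sub, sub_apply, hRa v z hz, sub_self]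
  have hd : R v - (y : H) ∈ V := V.sub_mem (hRV v) y.2
  have h1 : a (v - y) (v - y) = a (v - R v) (v - R v) + a (R v - y) (R v - y) := by
    have h2 : v - (y : H) = (v - R v) + (R v - y) := by abel
    conv_lhs => rw [h2]
    rw [map_add a, add_apply, map_add, map_add, h0 _ hd, ha (R v - y) (v - R v),
      h0 _ hd]
    ring
  have h2 : 0 ≤ a (R v - y) (R v - y) := le_trans (by positivity) (hcoer _)
  have h3 : a (v - y) (v - y) ≤ ‖a‖ * ‖v - y‖ ^ 2 := by
    rw [sq, ← mul_assoc]
    exact (le_abs_self _).trans (a.le_opNorm₂ _ _)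
  have h4 := hcoer (v - R v)
  rw [div_mul_eq_mul_div, le_div_iff₀ hα]
  linarith

/-- Stability of the backward Euler scheme in the energy norm, by testing with the difference
quotient. -/
lemma backward_euler_energy_le (r : L →L[ℝ] L →L[ℝ] ℝ) (hr : ∀ v w, r v w = r w v)
    (hr0 : ∀ v, 0 ≤ r v v) (a : H →L[ℝ] H →L[ℝ] ℝ) (ha : ∀ v w, a v w = a w v)
    (ha0 : ∀ v, 0 ≤ a v v) (j : H →L[ℝ] L) {k : ℝ} (hk : 0 < k) {N : ℕ} {θ : ℕ → H} {η : ℕ → L}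
    (hθ : ∀ n ≤ N, θ n ∈ V)
    (heq : ∀ n, 1 ≤ n → n ≤ N → ∀ v ∈ V,
      r (j (k⁻¹ • (θ n - θ (n - 1)))) (j v) + a (θ n) v = r (η n) (j v)) :
    ∀ n ≤ N, a (θ n) (θ n)
        + k * ∑ m ∈ Finset.Icc 1 n, r (j (k⁻¹ • (θ m - θ (m - 1)))) (j (k⁻¹ • (θ m - θ (m - 1))))
      ≤ a (θ 0) (θ 0) + k * ∑ m ∈ Finset.Icc 1 n, r (η m) (η m) := by
  intro n
  induction n with
  | zero => intro _; simp
  | succ n ih =>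
    intro hn
    have h1 := ih (by omega)
    rw [Finset.sum_Icc_succ_top (by omega), Finset.sum_Icc_succ_top (by omega)]
    simp only [Nat.add_sub_cancel]
    set δ := k⁻¹ • (θ (n + 1) - θ n) with hδ
    have hδV : δ ∈ V := V.smul_mem _ (V.sub_mem (hθ _ hn) (hθ _ (by omega)))
    have h2 := heq (n + 1) (by omega) hn δ hδV
    rw [Nat.add_sub_cancel, ← hδ] at h2
    have h3 : 2 * r (η (n + 1)) (j δ) ≤ r (η (n + 1)) (η (n + 1)) + r (j δ) (j δ) := by
      have h := hr0 (η (n + 1) - j δ)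
      simp only [map_sub, sub_apply] at h
      rw [hr (j δ) (η (n + 1))] at h
      linarith
    have h4 : a (θ (n + 1)) (θ (n + 1)) - a (θ n) (θ n) ≤ 2 * (k * a (θ (n + 1)) δ) := by
      have h := ha0 (θ (n + 1) - θ n)
      have h5 : k * a (θ (n + 1)) δ = a (θ (n + 1)) (θ (n + 1)) - a (θ (n + 1)) (θ n) := by
        rw [hδ, map_smul, smul_eq_mul, ← mul_assoc, mul_inv_cancel₀ hk.ne', one_mul, map_sub]
      simp only [map_sub, sub_apply] at h
      rw [ha (θ n) (θ (n + 1))] at h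
      linarith
    nlinarith [mul_le_mul_of_nonneg_left h3 hk.le, mul_le_mul_of_nonneg_left h2.le hk.le]

lemma sq_norm_intervalIntegral_le {E : Type*} [NormedAddCommGroup E] [NormedSpace ℝ E] {f : ℝ → E}
    {s t : ℝ} (hst : s ≤ t) (hf : IntervalIntegrable f volume s t)
    (hf2 : IntervalIntegrable (fun x => ‖f x‖ ^ 2) volume s t) :
    ‖∫ x in s..t, f x‖ ^ 2 ≤ (t - s) * ∫ x in s..t, ‖f x‖ ^ 2 := by
  rcases hst.eq_or_lt with rfl | hlt
  · simp
  set I := ∫ x in s..t, ‖f x‖ with hI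
  have hI0 : ‖∫ x in s..t, f x‖ ≤ I := intervalIntegral.norm_integral_le_integral_norm hst
  refine (pow_le_pow_left₀ (norm_nonneg _) hI0 2).trans ?_
  set m := I / (t - s) with hm
  have hts : 0 < t - s := sub_pos.2 hlt
  have h1 : 0 ≤ ∫ x in s..t, (‖f x‖ ^ 2 - 2 * m * ‖f x‖ + m ^ 2) :=
    intervalIntegral.integral_nonneg hst fun x _ => by nlinarith [sq_nonneg (‖f x‖ - m)]
  rw [intervalIntegral.integral_add (hf2.sub (hf.norm.const_mul _)) intervalIntegrable_const,
    intervalIntegral.integral_sub hf2 (hf.norm.const_mul _), intervalIntegral.integral_const_mul,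
    intervalIntegral.integral_const, ← hI, smul_eq_mul] at h1
  have h2 : m * (t - s) = I := div_mul_cancel₀ _ hts.ne'
  have h3 : 0 ≤ (t - s) * ((∫ x in s..t, ‖f x‖ ^ 2) - 2 * m * I + (t - s) * m ^ 2) :=
    mul_nonneg hts.le h1
  have h4 : (t - s) * (2 * m * I) = 2 * I ^ 2 := by rw [← h2]; ring
  have h5 : (t - s) * ((t - s) * m ^ 2) = I ^ 2 := by rw [← h2]; ring
  nlinarith

end AbstractEstimates

/-! ### Consistency of the backward Euler scheme -/

section AbstractEstimates

variable {H L : Type*} [NormedAddCommGroup H] [InnerProductSpace ℝ H] [CompleteSpace H]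
  [NormedAddCommGroup L] [InnerProductSpace ℝ L] [CompleteSpace L] {V : Submodule ℝ H} {T : ℝ}

lemma integrable_norm_sq_timeMeasure {E : Type*} [NormedAddCommGroup E] {f : ℝ → E}
    (hf : MemLp f 2 (timeMeasure T)) : Integrable (fun t => ‖f t‖ ^ 2) (timeMeasure T) :=
  hf.integrable_norm_pow (p := 2) (by norm_num)

lemma integrable_iInf_norm_sub_sq [FiniteDimensional ℝ V] {f : ℝ → H}
    (hf : MemLp f 2 (timeMeasure T)) :
    Integrable (fun t => ⨅ y : V, ‖f t - y‖ ^ 2) (timeMeasure T) := by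
  refine (integrable_norm_sq_timeMeasure hf).mono'
    (continuous_iInf_norm_sub_sq.comp_aestronglyMeasurable hf.1)
    (Filter.Eventually.of_forall fun t => ?_)
  rw [Real.norm_of_nonneg (iInf_norm_sub_sq_nonneg _)]
  exact iInf_norm_sub_sq_le _

lemma sq_norm_add_le {E : Type*} [SeminormedAddCommGroup E] (x y : E) :
    ‖x + y‖ ^ 2 ≤ 2 * ‖x‖ ^ 2 + 2 * ‖y‖ ^ 2 := by
  have h := pow_le_pow_left₀ (norm_nonneg _) (norm_add_le x y) 2
  nlinarith [sq_nonneg (‖x‖ - ‖y‖)]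

/-- The consistency error of one step: the projection error of `∂ₜu`, and a Taylor remainder. -/
lemma consistency_error_le [FiniteDimensional ℝ V] (hT : 0 < T) {uc du : ℝ → H} {duc ddu : ℝ → L}
    {j : H →L[ℝ] L} (hdu : MemLp du 2 (timeMeasure T)) (hddu : MemLp ddu 2 (timeMeasure T))
    (huc : ∀ s ∈ Icc 0 T, ∀ t ∈ Icc 0 T, uc t - uc s = ∫ r in s..t, du r)
    (hduc : ∀ s ∈ Icc 0 T, ∀ t ∈ Icc 0 T, duc t - duc s = ∫ r in s..t, ddu r)
    (hducc : ContinuousOn duc (Icc 0 T)) (hj : (fun t => j (du t)) =ᵐ[timeMeasure T] duc)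
    {R : H →L[ℝ] H} {K : ℝ} (hR : ∀ v, ‖v - R v‖ ^ 2 ≤ K * ⨅ y : V, ‖v - y‖ ^ 2)
    {s t : ℝ} (hs : s ∈ Icc 0 T) (ht : t ∈ Icc 0 T) (hst : s < t) :
    (t - s) * ‖j ((t - s)⁻¹ • (R (uc t) - R (uc s))) - duc t‖ ^ 2
      ≤ 2 * ‖j‖ ^ 2 * K * (∫ r in s..t, ⨅ y : V, ‖du r - y‖ ^ 2)
        + 2 * (t - s) ^ 2 * ∫ r in s..t, ‖ddu r‖ ^ 2 := by
  set k := t - s with hk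
  have hk0 : 0 < k := sub_pos.2 hst
  have hii : ∀ {f : ℝ → ℝ},
      Integrable f (timeMeasure T) → ∀ {p q : ℝ}, p ∈ Icc 0 T → q ∈ Icc 0 T →
      IntervalIntegrable f volume p q := fun hf _ _ hp hq =>
    intervalIntegrable_of_timeMeasure hT hf hp hq
  have hIcc : Icc s t ⊆ Icc 0 T := Icc_subset_Icc hs.1 ht.2
  have hdui : IntervalIntegrable du volume s t :=
    intervalIntegrable_of_timeMeasure hT (MemLp.integrable_timeMeasure hdu) hs ht
  -- the projection error of the difference quotient
  set A : H := ∫ r in s..t, (R (du r) - du r) with hA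
  have hRdu : MemLp (fun r => R (du r) - du r) 2 (timeMeasure T) :=
    (R.comp_memLp' hdu).sub hdu
  have hA1 : R (uc t) - R (uc s) - (uc t - uc s) = A := by
    have hRi : IntervalIntegrable (fun r => R (du r)) volume s t :=
      intervalIntegrable_of_timeMeasure hT (MemLp.integrable_timeMeasure (R.comp_memLp' hdu)) hs ht
    rw [← map_sub, huc s hs t ht, hA, intervalIntegral.integral_sub hRi hdui,
      R.intervalIntegral_comp_comm hdui]
  have hA2 : ‖A‖ ^ 2 ≤ k * (K * ∫ r in s..t, ⨅ y : V, ‖du r - y‖ ^ 2) := by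
    refine (sq_norm_intervalIntegral_le hst.le
      (intervalIntegrable_of_timeMeasure hT (MemLp.integrable_timeMeasure hRdu) hs ht)
      (hii (integrable_norm_sq_timeMeasure hRdu) hs ht)).trans ?_
    refine mul_le_mul_of_nonneg_left ?_ hk0.le
    rw [← intervalIntegral.integral_const_mul]
    refine intervalIntegral.integral_mono_on hst.le (hii (integrable_norm_sq_timeMeasure hRdu) hs ht)
      ((hii (integrable_iInf_norm_sub_sq hdu) hs ht).const_mul K) fun r _ => ?_
    rw [norm_sub_rev]
    exact hR _
  -- the Taylor remainder
  set B : L := ∫ r in s..t, (duc r - duc t) with hB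
  set M := ∫ r in s..t, ‖ddu r‖ ^ 2 with hM
  have hM0 : 0 ≤ M := intervalIntegral.integral_nonneg hst.le fun _ _ => sq_nonneg _
  have hducI : ContinuousOn duc (uIcc s t) := by
    rw [uIcc_of_le hst.le]
    exact hducc.mono hIcc
  have hB1 : j (uc t - uc s) - k • duc t = B := by
    rw [huc s hs t ht, ← j.intervalIntegral_comp_comm hdui, hB,
      intervalIntegral.integral_sub hducI.intervalIntegrable intervalIntegrable_const,
      intervalIntegral.integral_const]
    congr 1
    refine intervalIntegral.integral_congr_ae ?_
    have h1 : ∀ᵐ r ∂(volume.restrict (Icc 0 T)), j (du r) = duc r := by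
      rw [← restrict_Ioo_eq_restrict_Icc]
      exact hj
    rw [ae_restrict_iff' measurableSet_Icc] at h1
    filter_upwards [h1] with r hr hrm
    rw [uIoc_of_le hst.le] at hrm
    exact hr (hIcc ⟨hrm.1.le, hrm.2⟩)
  have hB3 : ∀ r ∈ Icc s t, ‖duc r - duc t‖ ^ 2 ≤ k * M := by
    intro r hr
    have hrT := hIcc hr
    rw [norm_sub_rev, hduc r hrT t ht]
    refine (sq_norm_intervalIntegral_le hr.2
      (intervalIntegrable_of_timeMeasure hT (MemLp.integrable_timeMeasure hddu) hrT ht)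
      (hii (integrable_norm_sq_timeMeasure hddu) hrT ht)).trans ?_
    refine mul_le_mul (by linarith [hr.1]) ?_
      (intervalIntegral.integral_nonneg hr.2 fun _ _ => sq_nonneg _) hk0.le
    refine intervalIntegral.integral_mono_interval hr.1 hr.2 le_rfl
      (Filter.Eventually.of_forall fun _ => sq_nonneg _)
      (hii (integrable_norm_sq_timeMeasure hddu) hs ht)
  have hBc : ContinuousOn (fun r => duc r - duc t) (uIcc s t) := hducI.sub continuousOn_const
  have hB2 : ‖B‖ ^ 2 ≤ k * (k * (k * M)) := by
    refine (sq_norm_intervalIntegral_le hst.le hBc.intervalIntegrable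
      (hBc.norm.pow 2).intervalIntegrable).trans (mul_le_mul_of_nonneg_left ?_ hk0.le)
    refine (intervalIntegral.integral_mono_on hst.le (hBc.norm.pow 2).intervalIntegrable
      intervalIntegrable_const hB3).trans (le_of_eq ?_)
    rw [intervalIntegral.integral_const, smul_eq_mul]
  have hsplit : j (k⁻¹ • (R (uc t) - R (uc s))) - duc t = k⁻¹ • (j A + B) := by
    rw [← hA1, ← hB1, map_sub j (R (uc t) - R (uc s)), map_smul, sub_add_sub_cancel, smul_sub,
      inv_smul_smul₀ hk0.ne']
  have hjA : ‖j A‖ ^ 2 ≤ ‖j‖ ^ 2 * ‖A‖ ^ 2 := by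
    rw [← mul_pow]
    exact pow_le_pow_left₀ (norm_nonneg _) (j.le_opNorm A) 2
  rw [hsplit, norm_smul, mul_pow, norm_inv, Real.norm_of_nonneg hk0.le, ← mul_assoc,
    show k * k⁻¹ ^ 2 = k⁻¹ by field_simp]
  calc k⁻¹ * ‖j A + B‖ ^ 2 ≤ k⁻¹ * (2 * (‖j‖ ^ 2 * (k * (K * ∫ r in s..t, ⨅ y : V, ‖du r - y‖ ^ 2)))
        + 2 * (k * (k * (k * M)))) := by
        refine mul_le_mul_of_nonneg_left ((sq_norm_add_le _ _).trans ?_) (inv_pos.2 hk0).le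
        have := hjA.trans (mul_le_mul_of_nonneg_left hA2 (sq_nonneg ‖j‖))
        linarith
    _ = _ := by field_simp

lemma sum_Icc_one_eq_sum_range {M : Type*} [AddCommMonoid M] (f : ℕ → M) (N : ℕ) :
    ∑ n ∈ Finset.Icc 1 N, f n = ∑ n ∈ Finset.range N, f (n + 1) := by
  induction N with
  | zero => simp
  | succ N ih => rw [Finset.sum_Icc_succ_top (by omega), Finset.sum_range_succ, ih]

lemma sum_step_integrals (hT : 0 < T) {N : ℕ} (hN : 1 ≤ N) {f : ℝ → ℝ}
    (hf : Integrable f (timeMeasure T)) :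
    ∑ n ∈ Finset.Icc 1 N, ∫ r in (((n - 1 : ℕ) : ℝ) * (T / N))..(n * (T / N)), f r
      = ∫ r, f r ∂(timeMeasure T) := by
  have hN0 : (0 : ℝ) < N := by exact_mod_cast hN
  have hmem : ∀ n ≤ N, (n : ℝ) * (T / N) ∈ Icc 0 T := by
    intro n hn
    refine ⟨by positivity, ?_⟩
    rw [mul_div_assoc', div_le_iff₀ hN0, mul_comm]
    exact mul_le_mul_of_nonneg_left (by exact_mod_cast hn) hT.le
  rw [sum_Icc_one_eq_sum_range]
  have h := intervalIntegral.sum_integral_adjacent_intervals (μ := volume) (f := f)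
    (a := fun n : ℕ => (n : ℝ) * (T / N)) (n := N) fun n hn =>
      intervalIntegrable_of_timeMeasure hT hf (hmem n hn.le) (hmem (n + 1) hn)
  simp only [Nat.add_sub_cancel]
  rw [h, Nat.cast_zero, zero_mul, mul_div_cancel₀ _ hN0.ne', intervalIntegral.integral_of_le hT.le,
    integral_Ioc_eq_integral_Ioo]

end AbstractEstimates

/-! ### The error bound for an abstract degenerate parabolic problem -/

section AbstractEstimates

variable {H L : Type*} [NormedAddCommGroup H] [InnerProductSpace ℝ H] [CompleteSpace H]
  [NormedAddCommGroup L] [InnerProductSpace ℝ L] [CompleteSpace L] {V : Submodule ℝ H} {T : ℝ}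

lemma eq_zero_of_self_eq_zero {r : L →L[ℝ] L →L[ℝ] ℝ} (hr : ∀ v w, r v w = r w v)
    (hr0 : ∀ v, 0 ≤ r v v) {x : L} (hx : r x x = 0) (z : L) : r x z = 0 := by
  by_contra hne
  have h := hr0 (z - ((r z z + 1) / (2 * r x z)) • x)
  simp only [map_sub, map_smul, sub_apply, smul_apply, smul_eq_mul, hx, hr z x] at h
  have h1 : (r z z + 1) / (2 * r x z) * r x z = (r z z + 1) / 2 := by field_simp
  nlinarith

lemma form_add_self_le {r : L →L[ℝ] L →L[ℝ] ℝ} (hr : ∀ v w, r v w = r w v)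
    (hr0 : ∀ v, 0 ≤ r v v) (x y : L) : r (x + y) (x + y) ≤ 2 * r x x + 2 * r y y := by
  have h := hr0 (x - y)
  simp only [map_sub, map_add, sub_apply, add_apply, hr y x] at h ⊢
  linarith

lemma form_self_le (r : L →L[ℝ] L →L[ℝ] ℝ) (x : L) : r x x ≤ ‖r‖ * ‖x‖ ^ 2 := by
  rw [sq, ← mul_assoc]
  exact (le_abs_self _).trans (r.le_opNorm₂ _ _)

set_option maxHeartbeats 1000000 in
/-- The error of the backward Euler scheme for the degenerate parabolic problem
`d/dt r(u, v) + a(u, v) = ⟨f, v⟩`. The form `r` only sees part of `u`, so the discrete initial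
error is bounded in the energy norm after it has been replaced by a discrete extension of the part
that `r` sees; this is the hypothesis `hext`. -/
theorem exists_backward_euler_error_bound (r : L →L[ℝ] L →L[ℝ] ℝ) (hr : ∀ v w, r v w = r w v)
    (hr0 : ∀ v, 0 ≤ r v v) (a : H →L[ℝ] H →L[ℝ] ℝ) (ha : ∀ v w, a v w = a w v) {α : ℝ}
    (hα : 0 < α) (hcoer : ∀ v, α * ‖v‖ ^ 2 ≤ a v v) (j : H →L[ℝ] L) (hT : 0 < T) (Ce : ℝ) :
    ∃ C : ℝ, 0 < C ∧ ∀ (V : Submodule ℝ H), FiniteDimensional ℝ V →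
      (∀ d ∈ V, ∀ w : H, r (j (w - d)) (j (w - d)) = 0 →
        ∃ y ∈ V, r (j (y - d)) (j (y - d)) = 0 ∧ ‖y‖ ≤ Ce * ‖w‖) →
      ∀ (u₀ : H) (uc du : ℝ → H) (duc ddu : ℝ → L),
        MemLp du 2 (timeMeasure T) → MemLp ddu 2 (timeMeasure T) →
        (∀ s ∈ Icc 0 T, ∀ t ∈ Icc 0 T, uc t - uc s = ∫ r in s..t, du r) →
        (∀ s ∈ Icc 0 T, ∀ t ∈ Icc 0 T, duc t - duc s = ∫ r in s..t, ddu r) →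
        ContinuousOn duc (Icc 0 T) → (fun t => j (du t)) =ᵐ[timeMeasure T] duc →
        r (j (uc 0 - u₀)) (j (uc 0 - u₀)) = 0 →
        ∀ (N : ℕ) (U : ℕ → H), 1 ≤ N → (∀ n ≤ N, U n ∈ V) →
          (∀ n, 1 ≤ n → n ≤ N → ∀ v ∈ V,
            r (j ((T / N)⁻¹ • (U n - U (n - 1)))) (j v) + a (U n) v
              = r (duc (n * (T / N))) (j v) + a (uc (n * (T / N))) v) →
          (⨆ n : Finset.Icc 1 N, r (j (uc ((n : ℕ) * (T / N)) - U n))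
              (j (uc ((n : ℕ) * (T / N)) - U n)))
            + (T / N) * ∑ n ∈ Finset.Icc 1 N, ‖uc (n * (T / N)) - U n‖ ^ 2
            + (T / N) * ∑ n ∈ Finset.Icc 1 N,
                r (duc (n * (T / N)) - j ((T / N)⁻¹ • (U n - U (n - 1))))
                  (duc (n * (T / N)) - j ((T / N)⁻¹ • (U n - U (n - 1))))
          ≤ C * (‖u₀ - U 0‖ ^ 2
            + (⨆ n : Finset.Icc 0 N, ⨅ v : V, ‖uc ((n : ℕ) * (T / N)) - (v : H)‖ ^ 2)
            + (∫ t, (⨅ v : V, ‖du t - (v : H)‖ ^ 2) ∂(timeMeasure T))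
            + (T / N) ^ 2 * ∫ t, ‖ddu t‖ ^ 2 ∂(timeMeasure T)) := by
  set K := ‖a‖ / α with hK
  have hK0 : 0 ≤ K := by positivity
  set S₀ := ‖a‖ * Ce ^ 2 * (2 * K + 2) + ‖r‖ * (2 * ‖j‖ ^ 2 * K + 2) with hS₀
  have hS₀0 : 0 ≤ S₀ := by positivity
  set Q := 2 * K + 2 * (S₀ / α) with hQ
  have hQ0 : 0 ≤ Q := by positivity
  refine ⟨‖r‖ * ‖j‖ ^ 2 * Q + T * Q + 4 * S₀ + 1, by positivity, ?_⟩
  intro V hV hext u₀ uc du duc ddu hdu hddu huc hduc hducc hj hinit N U hN hU heq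
  obtain ⟨R, hRV, hRa, hR⟩ := exists_ritz_projection a ha hα hcoer V
  have hnull := fun {x : L} (hx : r x x = 0) (z : L) => eq_zero_of_self_eq_zero hr hr0 hx z
  have ha0 : ∀ v, 0 ≤ a v v := fun v => le_trans (by positivity) (hcoer v)
  have hN0 : (0 : ℝ) < N := by exact_mod_cast hN
  set k := T / N with hk
  have hk0 : 0 < k := div_pos hT hN0
  have hNk : N * k = T := mul_div_cancel₀ _ hN0.ne'
  have hmem : ∀ n ≤ N, (n : ℝ) * k ∈ Icc 0 T := fun n hn =>
    ⟨by positivity, hNk ▸ mul_le_mul_of_nonneg_right (by exact_mod_cast hn) hk0.le⟩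
  set X₀ := ‖u₀ - U 0‖ ^ 2 with hX₀
  set m := ⨆ n : Finset.Icc 0 N, ⨅ v : V, ‖uc ((n : ℕ) * k) - (v : H)‖ ^ 2 with hm
  set I₁ := ∫ t, (⨅ v : V, ‖du t - (v : H)‖ ^ 2) ∂(timeMeasure T) with hI₁
  set I₂ := ∫ t, ‖ddu t‖ ^ 2 ∂(timeMeasure T) with hI₂
  have hX₀0 : 0 ≤ X₀ := sq_nonneg _
  have hm0 : 0 ≤ m := Real.iSup_nonneg fun _ => iInf_norm_sub_sq_nonneg _
  have hI₁0 : 0 ≤ I₁ := integral_nonneg fun _ => iInf_norm_sub_sq_nonneg _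
  have hI₂0 : 0 ≤ k ^ 2 * I₂ := mul_nonneg (sq_nonneg _) (integral_nonneg fun _ => sq_nonneg _)
  set D := X₀ + m + I₁ + k ^ 2 * I₂ with hD
  have hD0 : 0 ≤ D := by positivity
  have hm_le : ∀ n ≤ N, ‖uc (n * k) - R (uc (n * k))‖ ^ 2 ≤ K * m := by
    intro n hn
    refine (hR _).trans (mul_le_mul_of_nonneg_left ?_ hK0)
    exact le_ciSup (f := fun n : Finset.Icc 0 N => ⨅ v : V, ‖uc ((n : ℕ) * k) - (v : H)‖ ^ 2)
      (Set.finite_range _).bddAbove ⟨n, Finset.mem_Icc.2 ⟨Nat.zero_le _, hn⟩⟩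
  -- the discrete part of the error, with a modified initial value
  set θ : ℕ → H := fun n => R (uc (n * k)) - U n with hθ
  set w : H := (R (uc 0) - uc 0) + (u₀ - U 0) with hw
  obtain ⟨y, hyV, hy0, hyw⟩ := hext (θ 0) (V.sub_mem (hRV _) (hU 0 (Nat.zero_le _))) w (by
    have h1 : w - θ 0 = -(uc 0 - u₀) := by
      simp only [hw, hθ, Nat.cast_zero, zero_mul]
      abel
    rw [h1]
    simp only [map_neg, neg_apply, neg_neg]
    exact hinit)
  set θ' : ℕ → H := Function.update θ 0 y with hθ'
  have hθ'0 : θ' 0 = y := Function.update_self _ _ _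
  have hθ'n : ∀ n, 1 ≤ n → θ' n = θ n := fun n hn =>
    Function.update_of_ne (by omega) _ _
  -- the form `r` does not see the change of the initial value
  have hθr : ∀ n z, r (j (θ' n)) z = r (j (θ n)) z := by
    intro n z
    rcases Nat.eq_zero_or_pos n with rfl | hn
    · have := hnull hy0 z
      rwa [map_sub, map_sub, sub_apply, sub_eq_zero, ← hθ'0] at this
    · rw [hθ'n n hn]
  set η : ℕ → L := fun n =>
    j (k⁻¹ • (R (uc (n * k)) - R (uc ((n - 1 : ℕ) * k)))) - duc (n * k) with hη
  have hquot : ∀ n z, r (j (k⁻¹ • (θ' n - θ' (n - 1)))) z = r (j (k⁻¹ • (θ n - θ (n - 1)))) z := by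
    intro n z
    simp only [map_smul, map_sub, smul_apply, sub_apply, hθr]
  have hquot' : ∀ n, r (j (k⁻¹ • (θ' n - θ' (n - 1)))) (j (k⁻¹ • (θ' n - θ' (n - 1))))
      = r (j (k⁻¹ • (θ n - θ (n - 1)))) (j (k⁻¹ • (θ n - θ (n - 1)))) := fun n => by
    rw [hquot, hr, hquot]
  have hsplit : ∀ n, k⁻¹ • (θ n - θ (n - 1)) = k⁻¹ • (R (uc (n * k)) - R (uc ((n - 1 : ℕ) * k)))
      - k⁻¹ • (U n - U (n - 1)) := fun n => by
    rw [← smul_sub]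
    congr 1
    simp only [hθ]
    abel
  have henergy := backward_euler_energy_le (V := V) r hr hr0 a ha ha0 j hk0 (N := N) (θ := θ')
    (η := η) (fun n hn => by
      rcases Nat.eq_zero_or_pos n with rfl | hn0
      · rw [hθ'0]
        exact hyV
      · rw [hθ'n n hn0]
        exact V.sub_mem (hRV _) (hU n hn)) fun n hn1 hnN v hv => by
    rw [hquot, hθ'n n hn1, hsplit]
    have h1 := heq n hn1 hnN v hv
    simp only [hθ, hη, map_sub, sub_apply, hRa _ v hv] at h1 ⊢
    linarith
  set S := a y y + k * ∑ n ∈ Finset.Icc 1 N, r (η n) (η n) with hS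
  have hS_le : S ≤ S₀ * D := by
    have h1 : a y y ≤ ‖a‖ * Ce ^ 2 * (2 * (K * m) + 2 * X₀) := by
      have h2 : ‖y‖ ^ 2 ≤ Ce ^ 2 * ‖w‖ ^ 2 := by
        rw [← mul_pow]
        exact pow_le_pow_left₀ (norm_nonneg _) hyw 2
      have h3 : ‖w‖ ^ 2 ≤ 2 * (K * m) + 2 * X₀ := by
        have h4 := hm_le 0 (Nat.zero_le _)
        rw [Nat.cast_zero, zero_mul, norm_sub_rev] at h4
        have h5 := sq_norm_add_le (R (uc 0) - uc 0) (u₀ - U 0)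
        linarith
      calc a y y ≤ ‖a‖ * ‖y‖ ^ 2 := by
            rw [sq, ← mul_assoc]
            exact (le_abs_self _).trans (a.le_opNorm₂ _ _)
        _ ≤ ‖a‖ * (Ce ^ 2 * ‖w‖ ^ 2) := by gcongr
        _ ≤ ‖a‖ * (Ce ^ 2 * (2 * (K * m) + 2 * X₀)) := by gcongr
        _ = _ := by ring
    have h2 : k * ∑ n ∈ Finset.Icc 1 N, r (η n) (η n)
        ≤ ‖r‖ * (2 * ‖j‖ ^ 2 * K * I₁ + 2 * k ^ 2 * I₂) := by
      rw [hI₁, hI₂, ← sum_step_integrals hT hN (integrable_iInf_norm_sub_sq hdu),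
        ← sum_step_integrals hT hN (integrable_norm_sq_timeMeasure hddu), Finset.mul_sum,
        Finset.mul_sum, Finset.mul_sum, ← Finset.sum_add_distrib, Finset.mul_sum]
      refine Finset.sum_le_sum fun n hn => ?_
      obtain ⟨hn1, hnN⟩ := Finset.mem_Icc.1 hn
      have hstep : (n : ℝ) * k - (n - 1 : ℕ) * k = k := by
        rw [Nat.cast_sub hn1]
        push_cast
        ring
      have h3 := consistency_error_le (V := V) hT hdu hddu huc hduc hducc hj hR
        (hmem (n - 1) (by omega)) (hmem n hnN) (by linarith)
      rw [hstep] at h3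
      calc k * r (η n) (η n) ≤ k * (‖r‖ * ‖η n‖ ^ 2) :=
            mul_le_mul_of_nonneg_left (form_self_le r _) hk0.le
        _ = ‖r‖ * (k * ‖η n‖ ^ 2) := by ring
        _ ≤ _ := mul_le_mul_of_nonneg_left h3 (norm_nonneg r)
    have e1 : 2 * (K * m) + 2 * X₀ ≤ (2 * K + 2) * D := by
      have h3 : K * m ≤ K * D := mul_le_mul_of_nonneg_left (by linarith) hK0
      linarith
    have e2 : 2 * ‖j‖ ^ 2 * K * I₁ + 2 * k ^ 2 * I₂ ≤ (2 * ‖j‖ ^ 2 * K + 2) * D := by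
      have h3 : 2 * ‖j‖ ^ 2 * K * I₁ ≤ 2 * ‖j‖ ^ 2 * K * D :=
        mul_le_mul_of_nonneg_left (by linarith) (by positivity)
      linarith
    calc S ≤ ‖a‖ * Ce ^ 2 * (2 * (K * m) + 2 * X₀)
          + ‖r‖ * (2 * ‖j‖ ^ 2 * K * I₁ + 2 * k ^ 2 * I₂) := add_le_add h1 h2
      _ ≤ ‖a‖ * Ce ^ 2 * ((2 * K + 2) * D) + ‖r‖ * ((2 * ‖j‖ ^ 2 * K + 2) * D) := by gcongr
      _ = S₀ * D := by rw [hS₀]; ring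
  have hen : ∀ n ≤ N, a (θ' n) (θ' n)
      + k * ∑ i ∈ Finset.Icc 1 n, r (j (k⁻¹ • (θ i - θ (i - 1)))) (j (k⁻¹ • (θ i - θ (i - 1))))
      ≤ S := by
    intro n hn
    have h1 := henergy n hn
    simp only [hquot', hθ'0] at h1
    refine h1.trans (add_le_add le_rfl (mul_le_mul_of_nonneg_left ?_ hk0.le))
    exact Finset.sum_le_sum_of_subset_of_nonneg (Finset.Icc_subset_Icc le_rfl hn)
      fun i _ _ => hr0 _
  have hsumnn : ∀ n, 0 ≤ k * ∑ i ∈ Finset.Icc 1 n,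
      r (j (k⁻¹ • (θ i - θ (i - 1)))) (j (k⁻¹ • (θ i - θ (i - 1)))) := fun n =>
    mul_nonneg hk0.le (Finset.sum_nonneg fun i _ => hr0 _)
  have herr : ∀ n, 1 ≤ n → n ≤ N → ‖uc (n * k) - U n‖ ^ 2 ≤ Q * D := by
    intro n hn1 hnN
    have h1 := hen n hnN
    rw [hθ'n n hn1] at h1
    have h2 : ‖θ n‖ ^ 2 ≤ S₀ / α * D := by
      rw [div_mul_eq_mul_div, le_div_iff₀ hα]
      linarith [hcoer (θ n), hsumnn n]
    have h3 := sq_norm_add_le (uc (n * k) - R (uc (n * k))) (θ n)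
    rw [hθ] at h3
    rw [show uc (n * k) - R (uc (n * k)) + (R (uc (n * k)) - U n) = uc (n * k) - U n by abel] at h3
    have h4 : K * m ≤ K * D := mul_le_mul_of_nonneg_left (by rw [hD]; linarith) hK0
    have h5 := hm_le n hnN
    calc ‖uc (n * k) - U n‖ ^ 2 ≤ 2 * (K * D) + 2 * (S₀ / α * D) := by linarith
      _ = Q * D := by rw [hQ]; ring
  have : Nonempty (Finset.Icc 1 N) := ⟨⟨1, Finset.mem_Icc.2 ⟨le_rfl, hN⟩⟩⟩
  have hmax : (⨆ n : Finset.Icc 1 N, r (j (uc ((n : ℕ) * k) - U n)) (j (uc ((n : ℕ) * k) - U n)))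
      ≤ ‖r‖ * ‖j‖ ^ 2 * Q * D := by
    refine ciSup_le fun n => ?_
    obtain ⟨hn1, hnN⟩ := Finset.mem_Icc.1 n.2
    refine (form_self_le r _).trans ?_
    have h1 : ‖j (uc ((n : ℕ) * k) - U n)‖ ^ 2 ≤ ‖j‖ ^ 2 * (Q * D) := by
      refine (pow_le_pow_left₀ (norm_nonneg _) (j.le_opNorm _) 2).trans ?_
      rw [mul_pow]
      exact mul_le_mul_of_nonneg_left (herr n hn1 hnN) (sq_nonneg _)
    calc _ ≤ ‖r‖ * (‖j‖ ^ 2 * (Q * D)) := mul_le_mul_of_nonneg_left h1 (norm_nonneg r)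
      _ = _ := by ring
  have hsum : k * ∑ n ∈ Finset.Icc 1 N, ‖uc (n * k) - U n‖ ^ 2 ≤ T * Q * D := by
    have h1 : ∑ n ∈ Finset.Icc 1 N, ‖uc (n * k) - U n‖ ^ 2 ≤ N * (Q * D) := by
      refine (Finset.sum_le_card_nsmul _ _ (Q * D) fun n hn => ?_).trans (le_of_eq ?_)
      · obtain ⟨hn1, hnN⟩ := Finset.mem_Icc.1 hn
        exact herr n hn1 hnN
      · rw [Nat.card_Icc, nsmul_eq_mul, Nat.add_sub_cancel]
    calc _ ≤ k * (N * (Q * D)) := mul_le_mul_of_nonneg_left h1 hk0.le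
      _ = _ := by rw [← hNk]; ring
  have hder : k * ∑ n ∈ Finset.Icc 1 N, r (duc (n * k) - j (k⁻¹ • (U n - U (n - 1))))
      (duc (n * k) - j (k⁻¹ • (U n - U (n - 1)))) ≤ 4 * S₀ * D := by
    have h1 : ∀ n : ℕ, r (duc (n * k) - j (k⁻¹ • (U n - U (n - 1))))
        (duc (n * k) - j (k⁻¹ • (U n - U (n - 1)))) ≤ 2 * r (η n) (η n)
          + 2 * r (j (k⁻¹ • (θ n - θ (n - 1)))) (j (k⁻¹ • (θ n - θ (n - 1)))) := by
      intro n
      have h2 : duc (n * k) - j (k⁻¹ • (U n - U (n - 1))) = -η n + j (k⁻¹ • (θ n - θ (n - 1))) := by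
        rw [hsplit, map_sub]
        simp only [hη]
        abel
      have h3 := form_add_self_le hr hr0 (-η n) (j (k⁻¹ • (θ n - θ (n - 1))))
      rw [h2]
      simpa only [map_neg, neg_apply, neg_neg] using h3
    have h2 := Finset.sum_le_sum fun n (_ : n ∈ Finset.Icc 1 N) => h1 n
    rw [Finset.sum_add_distrib, ← Finset.mul_sum, ← Finset.mul_sum] at h2
    have h3 := hen N le_rfl
    have h4 := ha0 (θ' N)
    have h5 := ha0 y
    have h6 := mul_le_mul_of_nonneg_left h2 hk0.le
    have h7 : k * ∑ n ∈ Finset.Icc 1 N, r (η n) (η n) ≤ S := by rw [hS]; linarith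
    linarith
  calc _ ≤ ‖r‖ * ‖j‖ ^ 2 * Q * D + T * Q * D + 4 * S₀ * D :=
        add_le_add (add_le_add hmax hsum) hder
    _ ≤ (‖r‖ * ‖j‖ ^ 2 * Q + T * Q + 4 * S₀ + 1) * D := by linarith

end AbstractEstimates

/-! ### The eddy-current problem -/

section EddyCurrent

variable {T : ℝ} {Ω Ωc : Set Plane} {σ μ : Plane → ℝ} {J : ℝ → L2 Ω} {u du : ℝ → H01 Ω}
  {u₀ : L2 Ω}

lemma completeSpace_H01 : CompleteSpace (H01 Ω) :=
  (Submodule.isClosed_topologicalClosure (Submodule.span ℝ (testPairs Ω))).completeSpace_coe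

/-- Under the regularity assumption the equation holds pointwise in time. -/
lemma IsEddySolution.load_ae_eq (hu : IsEddySolution T Ωc σ μ u₀ J u)
    (hJ : MemLp J 2 (timeMeasure T)) (hdu : MemLp du 2 (timeMeasure T)) (hud : IsTimeDeriv T u du)
    {r : L2 Ω →L[ℝ] L2 Ω →L[ℝ] ℝ} (hr : ∀ v w, r v w = rForm σ Ωc v w)
    {a : H01 Ω →L[ℝ] H01 Ω →L[ℝ] ℝ} (ha : ∀ v w, a v w = aForm μ v w) (v : H01 Ω) :
    (fun t => load (J t) v) =ᵐ[timeMeasure T]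
      fun t => r (toL2 (du t)) (toL2 v) + a (u t) v := by
  have := completeSpace_H01 (Ω := Ω)
  set ℓ : H01 Ω →L[ℝ] ℝ := (r.flip (toL2 v)).comp (toL2L Ω) with hℓ
  have hℓ' : ∀ w, ℓ w = r (toL2 w) (toL2 v) := fun w => rfl
  set g : H01 Ω →L[ℝ] ℝ := a.flip v with hg
  have hg' : ∀ w, g w = a w v := fun w => rfl
  set q : L2 Ω →L[ℝ] ℝ := innerSL ℝ (toL2 v) with hq
  have hq' : ∀ f, q f = load f v := fun f => by
    rw [load_eq_inner, hq, innerSL_apply_apply, real_inner_comm]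
  have hui := MemLp.integrable_timeMeasure hu.memLp
  have hdui := MemLp.integrable_timeMeasure hdu
  have hJi := MemLp.integrable_timeMeasure hJ
  have h1 := ℓ.integrable_comp hdui
  have h2 := g.integrable_comp hui
  have h3 := q.integrable_comp hJi
  have hmul : ∀ {φ f : ℝ → ℝ}, Continuous φ → HasCompactSupport φ →
      Integrable f (timeMeasure T) → Integrable (fun t => φ t * f t) (timeMeasure T) := by
    intro φ f hφ hφc hf
    obtain ⟨M, hM⟩ := hφc.exists_bound_of_continuous hφ
    exact hf.bdd_mul hφ.aestronglyMeasurable (Filter.Eventually.of_forall hM)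
  have hfin : ∀ᵐ t, t ∈ Ioo 0 T → ℓ (du t) + g (u t) - q (J t) = 0 := by
    refine isOpen_Ioo.ae_eq_zero_of_integral_contDiff_smul_eq_zero ?_ fun φ hφ hφc hφs => ?_
    · exact IntegrableOn.locallyIntegrableOn ((h1.add h2).sub h3)
    · have heq := hu.equation v φ ⟨hφ, hφc, hφs⟩
      have hder := congrArg ℓ (hud φ ⟨hφ, hφc, hφs⟩)
      have hdc : Continuous (deriv φ) := hφ.continuous_deriv (by simp)
      have hbd : ∀ {φ : ℝ → ℝ} {f : ℝ → H01 Ω}, Continuous φ → HasCompactSupport φ →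
          Integrable f (timeMeasure T) → Integrable (fun t => φ t • f t) (timeMeasure T) := by
        intro φ f hφ hφc hf
        obtain ⟨M, hM⟩ := hφc.exists_bound_of_continuous hφ
        exact hf.bdd_smul M hφ.aestronglyMeasurable (Filter.Eventually.of_forall hM)
      rw [map_neg, ← ℓ.integral_comp_comm (hbd hφ.continuous hφc hdui),
        ← ℓ.integral_comp_comm (hbd hdc hφc.deriv hui)] at hder
      simp only [map_smul, smul_eq_mul] at hder
      simp only [← hr, ← ha, ← hℓ', ← hg', ← hq'] at heq
      rw [← setIntegral_eq_integral_of_forall_compl_eq_zero (s := Ioo 0 T) fun t ht => by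
          rw [image_eq_zero_of_notMem_tsupport fun hmem => ht (hφs hmem), zero_smul]]
      have hs1 := hmul hφ.continuous hφc h1
      have hs2 := hmul hφ.continuous hφc h2
      have hs3 := hmul hφ.continuous hφc h3
      simp only [smul_eq_mul, mul_sub, mul_add]
      have e1 := integral_sub (hs1.add hs2) hs3
      have e2 := integral_add hs1 hs2
      simp only [Pi.add_apply] at e1
      have e3 : ∀ f : ℝ → ℝ, ∫ t, f t * φ t ∂(timeMeasure T) = ∫ t, φ t * f t ∂(timeMeasure T) :=
        fun f => by simp only [mul_comm]
      have e4 : ∫ t, ℓ (u t) * deriv φ t ∂(timeMeasure T)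
          = ∫ t, deriv φ t * ℓ (u t) ∂(timeMeasure T) := by simp only [mul_comm]
      rw [e3, e3, e4, ← hder] at heq
      rw [e1, e2, heq, sub_self]
  change ∀ᵐ t ∂(timeMeasure T), load (J t) v = r (toL2 (du t)) (toL2 v) + a (u t) v
  rw [ae_restrict_iff' measurableSet_Ioo]
  filter_upwards [hfin] with t ht hmem
  rw [← hℓ', ← hg', ← hq']
  linarith [ht hmem]

/-- A continuous representative is determined on `[0,T]`. -/
lemma HasTimeValue.eq_of_ae_eq {E : Type*} [NormedAddCommGroup E] [NormedSpace ℝ E] {f g : ℝ → E}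
    {t : ℝ} {b : E} (hT : 0 < T) (h : HasTimeValue T f t b) (ht : t ∈ Icc 0 T)
    (hg : ContinuousOn g (Icc 0 T)) (hfg : f =ᵐ[timeMeasure T] g) : b = g t := by
  obtain ⟨g', ⟨hg', hfg'⟩, rfl⟩ := h
  exact eqOn_Icc_of_ae_eq hT hg' hg (hfg'.symm.trans hfg) ht

end EddyCurrent

theorem theorem5
    (T : ℝ) (hT : 0 < T)
    (Ω Ωc : Set Plane) (hΩ : IsLipschitzPolygon Ω) (hΩc : IsLipschitzPolygon Ωc) (hsub : Ωc ⊆ Ω)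
    (σ μ : Plane → ℝ) (σmin σmax μmin μmax : ℝ) (hσmin : 0 < σmin) (hμmin : 0 < μmin)
    (hσm : AEMeasurable σ (volume.restrict Ωc)) (hμm : AEMeasurable μ (volume.restrict Ω))
    (hσ : ∀ᵐ x ∂(volume.restrict Ωc), σmin ≤ σ x ∧ σ x ≤ σmax)
    (hμ : ∀ᵐ x ∂(volume.restrict Ω), μmin ≤ μ x ∧ μ x ≤ μmax)
    {ι : Type*} (𝒯 : ι → TriMesh Ω Ωc) (hreg : IsRegularFamily 𝒯) :
    ∃ C : ℝ, 0 < C ∧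
      ∀ (u₀ : H01 Ω) (J : ℝ → L2 Ω) (u du : ℝ → H01 Ω) (ddu : ℝ → L2 Ω),
        MemLp J 2 (timeMeasure T) →
        IsEddySolution T Ωc σ μ (toL2 u₀) J u →
        -- `u ∈ H¹(0,T;H¹₀(Ω))`, with `∂ₜu = du`
        MemLp du 2 (timeMeasure T) → IsTimeDeriv T u du →
        -- `u ∈ H²(0,T;L²(Ω))`, with `∂ₜₜu = ddu`
        MemLp ddu 2 (timeMeasure T) → IsTimeDeriv T (fun t => toL2 (du t)) ddu →
        -- `u` and `∂ₜu` have continuous representatives `uc`, `duc`, used at the nodes `tₙ`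
        ∃ (uc : ℝ → H01 Ω) (duc : ℝ → L2 Ω),
          IsContRep T u uc ∧ IsContRep T (fun t => toL2 (du t)) duc ∧
          ∀ (i : ι) (N : ℕ) (U : ℕ → H01 Ω), 1 ≤ N →
            IsDiscreteSolution T σ μ J (𝒯 i) N U →
            (⨆ n : Finset.Icc 1 N,
                sigmaNormSq σ Ωc (toL2 (uc ((n : ℕ) * (T / N)) - U n)))
              + (T / N) * ∑ n ∈ Finset.Icc 1 N, ‖uc (n * (T / N)) - U n‖ ^ 2
              + (T / N) * ∑ n ∈ Finset.Icc 1 N,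
                  sigmaNormSq σ Ωc
                    (duc (n * (T / N)) - toL2 ((T / N)⁻¹ • (U n - U (n - 1))))
            ≤ C * (‖u₀ - U 0‖ ^ 2
              + (⨆ n : Finset.Icc 0 N,
                  ⨅ v : P1 (𝒯 i), ‖uc ((n : ℕ) * (T / N)) - (v : H01 Ω)‖ ^ 2)
              + (∫ t, (⨅ v : P1 (𝒯 i), ‖du t - (v : H01 Ω)‖ ^ 2) ∂(timeMeasure T))
              + (T / N) ^ 2 * ∫ t, ‖ddu t‖ ^ 2 ∂(timeMeasure T)) := by
  have := completeSpace_H01 (Ω := Ω)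
  obtain ⟨κ, hκ⟩ := hreg
  have hshape : ∀ i, IsShapeRegular κ (𝒯 i) := hκ
  obtain ⟨Ce, -, hext⟩ := exists_discrete_extension hΩ hΩc hsub κ
  obtain ⟨r, hr⟩ := exists_rForm_clm hΩc.1.measurableSet hsub hσmin hσm hσ
  obtain ⟨a, ha⟩ := exists_aForm_clm hμmin hμm hμ
  obtain ⟨α, hα, hcoer⟩ := exists_aForm_coercive hΩ hμmin hμm hμ
  obtain ⟨C, hC, hmain⟩ := exists_backward_euler_error_bound r
    (fun v w => by rw [hr, hr, rForm_comm]) (fun v => by rw [hr]; exact rForm_self_nonneg hσmin hσ v)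
    a (fun v w => by rw [ha, ha, aForm_comm]) hα (fun v => by rw [ha]; exact hcoer v) (toL2L Ω) hT Ce
  refine ⟨C, hC, fun u₀ J u du ddu hJ hu hdu hud hddu hdud => ?_⟩
  obtain ⟨uc, huc, huc'⟩ := exists_isContRep hT (MemLp.integrable_timeMeasure hu.memLp)
    (MemLp.integrable_timeMeasure hdu) hud
  obtain ⟨duc, hduc, hduc'⟩ := exists_isContRep hT
    ((toL2L Ω).integrable_comp (MemLp.integrable_timeMeasure hdu))
    (MemLp.integrable_timeMeasure hddu) hdud
  refine ⟨uc, duc, huc, hduc, fun i N U hN hU => ?_⟩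
  have hnull : ∀ w : L2 Ω, r w w = 0 ↔ w =ᵐ[volume.restrict Ωc] 0 := fun w => by
    rw [hr]
    exact ⟨ae_eq_zero_of_rForm_self_eq_zero hsub hσmin hσm hσ, fun h => ae_eq_zero_rForm w h⟩
  have hsubae : ∀ v w : H01 Ω, toL2 (v - w) =ᵐ[volume.restrict Ωc] 0 ↔
      toL2 v =ᵐ[volume.restrict Ωc] toL2 w := by
    intro v w
    have h1 : toL2 (v - w) =ᵐ[volume.restrict Ωc] fun x => toL2 v x - toL2 w x :=
      ae_restrict_of_ae_restrict_of_subset hsub (Lp.coeFn_sub (toL2 v) (toL2 w))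
    constructor
    · intro h
      filter_upwards [h, h1] with x h2 h3
      rw [h3] at h2
      exact sub_eq_zero.1 h2
    · intro h
      filter_upwards [h, h1] with x h2 h3
      rw [h3, h2, sub_self, Pi.zero_apply]
  have hN0 : (0 : ℝ) < N := by exact_mod_cast hN
  have h0 : (0 : ℝ) ∈ Icc 0 T := left_mem_Icc.2 hT.le
  simp only [sigmaNormSq_eq_rForm, ← hr]
  refine hmain (P1 (𝒯 i)) (finiteDimensional_P1 hΩ (hshape i)) ?_ u₀ uc du duc ddu hdu hddu huc'
    hduc' hduc.1 hduc.2 ?_ N U hN hU.mem ?_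
  · intro d hd w hw
    obtain ⟨y, hy, hyd, hyw⟩ := hext (𝒯 i) (hshape i) d hd w ((hsubae w d).1 ((hnull _).1 hw))
    exact ⟨y, hy, (hnull _).2 ((hsubae y d).2 hyd), hyw⟩
  · have hc : ∀ v : H01 Ω, ContinuousOn (fun t => r (toL2 (uc t)) (toL2 v)) (Icc 0 T) := fun v =>
      ((r.flip (toL2 v)).comp (toL2L Ω)).continuous.comp_continuousOn huc.1
    have h1 : ∀ v : H01 Ω, r (toL2 u₀) (toL2 v) = r (toL2 (uc 0)) (toL2 v) := fun v => by
      have h2 := hu.initial v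
      simp only [← hr] at h2
      refine h2.eq_of_ae_eq hT h0 (hc v) ?_
      filter_upwards [huc.2] with t ht
      rw [ht]
    have h2 : ∀ v : H01 Ω, r (toL2L Ω (uc 0 - u₀)) (toL2 v) = 0 := fun v => by
      rw [map_sub (toL2L Ω), map_sub r, sub_apply, sub_eq_zero]
      exact (h1 v).symm
    exact h2 (uc 0 - u₀)
  · intro n hn1 hnN v hv
    have htn : (n : ℝ) * (T / N) ∈ Icc 0 T := by
      refine ⟨by positivity, ?_⟩
      rw [mul_div_assoc', div_le_iff₀ hN0, mul_comm]
      exact mul_le_mul_of_nonneg_left (by exact_mod_cast hnN) hT.le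
    have hc : ContinuousOn (fun t => r (duc t) (toL2 v) + a (uc t) v) (Icc 0 T) :=
      ((r.flip (toL2 v)).continuous.comp_continuousOn hduc.1).add
        ((a.flip v).continuous.comp_continuousOn huc.1)
    have h1 := (hU.equation n hn1 hnN v hv).eq_of_ae_eq hT htn hc (by
      filter_upwards [hu.load_ae_eq hJ hdu hud hr ha v, huc.2, hduc.2] with t h1 h2 h3
      rw [h1, ← h2, ← h3]
      rfl)
    rw [← hr, ← ha] at h1
    exact h1
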